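/- **Proposition.** Let $p$ be a prime. Work on the category of all schemes with the fpqc topology, and view commutative group schemes over $\mathbb Z$ as fpqc sheaves of abelian groups. For a complex $d:A\to B$ of two such sheaves let $\mathrm{Cone}(A\xrightarrow{d} B)$ be the strictly commutative Picard stack associated with $S\mapsto \mathrm{Cone}(A(S)\to B(S))$, where $\mathrm{Cone}(A(S)\to B(S))$ is the groupoid whose objects are the elements of $B(S)$ and whose morphisms $b\to b'$ are the $a\in A(S)$ with $b+d(a)=b'$; this is functorial in the complex. Let $W$ be the ring scheme of $p$-typical Witt vectors, with Frobenius $F$ and Verschiebung $V$, let $W\to\mathbb G_a$, $w\mapsto w_0$, be the canonical homomorphism $W\to W/VW=\mathbb G_a$, and let $\mathbb G_a^\sharp$ be the spectrum of the subring of $\mathbb Q[x]$ generated by the elements $x^{p^n}/p^{(p^n-1)/(p-1)}$, $n\ge 0$, with the group law given by $x\mapsto x\otimes 1+1\otimes x$, and with its canonical homomorphism to $\mathbb G_a$ (the element $x$). Then there is a canonical isomorphism of Picard stacks over $\mathbb Z$ $$\mathrm{Cone}(\mathbb G_a^\sharp\to\mathbb G_a)\;\xrightarrow{\ \sim\ }\;\mathrm{Cone}(W\xrightarrow{\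 p\ }W).$$ Precisely: there is a unique homomorphism of group schemes $\sigma:\mathbb G_a^\sharp\to W$ such that $F\circ\sigma=0$ and the composition of $\sigma$ with $W\to\mathbb G_a$ is the canonical homomorphism. Let $K$ be the complex $\mathbb G_a^\sharp\times W\to W$, $(x,b)\mapsto\sigma(x)+V(b)$, let $q_1:K\to(\mathbb G_a^\sharp\to\mathbb G_a)$ be the morphism of complexes given by $(x,b)\mapsto x$ and $w\mapsto w_0$, and let $q_2:K\to(W\xrightarrow{p}W)$ be the one given by $(x,b)\mapsto b$ and $w\mapsto F(w)$. Then $\mathrm{Cone}(q_1)$ is an isomorphism of Picard stacks, and there is an isomorphism of Picard stacks $\Phi:\mathrm{Cone}(\mathbb G_a^\sharp\to\mathbb G_a)\to\mathrm{Cone}(W\xrightarrow{p}W)$ such that $\Phi\circ\mathrm{Cone}(q_1)$ is isomorphic to $\mathrm{Cone}(q_2)$ as a morphism of Picard stacks. -/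

import Mathlib

set_option linter.unusedVariables false
set_option linter.checkUnivs false
open CategoryTheory Opposite MonoidalCategory

universe w v₁ u₁ v₂ u₂ u

/-- A two-term complex `A → B` of sheaves of abelian groups on the site `(C, J)`. -/
structure TwoTerm {C : Type u₁} [Category.{v₁} C] (J : GrothendieckTopology C) where
  A : Cᵒᵖ ⥤ AddCommGrpCat.{w}
  B : Cᵒᵖ ⥤ AddCommGrpCat.{w}
  d : A ⟶ B
  isSheaf_A : Presieve.IsSheaf J (A ⋙ forget AddCommGrpCat.{w})
  isSheaf_B : Presieve.IsSheaf J (B ⋙ forget AddCommGrpCat.{w})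

namespace TwoTerm

variable {C : Type u₁} [Category.{v₁} C]

/-- The restriction map `A(Y) → A(Z)` along `g : Z ⟶ Y`. -/
def res (A : Cᵒᵖ ⥤ AddCommGrpCat.{w}) {Y Z : C} (g : Z ⟶ Y) :
    A.obj (op Y) →+ A.obj (op Z) := (A.map g.op).hom

@[simp] lemma res_id (A : Cᵒᵖ ⥤ AddCommGrpCat.{w}) {Y : C} (x : A.obj (op Y)) :
    res A (𝟙 Y) x = x := by simp [res]

@[simp] lemma res_res (A : Cᵒᵖ ⥤ AddCommGrpCat.{w}) {Y Z T : C} (g : Z ⟶ Y) (h : T ⟶ Z)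
    (x : A.obj (op Y)) : res A h (res A g x) = res A (h ≫ g) x := by simp [res]

lemma res_app {A B : Cᵒᵖ ⥤ AddCommGrpCat.{w}} (φ : A ⟶ B) {Y Z : C} (g : Z ⟶ Y)
    (x : A.obj (op Y)) : res B g ((φ.app (op Y)).hom x) = (φ.app (op Z)).hom (res A g x) := by
  simp [res]

variable {J : GrothendieckTopology C}

lemma sep {A : Cᵒᵖ ⥤ AddCommGrpCat.{w}} (hA : Presieve.IsSheaf J (A ⋙ forget AddCommGrpCat.{w}))
    {Y : C} {S : Sieve Y} (hS : S ∈ J Y) {s t : A.obj (op Y)}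
    (h : ∀ ⦃Z⦄ (g : Z ⟶ Y), S g → res A g s = res A g t) : s = t :=
  (hA S hS).isSeparatedFor.ext (fun _ g hg => h g hg)

lemma glue {A : Cᵒᵖ ⥤ AddCommGrpCat.{w}} (hA : Presieve.IsSheaf J (A ⋙ forget AddCommGrpCat.{w}))
    {Y : C} {S : Sieve Y} (hS : S ∈ J Y) (x : ∀ ⦃Z⦄ (g : Z ⟶ Y), S g → A.obj (op Z))
    (hx : ∀ ⦃Z T⦄ (g : Z ⟶ Y) (h : T ⟶ Z) (hg : S g),
      res A h (x g hg) = x (h ≫ g) (S.downward_closed hg h)) :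
    ∃ s : A.obj (op Y), ∀ ⦃Z⦄ (g : Z ⟶ Y) (hg : S g), res A g s = x g hg := by
  let x' : Presieve.FamilyOfElements (A ⋙ forget AddCommGrpCat.{w}) S.arrows := x
  have hc : x'.Compatible := by
    rw [Presieve.compatible_iff_sieveCompatible]
    intro Z T g h hg
    exact (hx g h hg).symm
  obtain ⟨s, hs, -⟩ := hA S hS _ hc
  exact ⟨s, fun Z g hg => hs g hg⟩

variable (K : TwoTerm.{w} J)

/-- The differential on sections. -/
def dAt (Y : C) : K.A.obj (op Y) →+ K.B.obj (op Y) := (K.d.app (op Y)).hom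

lemma res_dAt {Y Z : C} (g : Z ⟶ Y) (x : K.A.obj (op Y)) :
    res K.B g (K.dAt Y x) = K.dAt Z (res K.A g x) := res_app K.d g x

/-- An object over `X` of the stack associated with the presheaf of groupoids
`Y ↦ Cone (A(Y) → B(Y))`, where the objects of `Cone (A(Y) → B(Y))` are the elements of `B(Y)` and
the morphisms `b ⟶ b'` are the `c ∈ A(Y)` with `b + d c = b'`, composed by addition.
It is given by a descent datum in this presheaf of groupoids, relative to a covering sieve of `X`. -/
structure ConeObj (X : C) where
  sieve : Sieve X
  mem : sieve ∈ J X
  /-- the object `b f` over `Y`, for every `f : Y ⟶ X` in the sieve -/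
  b : ∀ ⦃Y : C⦄ (f : Y ⟶ X), sieve f → K.B.obj (op Y)
  /-- the transition isomorphism `g^* (b f) ⟶ b (g ≫ f)` -/
  a : ∀ ⦃Y Z : C⦄ (f : Y ⟶ X) (_ : Z ⟶ Y), sieve f → K.A.obj (op Z)
  d_a : ∀ ⦃Y Z : C⦄ (f : Y ⟶ X) (g : Z ⟶ Y) (hf : sieve f),
    res K.B g (b f hf) + K.dAt Z (a f g hf) = b (g ≫ f) (sieve.downward_closed hf g)
  cocycle : ∀ ⦃Y Z T : C⦄ (f : Y ⟶ X) (g : Z ⟶ Y) (h : T ⟶ Z) (hf : sieve f),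
    a f (h ≫ g) hf = res K.A h (a f g hf) + a (g ≫ f) h (sieve.downward_closed hf g)

namespace ConeObj

variable {K} {X : C}

/-- A morphism of descent data, defined on the common refinement of the covering sieves. -/
@[ext]
structure Hom (x y : K.ConeObj X) where
  /-- the morphism `x.b f ⟶ y.b f` -/
  c : ∀ ⦃Y : C⦄ (f : Y ⟶ X), x.sieve f → y.sieve f → K.A.obj (op Y)
  d_c : ∀ ⦃Y : C⦄ (f : Y ⟶ X) (hx : x.sieve f) (hy : y.sieve f),
    x.b f hx + K.dAt Y (c f hx hy) = y.b f hy
  nat : ∀ ⦃Y Z : C⦄ (f : Y ⟶ X) (g : Z ⟶ Y) (hx : x.sieve f) (hy : y.sieve f),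
    x.a f g hx + c (g ≫ f) (x.sieve.downward_closed hx g) (y.sieve.downward_closed hy g) =
      res K.A g (c f hx hy) + y.a f g hy

lemma a_id (x : K.ConeObj X) {Y : C} (f : Y ⟶ X) (hf : x.sieve f) : x.a f (𝟙 Y) hf = 0 := by
  have := x.cocycle f (𝟙 Y) (𝟙 Y) hf
  simpa using this

/-- Two morphisms which agree on a covering sieve are equal. -/
lemma Hom.ext_of {x y : K.ConeObj X} {T : Sieve X} (hT : T ∈ J X) {φ ψ : Hom x y}
    (h : ∀ ⦃Y⦄ (f : Y ⟶ X) (_ : T f) (hx : x.sieve f) (hy : y.sieve f),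
      φ.c f hx hy = ψ.c f hx hy) : φ = ψ := by
  ext Y f hx hy
  refine sep K.isSheaf_A (J.pullback_stable f hT) (fun Z g hg => ?_)
  have h1 := φ.nat f g hx hy
  have h2 := ψ.nat f g hx hy
  rw [h _ hg] at h1
  exact add_right_cancel (h1.symm.trans h2)

/-- A morphism may be given on a covering sieve. -/
lemma Hom.exists_glue (x y : K.ConeObj X) {T : Sieve X} (hT : T ∈ J X)
    (c : ∀ ⦃Y⦄ (f : Y ⟶ X), T f → x.sieve f → y.sieve f → K.A.obj (op Y))
    (d_c : ∀ ⦃Y : C⦄ (f : Y ⟶ X) (hT : T f) (hx : x.sieve f) (hy : y.sieve f),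
      x.b f hx + K.dAt Y (c f hT hx hy) = y.b f hy)
    (nat : ∀ ⦃Y Z : C⦄ (f : Y ⟶ X) (g : Z ⟶ Y) (hT : T f) (hx : x.sieve f) (hy : y.sieve f),
      x.a f g hx + c (g ≫ f) (T.downward_closed hT g) (x.sieve.downward_closed hx g)
        (y.sieve.downward_closed hy g) = res K.A g (c f hT hx hy) + y.a f g hy) :
    ∃ φ : Hom x y, ∀ ⦃Y⦄ (f : Y ⟶ X) (hT : T f) (hx : x.sieve f) (hy : y.sieve f),
      φ.c f hx hy = c f hT hx hy := by
  have key : ∀ ⦃Y⦄ (f : Y ⟶ X) (hx : x.sieve f) (hy : y.sieve f),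
      ∃ s : K.A.obj (op Y), ∀ ⦃Z⦄ (g : Z ⟶ Y) (hg : T (g ≫ f)), res K.A g s =
        x.a f g hx + c (g ≫ f) hg (x.sieve.downward_closed hx g)
          (y.sieve.downward_closed hy g) - y.a f g hy := by
    intro Y f hx hy
    refine glue K.isSheaf_A (J.pullback_stable f hT) (fun Z g hg => x.a f g hx +
      c (g ≫ f) hg (x.sieve.downward_closed hx g) (y.sieve.downward_closed hy g) - y.a f g hy) ?_
    intro Z T' g h hg
    have h1 := nat (g ≫ f) h hg (x.sieve.downward_closed hx g) (y.sieve.downward_closed hy g)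
    have h2 := x.cocycle f g h hx
    have h3 := y.cocycle f g h hy
    simp only [map_add, map_sub, Category.assoc] at h1 h2 h3 ⊢
    rw [h2, h3, eq_sub_of_add_eq h1.symm]
    abel
  choose s hs using key
  refine ⟨⟨s, ?_, ?_⟩, ?_⟩
  · intro Y f hx hy
    refine sep K.isSheaf_B (J.pullback_stable f hT) (fun Z g hg => ?_)
    have h1 := d_c (g ≫ f) hg (x.sieve.downward_closed hx g) (y.sieve.downward_closed hy g)
    have h2 := x.d_a f g hx
    have h3 := y.d_a f g hy
    rw [map_add, res_dAt, hs f hx hy g hg, map_sub, map_add]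
    rw [← h2, ← h3] at h1
    rw [← add_right_cancel_iff (a := K.dAt Z (y.a f g hy)), ← h1]
    abel
  · intro Y Z f g hx hy
    refine sep K.isSheaf_A (J.pullback_stable (g ≫ f) hT) (fun U h hg => ?_)
    have h1 := hs (g ≫ f) (x.sieve.downward_closed hx g) (y.sieve.downward_closed hy g) h hg
    have h2 := hs f hx hy (h ≫ g) (by simpa using hg)
    have h3 := x.cocycle f g h hx
    have h4 := y.cocycle f g h hy
    simp only [map_add, res_res, Category.assoc] at h1 h2 h3 h4 ⊢
    rw [h1, h2, h3, h4]
    abel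
  · intro Y f hT' hx hy
    have h1 := hs f hx hy (𝟙 Y) (by simpa using hT')
    simpa [a_id] using h1

/-- Composition is determined by addition of the components on the common refinement. -/
lemma Hom.exists_comp {x y z : K.ConeObj X} (φ : Hom x y) (ψ : Hom y z) :
    ∃ χ : Hom x z, ∀ ⦃Y⦄ (f : Y ⟶ X) (hx : x.sieve f) (hy : y.sieve f) (hz : z.sieve f),
      χ.c f hx hz = φ.c f hx hy + ψ.c f hy hz := by
  obtain ⟨χ, hχ⟩ := Hom.exists_glue x z y.mem (fun Y f hy hx hz => φ.c f hx hy + ψ.c f hy hz)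
    (fun Y f hy hx hz => by rw [map_add, ← add_assoc, φ.d_c, ψ.d_c])
    (fun Y Z f g hy hx hz => by
      rw [← add_assoc, φ.nat f g hx hy, add_assoc, ψ.nat f g hy hz, map_add, add_assoc])
  exact ⟨χ, fun Y f hx hy hz => hχ f hy hx hz⟩

noncomputable instance : Category (K.ConeObj X) where
  Hom := Hom
  id x :=
    { c := fun _ _ _ _ => 0
      d_c := by simp
      nat := by simp }
  comp φ ψ := (Hom.exists_comp φ ψ).choose
  id_comp {x y} φ := Hom.ext_of (J.intersection_covering x.mem y.mem) fun Y f hT hx hy => by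
    rw [(Hom.exists_comp _ φ).choose_spec f hx hx hy, zero_add]
  comp_id {x y} φ := Hom.ext_of (J.intersection_covering x.mem y.mem) fun Y f hT hx hy => by
    rw [(Hom.exists_comp φ _).choose_spec f hx hy hy, add_zero]
  assoc {x y z t} φ ψ χ := Hom.ext_of (J.intersection_covering y.mem z.mem) fun Y f hT hx ht => by
    rw [(Hom.exists_comp _ χ).choose_spec f hx hT.2 ht,
      (Hom.exists_comp φ ψ).choose_spec f hx hT.1 hT.2,
      (Hom.exists_comp φ _).choose_spec f hx hT.1 ht,
      (Hom.exists_comp ψ χ).choose_spec f hT.1 hT.2 ht, add_assoc]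

lemma hom_ext {x y : K.ConeObj X} {φ ψ : x ⟶ y} (h : ∀ ⦃Y⦄ (f : Y ⟶ X) (hx : x.sieve f)
    (hy : y.sieve f), Hom.c φ f hx hy = Hom.c ψ f hx hy) : φ = ψ :=
  Hom.ext (by funext Y f hx hy; exact h f hx hy)

@[simp] lemma id_c (x : K.ConeObj X) {Y : C} (f : Y ⟶ X) (hx hx' : x.sieve f) :
    Hom.c (𝟙 x) f hx hx' = 0 := rfl

lemma comp_c {x y z : K.ConeObj X} (φ : x ⟶ y) (ψ : y ⟶ z) {Y : C} (f : Y ⟶ X)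
    (hx : x.sieve f) (hz : z.sieve f) (hy : y.sieve f) :
    Hom.c (φ ≫ ψ) f hx hz = Hom.c φ f hx hy + Hom.c ψ f hy hz :=
  (Hom.exists_comp φ ψ).choose_spec f hx hy hz

lemma square_c {x y y' z : K.ConeObj X} {φ : x ⟶ y} {ψ : y ⟶ z} {φ' : x ⟶ y'} {ψ' : y' ⟶ z}
    {Y : C} {f : Y ⟶ X} {hx : x.sieve f} {hz : z.sieve f} (hy : y.sieve f) (hy' : y'.sieve f)
    (h : Hom.c φ f hx hy + Hom.c ψ f hy hz = Hom.c φ' f hx hy' + Hom.c ψ' f hy' hz) :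
    Hom.c (φ ≫ ψ) f hx hz = Hom.c (φ' ≫ ψ') f hx hz := by
  rw [comp_c φ ψ f hx hz hy, comp_c φ' ψ' f hx hz hy', h]

/-- A morphism with vanishing components between descent data with equal values. -/
def zeroHom (x y : K.ConeObj X)
    (hb : ∀ ⦃Y : C⦄ (f : Y ⟶ X) (hx : x.sieve f) (hy : y.sieve f), x.b f hx = y.b f hy)
    (ha : ∀ ⦃Y Z : C⦄ (f : Y ⟶ X) (g : Z ⟶ Y) (hx : x.sieve f) (hy : y.sieve f),
      x.a f g hx = y.a f g hy) : x ⟶ y where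
  c := fun _ _ _ _ => 0
  d_c := fun Y f hx hy => by rw [map_zero, add_zero, hb f hx hy]
  nat := fun Y Z f g hx hy => by rw [map_zero, add_zero, zero_add, ha f g hx hy]

/-- The isomorphism with vanishing components. -/
def zeroIso (x y : K.ConeObj X)
    (hb : ∀ ⦃Y : C⦄ (f : Y ⟶ X) (hx : x.sieve f) (hy : y.sieve f), x.b f hx = y.b f hy)
    (ha : ∀ ⦃Y Z : C⦄ (f : Y ⟶ X) (g : Z ⟶ Y) (hx : x.sieve f) (hy : y.sieve f),
      x.a f g hx = y.a f g hy) : x ≅ y where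
  hom := zeroHom x y hb ha
  inv := zeroHom y x (fun _ f hx hy => (hb f hy hx).symm) (fun _ _ f g hx hy => (ha f g hy hx).symm)
  hom_inv_id := Hom.ext_of y.mem fun Y f hT hx hx' => by
    rw [comp_c _ _ f hx hx' hT]; exact add_zero _
  inv_hom_id := Hom.ext_of x.mem fun Y f hT hx hx' => by
    rw [comp_c _ _ f hx hx' hT]; exact add_zero _

@[simp] lemma zeroIso_hom_c (x y : K.ConeObj X) (hb ha) {Y : C} (f : Y ⟶ X) (hx : x.sieve f)
    (hy : y.sieve f) : Hom.c (zeroIso x y hb ha).hom f hx hy = 0 := rfl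

@[simp] lemma zeroIso_inv_c (x y : K.ConeObj X) (hb ha) {Y : C} (f : Y ⟶ X) (hx : x.sieve f)
    (hy : y.sieve f) : Hom.c (zeroIso x y hb ha).inv f hy hx = 0 := rfl

/-- A morphism whose components vanish locally. -/
class IsTriv {x y : K.ConeObj X} (φ : x ⟶ y) : Prop where
  exists_sieve : ∃ T ∈ J X, ∀ ⦃Y⦄ (f : Y ⟶ X) (_ : T f) (hx : x.sieve f) (hy : y.sieve f),
    Hom.c φ f hx hy = 0

lemma IsTriv.of_c {x y : K.ConeObj X} {φ : x ⟶ y} (h : ∀ ⦃Y⦄ (f : Y ⟶ X) (hx : x.sieve f)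
    (hy : y.sieve f), Hom.c φ f hx hy = 0) : IsTriv φ := ⟨⊤, J.top_mem X, fun _ f _ => h f⟩

lemma eq_of_isTriv {x y : K.ConeObj X} (φ ψ : x ⟶ y) [hφ : IsTriv φ] [hψ : IsTriv ψ] : φ = ψ := by
  obtain ⟨T, hT, h⟩ := hφ
  obtain ⟨T', hT', h'⟩ := hψ
  exact Hom.ext_of (J.intersection_covering hT hT') fun Y f hf hx hy => by
    rw [h f hf.1 hx hy, h' f hf.2 hx hy]

instance (x : K.ConeObj X) : IsTriv (𝟙 x) := .of_c fun _ _ _ _ => rfl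
instance (x y : K.ConeObj X) (hb ha) : IsTriv (zeroIso x y hb ha).hom := .of_c fun _ _ _ _ => rfl
instance (x y : K.ConeObj X) (hb ha) : IsTriv (zeroIso x y hb ha).inv := .of_c fun _ _ _ _ => rfl
instance {x y z : K.ConeObj X} (φ : x ⟶ y) (ψ : y ⟶ z) [hφ : IsTriv φ] [hψ : IsTriv ψ] :
    IsTriv (φ ≫ ψ) := by
  obtain ⟨T, hT, h⟩ := hφ
  obtain ⟨T', hT', h'⟩ := hψ
  refine ⟨(T ⊓ T') ⊓ y.sieve, J.intersection_covering (J.intersection_covering hT hT') y.mem,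
    fun Y f hf hx hy => ?_⟩
  rw [comp_c φ ψ f hx hy hf.2, h f hf.1.1, h' f hf.1.2, add_zero]

lemma IsTriv.comp {x y z : K.ConeObj X} {φ : x ⟶ y} {ψ : y ⟶ z} (_ : IsTriv φ) (_ : IsTriv ψ) :
    IsTriv (φ ≫ ψ) := inferInstance

instance : IsGroupoid (K.ConeObj X) where
  all_isIso {x y} φ := by
    let ψ : y ⟶ x :=
      { c := fun Y f hy hx => -Hom.c φ f hx hy
        d_c := fun Y f hy hx => by
          rw [← Hom.d_c φ f hx hy, map_neg, add_neg_cancel_right]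
        nat := fun Y Z f g hy hx => by
          have := Hom.nat φ f g hx hy
          rw [map_neg, ← sub_eq_add_neg, sub_eq_iff_eq_add, add_assoc, eq_neg_add_iff_add_eq]
          exact this.symm }
    refine ⟨ψ, Hom.ext_of y.mem fun Y f hT hx hx' => ?_, Hom.ext_of x.mem fun Y f hT hx hx' => ?_⟩
    · rw [comp_c _ _ f hx hx' hT]; exact add_neg_cancel _
    · rw [comp_c _ _ f hx hx' hT]; exact neg_add_cancel _

/-- The sum of two descent data. -/
def add (x y : K.ConeObj X) : K.ConeObj X where
  sieve := x.sieve ⊓ y.sieve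
  mem := J.intersection_covering x.mem y.mem
  b := fun _ f h => x.b f h.1 + y.b f h.2
  a := fun _ _ f g h => x.a f g h.1 + y.a f g h.2
  d_a := fun Y Z f g h => by
    rw [map_add, map_add, ← x.d_a f g h.1, ← y.d_a f g h.2]; abel
  cocycle := fun Y Z T f g h hf => by
    rw [map_add, x.cocycle f g h hf.1, y.cocycle f g h hf.2]; abel

/-- The descent datum of the zero object. -/
def zero (X : C) : K.ConeObj X where
  sieve := ⊤
  mem := J.top_mem X
  b := fun _ _ _ => 0
  a := fun _ _ _ _ _ => 0
  d_a := by simp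
  cocycle := by simp

/-- The opposite of a descent datum. -/
def neg (x : K.ConeObj X) : K.ConeObj X where
  sieve := x.sieve
  mem := x.mem
  b := fun _ f h => -x.b f h
  a := fun _ _ f g h => -x.a f g h
  d_a := fun Y Z f g h => by rw [map_neg, map_neg, ← x.d_a f g h]; abel
  cocycle := fun Y Z T f g h hf => by rw [map_neg, x.cocycle f g h hf]; abel

/-- The sum of two morphisms. -/
def addHom {x x' y y' : K.ConeObj X} (φ : x ⟶ x') (ψ : y ⟶ y') : add x y ⟶ add x' y' where
  c := fun _ f h h' => Hom.c φ f h.1 h'.1 + Hom.c ψ f h.2 h'.2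
  d_c := fun Y f h h' => by
    have h1 := Hom.d_c φ f h.1 h'.1
    have h2 := Hom.d_c ψ f h.2 h'.2
    simp only [add, map_add, ← h1, ← h2]; abel
  nat := fun Y Z f g h h' => by
    have h1 := Hom.nat φ f g h.1 h'.1
    have h2 := Hom.nat ψ f g h.2 h'.2
    simp only [add, map_add]
    rw [add_add_add_comm, h1, h2]; abel

noncomputable instance : MonoidalCategoryStruct (K.ConeObj X) where
  tensorObj := add
  tensorUnit := zero X
  tensorHom := addHom
  whiskerLeft x _ _ φ := addHom (𝟙 x) φ
  whiskerRight φ y := addHom φ (𝟙 y)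
  associator x y z := zeroIso _ _ (fun _ _ _ _ => add_assoc _ _ _) (fun _ _ _ _ _ _ => add_assoc _ _ _)
  leftUnitor x := zeroIso _ _ (fun _ _ _ _ => zero_add _) (fun _ _ _ _ _ _ => zero_add _)
  rightUnitor x := zeroIso _ _ (fun _ _ _ _ => add_zero _) (fun _ _ _ _ _ _ => add_zero _)

lemma tensor_sieve (x y : K.ConeObj X) : (x ⊗ y).sieve = x.sieve ⊓ y.sieve := rfl
lemma mem_tensor {x y : K.ConeObj X} {Y : C} {f : Y ⟶ X} (hx : x.sieve f) (hy : y.sieve f) :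
    (x ⊗ y).sieve f := ⟨hx, hy⟩
lemma mem_unit {Y : C} (f : Y ⟶ X) : (𝟙_ (K.ConeObj X)).sieve f := trivial

@[simp] lemma tensorHom_c {x x' y y' : K.ConeObj X} (φ : x ⟶ x') (ψ : y ⟶ y') {Y : C} (f : Y ⟶ X)
    (h : (x ⊗ y).sieve f) (h' : (x' ⊗ y').sieve f) :
    Hom.c (φ ⊗ₘ ψ) f h h' = Hom.c φ f h.1 h'.1 + Hom.c ψ f h.2 h'.2 := rfl
@[simp] lemma whiskerLeft_c (x : K.ConeObj X) {y y' : K.ConeObj X} (ψ : y ⟶ y') {Y : C} (f : Y ⟶ X)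
    (h : (x ⊗ y).sieve f) (h' : (x ⊗ y').sieve f) :
    Hom.c (x ◁ ψ) f h h' = Hom.c ψ f h.2 h'.2 := zero_add _
@[simp] lemma whiskerRight_c {x x' : K.ConeObj X} (φ : x ⟶ x') (y : K.ConeObj X) {Y : C} (f : Y ⟶ X)
    (h : (x ⊗ y).sieve f) (h' : (x' ⊗ y).sieve f) :
    Hom.c (φ ▷ y) f h h' = Hom.c φ f h.1 h'.1 := add_zero _
@[simp] lemma associator_hom_c (x y z : K.ConeObj X) {Y : C} (f : Y ⟶ X) (h h') :
    Hom.c (α_ x y z).hom f h h' = 0 := rfl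
@[simp] lemma associator_inv_c (x y z : K.ConeObj X) {Y : C} (f : Y ⟶ X) (h h') :
    Hom.c (α_ x y z).inv f h h' = 0 := rfl
@[simp] lemma leftUnitor_hom_c (x : K.ConeObj X) {Y : C} (f : Y ⟶ X) (h h') :
    Hom.c (λ_ x).hom f h h' = 0 := rfl
@[simp] lemma leftUnitor_inv_c (x : K.ConeObj X) {Y : C} (f : Y ⟶ X) (h h') :
    Hom.c (λ_ x).inv f h h' = 0 := rfl
@[simp] lemma rightUnitor_hom_c (x : K.ConeObj X) {Y : C} (f : Y ⟶ X) (h h') :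
    Hom.c (ρ_ x).hom f h h' = 0 := rfl
@[simp] lemma rightUnitor_inv_c (x : K.ConeObj X) {Y : C} (f : Y ⟶ X) (h h') :
    Hom.c (ρ_ x).inv f h h' = 0 := rfl

instance {x x' y y' : K.ConeObj X} (φ : x ⟶ x') (ψ : y ⟶ y') [hφ : IsTriv φ] [hψ : IsTriv ψ] :
    IsTriv (φ ⊗ₘ ψ) := by
  obtain ⟨T, hT, h⟩ := hφ
  obtain ⟨T', hT', h'⟩ := hψ
  refine ⟨T ⊓ T', J.intersection_covering hT hT', fun Y f hf hx hy => ?_⟩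
  rw [tensorHom_c, h f hf.1, h' f hf.2, add_zero]
instance instIsTrivWhiskerLeft (x : K.ConeObj X) {y y' : K.ConeObj X} (ψ : y ⟶ y') [IsTriv ψ] :
    IsTriv (x ◁ ψ) :=
  inferInstanceAs (IsTriv (𝟙 x ⊗ₘ ψ))
instance instIsTrivWhiskerRight {x x' : K.ConeObj X} (φ : x ⟶ x') (y : K.ConeObj X) [IsTriv φ] :
    IsTriv (φ ▷ y) :=
  inferInstanceAs (IsTriv (φ ⊗ₘ 𝟙 y))
instance (x y z : K.ConeObj X) : IsTriv (α_ x y z).hom := .of_c fun _ _ _ _ => rfl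
instance (x y z : K.ConeObj X) : IsTriv (α_ x y z).inv := .of_c fun _ _ _ _ => rfl
instance (x : K.ConeObj X) : IsTriv (λ_ x).hom := .of_c fun _ _ _ _ => rfl
instance (x : K.ConeObj X) : IsTriv (λ_ x).inv := .of_c fun _ _ _ _ => rfl
instance (x : K.ConeObj X) : IsTriv (ρ_ x).hom := .of_c fun _ _ _ _ => rfl
instance (x : K.ConeObj X) : IsTriv (ρ_ x).inv := .of_c fun _ _ _ _ => rfl

noncomputable instance : MonoidalCategory (K.ConeObj X) where
  tensorHom_def {x x' y y'} φ ψ := by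
    refine Hom.ext_of (add x' y).mem fun Y f hT h h' => ?_
    rw [comp_c _ _ f h h' hT]; simp
  id_tensorHom_id x y := eq_of_isTriv _ _
  tensorHom_comp_tensorHom {x y z x' y' z'} φ ψ φ' ψ' := by
    refine Hom.ext_of (add y y').mem fun Y f hT h h' => ?_
    rw [comp_c _ _ f h h' hT, tensorHom_c, tensorHom_c, tensorHom_c, comp_c _ _ f h.1 h'.1 hT.1,
      comp_c _ _ f h.2 h'.2 hT.2, add_add_add_comm]
  whiskerLeft_id x y := eq_of_isTriv _ _
  id_whiskerRight x y := eq_of_isTriv _ _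
  associator_naturality {x y z x' y' z'} φ ψ χ := by
    refine Hom.ext_of (J.intersection_covering (add x (add y z)).mem (add x' (add y' z')).mem)
      fun Y f hT h h' => ?_
    rw [comp_c _ _ f h h' (mem_tensor (mem_tensor hT.2.1 hT.2.2.1) hT.2.2.2),
      comp_c _ _ f h h' hT.1]
    simp [add_assoc]
  leftUnitor_naturality {x y} φ := by
    refine Hom.ext_of (J.intersection_covering x.mem y.mem) fun Y f hT h h' => ?_
    rw [comp_c _ _ f h h' hT.1, comp_c _ _ f h h' (mem_tensor (mem_unit f) hT.2)]
    simp
  rightUnitor_naturality {x y} φ := by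
    refine Hom.ext_of (J.intersection_covering x.mem y.mem) fun Y f hT h h' => ?_
    rw [comp_c _ _ f h h' hT.1, comp_c _ _ f h h' (mem_tensor hT.2 (mem_unit f))]
    simp
  pentagon x y z t := eq_of_isTriv _ _
  triangle x y := eq_of_isTriv _ _

/-- The commutativity isomorphism. -/
noncomputable def braid (x y : K.ConeObj X) : x ⊗ y ≅ y ⊗ x :=
  zeroIso _ _ (fun _ _ _ _ => add_comm _ _) (fun _ _ _ _ _ _ => add_comm _ _)

instance (x y : K.ConeObj X) : IsTriv (braid x y).hom := .of_c fun _ _ _ _ => rfl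
instance (x y : K.ConeObj X) : IsTriv (braid x y).inv := .of_c fun _ _ _ _ => rfl
@[simp] lemma braid_hom_c (x y : K.ConeObj X) {Y : C} (f : Y ⟶ X) (h h') :
    Hom.c (braid x y).hom f h h' = 0 := rfl

noncomputable instance : SymmetricCategory (K.ConeObj X) where
  braiding := braid
  braiding_naturality_right x {y z} φ := by
    refine Hom.ext_of (J.intersection_covering y.mem z.mem) fun Y f hT h h' => ?_
    rw [comp_c _ _ f h h' (mem_tensor h.1 hT.2), comp_c _ _ f h h' (mem_tensor hT.1 h.1)]
    simp
  braiding_naturality_left {x y} φ z := by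
    refine Hom.ext_of (J.intersection_covering x.mem y.mem) fun Y f hT h h' => ?_
    rw [comp_c _ _ f h h' (mem_tensor hT.2 h.2), comp_c _ _ f h h' (mem_tensor h.2 hT.1)]
    simp
  hexagon_forward x y z := eq_of_isTriv _ _
  hexagon_reverse x y z := eq_of_isTriv _ _
  symmetry x y := eq_of_isTriv _ _

instance (x y : K.ConeObj X) : IsTriv (β_ x y).hom := .of_c fun _ _ _ _ => rfl

lemma braiding_self (x : K.ConeObj X) : (β_ x x).hom = 𝟙 (x ⊗ x) := eq_of_isTriv _ _

lemma exists_inverse (x : K.ConeObj X) : ∃ y : K.ConeObj X, Nonempty (x ⊗ y ≅ 𝟙_ _) :=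
  ⟨neg x, ⟨zeroIso _ _ (fun _ _ _ _ => add_neg_cancel _) (fun _ _ _ _ _ _ => add_neg_cancel _)⟩⟩

/-- The pullback of a descent datum. -/
def pull {X' : C} (k : X' ⟶ X) (x : K.ConeObj X) : K.ConeObj X' where
  sieve := x.sieve.pullback k
  mem := J.pullback_stable k x.mem
  b := fun _ f h => x.b (f ≫ k) h
  a := fun _ _ f g h => x.a (f ≫ k) g h
  d_a := fun Y Z f g h => by simpa using x.d_a (f ≫ k) g h
  cocycle := fun Y Z T f g h hf => by simpa using x.cocycle (f ≫ k) g h hf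

/-- The pullback of a morphism of descent data. -/
def pullMap {X' : C} (k : X' ⟶ X) {x y : K.ConeObj X} (φ : x ⟶ y) : pull k x ⟶ pull k y where
  c := fun _ f h h' => Hom.c φ (f ≫ k) h h'
  d_c := fun Y f h h' => Hom.d_c φ (f ≫ k) h h'
  nat := fun Y Z f g h h' => by simpa [pull] using Hom.nat φ (f ≫ k) g h h'

variable (K) in
/-- The pullback functor. -/
noncomputable def pullFunctor {X' : C} (k : X' ⟶ X) : K.ConeObj X ⥤ K.ConeObj X' where
  obj := pull k
  map := pullMap k
  map_id _ := rfl
  map_comp {x y z} φ ψ := Hom.ext_of (pull k y).mem fun Y f hT h h' => by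
    rw [comp_c _ _ f h h' hT]
    exact comp_c φ ψ (f ≫ k) h h' hT

@[simp] lemma pullFunctor_map_c {X' : C} (k : X' ⟶ X) {x y : K.ConeObj X} (φ : x ⟶ y) {Y : C}
    (f : Y ⟶ X') (h h') : Hom.c ((pullFunctor K k).map φ) f h h' = Hom.c φ (f ≫ k) h h' := rfl

instance {X' : C} (k : X' ⟶ X) {x y : K.ConeObj X} (φ : x ⟶ y) [hφ : IsTriv φ] :
    IsTriv ((pullFunctor K k).map φ) := by
  obtain ⟨T, hT, h⟩ := hφ
  exact ⟨T.pullback k, J.pullback_stable k hT, fun Y f hf hx hy => h (f ≫ k) hf hx hy⟩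

/-- Compatibility of pullback with the unit object. -/
noncomputable def pullUnit {X' : C} (k : X' ⟶ X) : 𝟙_ (K.ConeObj X') ≅ (pullFunctor K k).obj (𝟙_ _) :=
  zeroIso _ _ (fun _ _ _ _ => rfl) (fun _ _ _ _ _ _ => rfl)

/-- Compatibility of pullback with the tensor product. -/
noncomputable def pullTensor {X' : C} (k : X' ⟶ X) (x y : K.ConeObj X) :
    (pullFunctor K k).obj x ⊗ (pullFunctor K k).obj y ≅ (pullFunctor K k).obj (x ⊗ y) :=
  zeroIso _ _ (fun _ _ _ _ => rfl) (fun _ _ _ _ _ _ => rfl)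

instance {X' : C} (k : X' ⟶ X) : IsTriv (pullUnit (K := K) k).hom := .of_c fun _ _ _ _ => rfl
instance {X' : C} (k : X' ⟶ X) (x y : K.ConeObj X) : IsTriv (pullTensor k x y).hom :=
  .of_c fun _ _ _ _ => rfl
@[simp] lemma pullTensor_hom_c {X' : C} (k : X' ⟶ X) (x y : K.ConeObj X) {Y : C} (f : Y ⟶ X')
    (h h') : Hom.c (pullTensor k x y).hom f h h' = 0 := rfl

noncomputable instance {X' : C} (k : X' ⟶ X) : (pullFunctor K k).Monoidal :=
  Functor.CoreMonoidal.toMonoidal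
    { εIso := pullUnit k
      μIso := pullTensor k
      μIso_hom_natural_left := fun {x y} φ z => by
        refine Hom.ext_of (J.intersection_covering (pull k x).mem (pull k y).mem)
          fun Y f hT h h' => ?_
        refine square_c ⟨hT.2, h.2⟩ ⟨hT.1, h.2⟩ ?_
        change (Hom.c φ (f ≫ k) h.1 h'.1 + 0) + 0 = 0 + (Hom.c φ (f ≫ k) h.1 h'.1 + 0)
        simp
      μIso_hom_natural_right := fun {x y} z φ => by
        refine Hom.ext_of (J.intersection_covering (pull k x).mem (pull k y).mem)
          fun Y f hT h h' => ?_
        refine square_c ⟨h.1, hT.2⟩ ⟨h.1, hT.1⟩ ?_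
        change (0 + Hom.c φ (f ≫ k) h.2 h'.2) + 0 = 0 + (0 + Hom.c φ (f ≫ k) h.2 h'.2)
        simp
      associativity := fun x y z => eq_of_isTriv _ _
      left_unitality := fun x => eq_of_isTriv _ _
      right_unitality := fun x => eq_of_isTriv _ _ }

open Functor.LaxMonoidal in
instance {X' : C} (k : X' ⟶ X) : IsTriv (ε (pullFunctor K k)) := .of_c fun _ _ _ _ => rfl
open Functor.LaxMonoidal in
instance {X' : C} (k : X' ⟶ X) (x y : K.ConeObj X) : IsTriv (μ (pullFunctor K k) x y) :=
  .of_c fun _ _ _ _ => rfl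

noncomputable instance {X' : C} (k : X' ⟶ X) : (pullFunctor K k).Braided where
  braided _ _ := eq_of_isTriv _ _

variable (K) in
/-- Pullback along the identity. -/
noncomputable def pullId (X : C) : pullFunctor K (𝟙 X) ≅ 𝟭 (K.ConeObj X) :=
  NatIso.ofComponents (fun x => zeroIso _ _ (fun Y f hx hy => by simp [pullFunctor, pull])
    (fun Y Z f g hx hy => by simp [pullFunctor, pull])) (fun {x y} φ => by
      refine Hom.ext_of (J.intersection_covering x.mem y.mem) fun Y f hT h h' => ?_
      refine square_c (by simpa [pullFunctor, pull] using hT.2) hT.1 ?_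
      simp)

variable (K) in
/-- Pullback along a composition. -/
noncomputable def pullComp {X Y Z : C} (f : Y ⟶ X) (g : Z ⟶ Y) :
    pullFunctor K (g ≫ f) ≅ pullFunctor K f ⋙ pullFunctor K g :=
  NatIso.ofComponents (fun x => zeroIso _ _ (fun Y f hx hy => by simp [pullFunctor, pull])
    (fun Y Z f g hx hy => by simp [pullFunctor, pull])) (fun {x y} φ => by
      refine Hom.ext_of (J.intersection_covering (pull (g ≫ f) x).mem (pull (g ≫ f) y).mem)
        fun Y k hT h h' => ?_
      refine square_c hT.2 (by simpa [pullFunctor, pull] using hT.1) ?_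
      change Hom.c φ (k ≫ g ≫ f) _ _ + 0 = 0 + Hom.c φ ((k ≫ g) ≫ f) _ _
      simp)

instance (x : K.ConeObj X) : IsTriv ((pullId K X).hom.app x) := .of_c fun _ _ _ _ => rfl
instance (x : K.ConeObj X) : IsTriv ((pullId K X).inv.app x) := .of_c fun _ _ _ _ => rfl
instance {X Y Z : C} (f : Y ⟶ X) (g : Z ⟶ Y) (x : K.ConeObj X) :
    IsTriv ((pullComp K f g).hom.app x) := .of_c fun _ _ _ _ => rfl
instance {X Y Z : C} (f : Y ⟶ X) (g : Z ⟶ Y) (x : K.ConeObj X) :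
    IsTriv ((pullComp K f g).inv.app x) := .of_c fun _ _ _ _ => rfl

lemma isTriv_eqToHom {x y : K.ConeObj X} (h : x = y) : IsTriv (eqToHom h) := by
  subst h; rw [eqToHom_refl]; infer_instance

lemma isTriv_eqToHom_app {X' : C} {F G : Cat.of (K.ConeObj X) ⟶ Cat.of (K.ConeObj X')}
    (h : F = G) (x : K.ConeObj X) : IsTriv ((eqToHom h).toNatTrans.app x) := by
  subst h
  exact .of_c fun _ _ _ _ => rfl

end ConeObj

open ConeObj Bicategory

/-- The pseudofunctor of descent data, the stack associated with `Y ↦ Cone (A(Y) → B(Y))`. -/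
noncomputable def conePseudofunctor :
    Pseudofunctor (LocallyDiscrete Cᵒᵖ) Cat.{max u₁ v₁ w, max u₁ v₁ w} :=
  pseudofunctorOfIsLocallyDiscrete
    (fun X : LocallyDiscrete Cᵒᵖ => Cat.of (K.ConeObj X.as.unop))
    (fun {X Y : LocallyDiscrete Cᵒᵖ} (f : X ⟶ Y) => (pullFunctor K f.as.unop).toCatHom)
    (fun X : LocallyDiscrete Cᵒᵖ => Cat.Hom.isoMk (pullId K X.as.unop))
    (fun {X Y Z : LocallyDiscrete Cᵒᵖ} (f : X ⟶ Y) (g : Y ⟶ Z) =>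
      Cat.Hom.isoMk (pullComp K f.as.unop g.as.unop))
    (fun {X₀ X₁ X₂ X₃ : LocallyDiscrete Cᵒᵖ} f g h => by
      ext x
      refine @eq_of_isTriv _ _ _ _ _ _ _ _ _ ?_ (isTriv_eqToHom_app _ x)
      change IsTriv ((pullComp K (f ≫ g).as.unop h.as.unop).hom.app x ≫
        (pullFunctor K h.as.unop).map ((pullComp K f.as.unop g.as.unop).hom.app x) ≫ 𝟙 _ ≫
        (pullComp K g.as.unop h.as.unop).inv.app ((pullFunctor K f.as.unop).obj x) ≫
        (pullComp K f.as.unop (g ≫ h).as.unop).inv.app x)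
      exact .comp (.of_c fun _ _ _ _ => rfl) <| .comp (.of_c fun _ _ _ _ => rfl) <|
        .comp (.of_c fun _ _ _ _ => rfl) <| .comp (.of_c fun _ _ _ _ => rfl)
        (.of_c fun _ _ _ _ => rfl))
    (fun {X₀ X₁ : LocallyDiscrete Cᵒᵖ} f => by
      ext x
      refine @eq_of_isTriv _ _ _ _ _ _ _ _ _ ?_ (isTriv_eqToHom_app _ x)
      change IsTriv ((pullComp K (𝟙 X₀ : X₀ ⟶ X₀).as.unop f.as.unop).hom.app x ≫
        (pullFunctor K f.as.unop).map ((pullId K X₀.as.unop).hom.app x) ≫ 𝟙 _)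
      exact .comp (.of_c fun _ _ _ _ => rfl) <| .comp (.of_c fun _ _ _ _ => rfl)
        (.of_c fun _ _ _ _ => rfl))
    (fun {X₀ X₁ : LocallyDiscrete Cᵒᵖ} f => by
      ext x
      refine @eq_of_isTriv _ _ _ _ _ _ _ _ _ ?_ (isTriv_eqToHom_app _ x)
      change IsTriv ((pullComp K f.as.unop (𝟙 X₁ : X₁ ⟶ X₁).as.unop).hom.app x ≫
        (pullId K X₁.as.unop).hom.app ((pullFunctor K f.as.unop).obj x) ≫ 𝟙 _)
      exact .comp (.of_c fun _ _ _ _ => rfl) <| .comp (.of_c fun _ _ _ _ => rfl)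
        (.of_c fun _ _ _ _ => rfl))

section Stack

variable {K}

lemma mapComp'_hom_c {X Y Z : C} (f : Y ⟶ X) (g : Z ⟶ Y) (q : Z ⟶ X) (h) (x : K.ConeObj X) {T : C}
    (t : T ⟶ Z) (h1) (h2) :
    ConeObj.Hom.c (x := pull q x) (y := pull g (pull f x))
      ((K.conePseudofunctor.mapComp' f.op.toLoc g.op.toLoc q.op.toLoc h).hom.toNatTrans.app x)
      t h1 h2 = 0 := by
  obtain rfl : g ≫ f = q := congrArg (fun e : LocallyDiscrete.mk (op X) ⟶ .mk (op Z) => e.as.unop) h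
  have : K.conePseudofunctor.mapComp' f.op.toLoc g.op.toLoc (g ≫ f).op.toLoc h =
    K.conePseudofunctor.mapComp f.op.toLoc g.op.toLoc := K.conePseudofunctor.mapComp'_eq_mapComp _ _
  rw [this]
  rfl

lemma mapComp'_inv_c {X Y Z : C} (f : Y ⟶ X) (g : Z ⟶ Y) (q : Z ⟶ X) (h) (x : K.ConeObj X) {T : C}
    (t : T ⟶ Z) (h1) (h2) :
    ConeObj.Hom.c (x := pull g (pull f x)) (y := pull q x)
      ((K.conePseudofunctor.mapComp' f.op.toLoc g.op.toLoc q.op.toLoc h).inv.toNatTrans.app x)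
      t h1 h2 = 0 := by
  obtain rfl : g ≫ f = q := congrArg (fun e : LocallyDiscrete.mk (op X) ⟶ .mk (op Z) => e.as.unop) h
  have : K.conePseudofunctor.mapComp' f.op.toLoc g.op.toLoc (g ≫ f).op.toLoc h =
    K.conePseudofunctor.mapComp f.op.toLoc g.op.toLoc := K.conePseudofunctor.mapComp'_eq_mapComp _ _
  rw [this]
  rfl

open Pseudofunctor LocallyDiscreteOpToCat

variable {S : C} {ι : Type*} {X : ι → C} {f : ∀ i, X i ⟶ S}

lemma pullHom_c {X₁ X₂ Y Y' : C} (M₁ : K.ConeObj X₁) (M₂ : K.ConeObj X₂) (f₁ : Y ⟶ X₁)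
    (f₂ : Y ⟶ X₂) (φ : pull f₁ M₁ ⟶ pull f₂ M₂) (g : Y' ⟶ Y) (gf₁ : Y' ⟶ X₁) (gf₂ : Y' ⟶ X₂)
    (hgf₁ : g ≫ f₁ = gf₁) (hgf₂ : g ≫ f₂ = gf₂) {T : C} (t : T ⟶ Y') (h1 h2 h3 h4) :
    ConeObj.Hom.c (x := pull gf₁ M₁) (y := pull gf₂ M₂)
      (pullHom (F := K.conePseudofunctor) (M₁ := M₁) (M₂ := M₂) (f₁ := f₁) (f₂ := f₂) φ g gf₁ gf₂
        hgf₁ hgf₂) t h1 h2 = ConeObj.Hom.c φ (t ≫ g) h3 h4 := by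
  subst hgf₁ hgf₂
  have h5 : (pull g (pull f₁ M₁)).sieve t := h3
  have h6 : (pull g (pull f₂ M₂)).sieve t := h4
  refine (comp_c (x := pull (g ≫ f₁) M₁) (y := pull g (pull f₁ M₁)) (z := pull (g ≫ f₂) M₂)
    _ _ t h1 h2 h5).trans ?_
  rw [mapComp'_hom_c, zero_add]
  refine (comp_c (x := pull g (pull f₁ M₁)) (y := pull g (pull f₂ M₂)) (z := pull (g ≫ f₂) M₂)
    _ _ t h5 h2 h6).trans ?_
  rw [mapComp'_inv_c, add_zero]
  rfl

lemma ofObj_hom_c (x : K.ConeObj S) {Y : C} (q : Y ⟶ S) {i₁ i₂ : ι} (f₁ : Y ⟶ X i₁) (f₂ : Y ⟶ X i₂)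
    (hf₁ : f₁ ≫ f i₁ = q) (hf₂ : f₂ ≫ f i₂ = q) {T : C} (t : T ⟶ Y) (h1) (h2) :
    ConeObj.Hom.c (x := pull f₁ (pull (f i₁) x)) (y := pull f₂ (pull (f i₂) x))
      ((DescentData.ofObj (F := K.conePseudofunctor) (f := f) x).hom q f₁ f₂ hf₁ hf₂) t h1 h2
      = 0 := by
  have h3 : (pull q x).sieve t := by
    subst hf₁
    simpa [pull] using h1
  refine (comp_c (x := pull f₁ (pull (f i₁) x)) (y := pull q x) (z := pull f₂ (pull (f i₂) x))
    _ _ t h1 h2 h3).trans ?_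
  rw [mapComp'_hom_c, mapComp'_inv_c, add_zero]

/-- The objects of a descent datum. -/
def ddObj (D : K.conePseudofunctor.DescentData f) (i : ι) : K.ConeObj (X i) := D.obj i

/-- The gluing isomorphisms of a descent datum. -/
def ddMor (D : K.conePseudofunctor.DescentData f) {Z : C} (q : Z ⟶ S) {i j : ι} (g : Z ⟶ X i)
    (g' : Z ⟶ X j) (h : g ≫ f i = q) (h' : g' ≫ f j = q) :
    pull g (ddObj D i) ⟶ pull g' (ddObj D j) := D.hom q g g' h h'

/-- The components of the gluing isomorphisms of a descent datum. -/
def ddHom (D : K.conePseudofunctor.DescentData f) {Z : C} {i j : ι} (g : Z ⟶ X i) (g' : Z ⟶ X j)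
    (h : g ≫ f i = g' ≫ f j) (hg : (ddObj D i).sieve g) (hg' : (ddObj D j).sieve g') :
    K.A.obj (op Z) :=
  ConeObj.Hom.c (ddMor D (g ≫ f i) g g' rfl h.symm) (𝟙 Z) (by simpa [pull] using hg)
    (by simpa [pull] using hg')

variable (D : K.conePseudofunctor.DescentData f)

lemma ddMor_c {Z T : C} {i j : ι} (q : Z ⟶ S) (g : Z ⟶ X i) (g' : Z ⟶ X j)
    (h : g ≫ f i = q) (h' : g' ≫ f j = q) (t : T ⟶ Z) (hg : (ddObj D i).sieve (t ≫ g))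
    (hg' : (ddObj D j).sieve (t ≫ g')) :
    ConeObj.Hom.c (ddMor D q g g' h h') t hg hg'
      = ddHom D (t ≫ g) (t ≫ g') (by simp [h, h']) hg hg' := by
  have := D.pullHom_hom t q ((t ≫ g) ≫ f i) (by simp [h]) g g' h h' (t ≫ g) (t ≫ g') rfl rfl
  unfold ddHom ddMor
  rw [← this]
  refine Eq.trans ?_ (pullHom_c (ddObj D i) (ddObj D j) g g' _ t _ _ rfl rfl (𝟙 T) _ _
    (by simpa [pull] using hg) (by simpa [pull] using hg')).symm
  congr 1
  simp

lemma ddHom_d {Z : C} {i j : ι} (g : Z ⟶ X i) (g' : Z ⟶ X j)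
    (h : g ≫ f i = g' ≫ f j) (hg : (ddObj D i).sieve g) (hg' : (ddObj D j).sieve g') :
    (ddObj D i).b g hg + K.dAt Z (ddHom D g g' h hg hg') = (ddObj D j).b g' hg' := by
  have := ConeObj.Hom.d_c (ddMor D (g ≫ f i) g g' rfl h.symm) (𝟙 Z) (by simpa [pull] using hg)
    (by simpa [pull] using hg')
  rw [ddHom]
  simpa only [pull, Category.id_comp] using this

lemma ddHom_nat {Z T : C} {i j : ι} (g : Z ⟶ X i) (g' : Z ⟶ X j)
    (h : g ≫ f i = g' ≫ f j) (hg : (ddObj D i).sieve g) (hg' : (ddObj D j).sieve g')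
    (k : T ⟶ Z) :
    (ddObj D i).a g k hg + ddHom D (k ≫ g) (k ≫ g') (by simp [h])
      ((ddObj D i).sieve.downward_closed hg k) ((ddObj D j).sieve.downward_closed hg' k) =
      res K.A k (ddHom D g g' h hg hg') + (ddObj D j).a g' k hg' := by
  have := ConeObj.Hom.nat (ddMor D (g ≫ f i) g g' rfl h.symm) (𝟙 Z) k
    (by simpa [pull] using hg) (by simpa [pull] using hg')
  have h2 := ddMor_c D (g ≫ f i) g g' rfl h.symm (k ≫ 𝟙 Z)
    (by simpa using (ddObj D i).sieve.downward_closed hg k)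
    (by simpa using (ddObj D j).sieve.downward_closed hg' k)
  have h3 := this.symm.trans (congrArg _ h2)
  simp only [pull, Category.id_comp, Category.comp_id] at h3
  exact h3.symm

lemma ddHom_trans {Z : C} {i j k : ι} (g : Z ⟶ X i) (g' : Z ⟶ X j) (g'' : Z ⟶ X k)
    (h : g ≫ f i = g' ≫ f j) (h' : g' ≫ f j = g'' ≫ f k) (hg : (ddObj D i).sieve g)
    (hg' : (ddObj D j).sieve g') (hg'' : (ddObj D k).sieve g'') :
    ddHom D g g' h hg hg' + ddHom D g' g'' h' hg' hg'' = ddHom D g g'' (h.trans h') hg hg'' := by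
  have h1 : ddMor D (g ≫ f i) g g' rfl h.symm ≫ ddMor D (g ≫ f i) g' g'' h.symm (h.trans h').symm =
    ddMor D (g ≫ f i) g g'' rfl (h.trans h').symm :=
    D.hom_comp (g ≫ f i) g g' g'' rfl h.symm (h.trans h').symm
  have e1 : (ddObj D i).sieve (𝟙 Z ≫ g) := by simpa using hg
  have e2 : (ddObj D j).sieve (𝟙 Z ≫ g') := by simpa using hg'
  have e3 : (ddObj D k).sieve (𝟙 Z ≫ g'') := by simpa using hg''
  have h2 := comp_c (ddMor D (g ≫ f i) g g' rfl h.symm)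
    (ddMor D (g ≫ f i) g' g'' h.symm (h.trans h').symm) (𝟙 Z) e1 e3 e2
  rw [h1, ddMor_c, ddMor_c, ddMor_c] at h2
  simp only [Category.id_comp] at h2
  exact h2.symm

/-- The glued object. -/
theorem exists_glued_obj {R : Sieve S} (hR : R ∈ J S)
    (D : K.conePseudofunctor.DescentData (fun (f : R.arrows.category) ↦ f.obj.hom)) :
    ∃ x : K.ConeObj S, Nonempty ((DescentData.ofObj x :
      K.conePseudofunctor.DescentData (fun (f : R.arrows.category) ↦ f.obj.hom)) ≅ D) := by
  let U : Sieve S := Sieve.bind R.arrows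
    (fun _ h (hh : R h) => (ddObj D (R.arrows.categoryMk h hh)).sieve)
  have hU : U ∈ J S := J.bind_covering hR
    (fun _ h (hh : R h) => (ddObj D (R.arrows.categoryMk h hh)).mem)
  have hex : ∀ Z (h : Z ⟶ S), U h → ∃ (i : R.arrows.category) (g : Z ⟶ i.obj.left),
      g ≫ i.obj.hom = h ∧ (ddObj D i).sieve g := by
    rintro Z h ⟨Y, g, k, hk, hg, e⟩
    exact ⟨R.arrows.categoryMk k hk, g, e, hg⟩
  have hex' : ∀ (i : R.arrows.category) {Z : C} (g : Z ⟶ i.obj.left), (ddObj D i).sieve g →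
      U (g ≫ i.obj.hom) := fun i Z g hg => ⟨_, g, i.obj.hom, i.property, hg, rfl⟩
  choose I G hG hG' using hex
  have key : ∀ {Z : C} {i : R.arrows.category} (g : Z ⟶ i.obj.left) (h h' : Z ⟶ S) (e : h = h')
      (e' : g ≫ i.obj.hom = h) (hh : U h) (hh' : U h') (hg : (ddObj D i).sieve g),
      ddHom D g (G Z h hh) (by rw [e', hG]) hg (hG' Z h hh) =
        ddHom D g (G Z h' hh') (by rw [e', hG, e]) hg (hG' Z h' hh') := by
    intro Z i g h h' e e' hh hh' hg
    subst e
    rfl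
  have key' : ∀ {Z : C} {i : R.arrows.category} (g : Z ⟶ i.obj.left) (h h' : Z ⟶ S) (e : h = h')
      (e' : g ≫ i.obj.hom = h) (hh : U h) (hh' : U h') (hg : (ddObj D i).sieve g),
      ddHom D (G Z h hh) g (by rw [e', hG]) (hG' Z h hh) hg =
        ddHom D (G Z h' hh') g (by rw [e', hG, e]) (hG' Z h' hh') hg := by
    intro Z i g h h' e e' hh hh' hg
    subst e
    rfl
  let x : K.ConeObj S :=
    { sieve := U
      mem := hU
      b := fun Z h hh => (ddObj D (I Z h hh)).b (G Z h hh) (hG' Z h hh)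
      a := fun Z T h k hh => (ddObj D (I Z h hh)).a (G Z h hh) k (hG' Z h hh) +
        ddHom D (k ≫ G Z h hh) (G T (k ≫ h) (U.downward_closed hh k))
          (by rw [hG, Category.assoc, hG])
          ((ddObj D (I Z h hh)).sieve.downward_closed (hG' Z h hh) k) (hG' _ _ _)
      d_a := fun Z T h k hh => by
        rw [map_add, ← add_assoc, ConeObj.d_a, ddHom_d]
      cocycle := fun Z T V h k l hh => by
        rw [ConeObj.cocycle, map_add, add_assoc, add_assoc, ← add_assoc (res K.A l (ddHom _ _ _ _ _ _)),
          ← ddHom_nat, add_assoc, ddHom_trans]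
        simp only [Category.assoc]
        refine congrArg _ (congrArg _ (key _ _ _ (Category.assoc _ _ _) ?_ _ _ _))
        simp only [Category.assoc, hG] }
  let e : ∀ i : R.arrows.category, pull i.obj.hom x ⟶ ddObj D i := fun i =>
    { c := fun Z g hx hg => ddHom D (G Z (g ≫ i.obj.hom) hx) g (hG _ _ _) (hG' _ _ _) hg
      d_c := fun Z g hx hg => ddHom_d D _ _ _ _ _
      nat := fun Z T g k hx hg => by
        have h1 := ddHom_nat D (G Z (g ≫ i.obj.hom) hx) g (hG _ _ _) (hG' _ _ _) hg k
        have hx' : U (k ≫ g ≫ i.obj.hom) := U.downward_closed hx k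
        have hx'' : U ((k ≫ g) ≫ i.obj.hom) := by simpa using hx'
        have h2 := ddHom_trans D (k ≫ G Z (g ≫ i.obj.hom) hx) (G T (k ≫ g ≫ i.obj.hom) hx')
          (k ≫ g) ((Category.assoc _ _ _).trans
            ((congrArg (k ≫ ·) (hG _ _ hx)).trans (hG _ _ hx').symm))
          ((hG _ _ hx').trans (Category.assoc _ _ _).symm)
          ((ddObj D (I Z _ hx)).sieve.downward_closed (hG' _ _ _) k) (hG' _ _ _)
          ((ddObj D i).sieve.downward_closed hg k)
        have h3 := key' (k ≫ g) (k ≫ g ≫ i.obj.hom) ((k ≫ g) ≫ i.obj.hom)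
          (Category.assoc _ _ _).symm (Category.assoc _ _ _) hx' hx''
          ((ddObj D i).sieve.downward_closed hg k)
        rw [← h1, ← h2, h3, ← add_assoc]
        rfl }
  have he : ∀ i, IsIso (e i) := fun i => IsGroupoid.all_isIso _
  let e' : ∀ i : R.arrows.category, pull i.obj.hom x ≅ ddObj D i := fun i => asIso (e i)
  let D' : K.conePseudofunctor.DescentData (fun (f : R.arrows.category) ↦ f.obj.hom) :=
    DescentData.ofObj (F := K.conePseudofunctor) x
  refine ⟨x, ⟨DescentData.isoMk (D₁ := D') (D₂ := D) e' ?_⟩⟩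
  intro Y q i j f₁ f₂ hf₁ hf₂
  refine ConeObj.Hom.ext_of (x := pull f₁ (pull i.obj.hom x)) (y := pull f₂ (ddObj D j))
    (J.pullback_stable f₁ (ddObj D i).mem) fun T t hT hx hy => ?_
  have hx1 : U ((t ≫ f₁) ≫ i.obj.hom) := hx
  have hx2 : U ((t ≫ f₂) ≫ j.obj.hom) := by
    rw [Category.assoc, hf₂, ← hf₁, ← Category.assoc]; exact hx1
  refine (comp_c (x := pull f₁ (pull i.obj.hom x)) (y := pull f₁ (ddObj D i))
    (z := pull f₂ (ddObj D j)) (pullMap f₁ (e i)) (ddMor D q f₁ f₂ hf₁ hf₂) t hx hy hT).trans ?_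
  refine Eq.trans ?_ (comp_c (x := pull f₁ (pull i.obj.hom x)) (y := pull f₂ (pull j.obj.hom x))
    (z := pull f₂ (ddObj D j)) ((DescentData.ofObj (F := K.conePseudofunctor)
      (f := fun (f : R.arrows.category) ↦ f.obj.hom) x).hom q f₁ f₂ hf₁ hf₂)
    (pullMap f₂ (e j)) t hx hy hx2).symm
  have z := ofObj_hom_c (X := fun i : R.arrows.category => i.obj.left)
    (f := fun (f : R.arrows.category) ↦ f.obj.hom) x q f₁ f₂ hf₁ hf₂ t hx hx2
  refine Eq.trans ?_ (congrArg (· + ConeObj.Hom.c (pullMap f₂ (e j)) t hx2 hy) z).symm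
  refine Eq.trans (congrArg (ConeObj.Hom.c (pullMap f₁ (e i)) t hx hT + ·)
    (ddMor_c D q f₁ f₂ hf₁ hf₂ t hT hy)) ?_
  refine Eq.trans ?_ (zero_add _).symm
  change ddHom D (G T ((t ≫ f₁) ≫ i.obj.hom) hx1) (t ≫ f₁) (hG _ _ _) (hG' _ _ _) hT +
      ddHom D (t ≫ f₁) (t ≫ f₂) (by simp only [Category.assoc, hf₁, hf₂]) hT hy =
    ddHom D (G T ((t ≫ f₂) ≫ j.obj.hom) hx2) (t ≫ f₂) (hG _ _ _) (hG' _ _ _) hy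
  refine (ddHom_trans D _ _ _ _ _ _ _ _).trans ?_
  refine key' _ _ _ ?_ ?_ _ _ _ <;> simp only [Category.assoc, hf₁, hf₂]

lemma ddMap_eq {R : Sieve S} {x y : K.ConeObj S}
    (Φ : (DescentData.ofObj x : K.conePseudofunctor.DescentData
      (fun (f : R.arrows.category) ↦ f.obj.hom)) ⟶ DescentData.ofObj y)
    (i : R.arrows.category) {Z : C} (g : Z ⟶ i.obj.left)
    (hx : x.sieve (g ≫ i.obj.hom)) (hy : y.sieve (g ≫ i.obj.hom)) (h : R (g ≫ i.obj.hom)) :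
    ConeObj.Hom.c (x := pull i.obj.hom x) (y := pull i.obj.hom y) (Φ.hom i) g hx hy =
      ConeObj.Hom.c (x := pull (g ≫ i.obj.hom) x) (y := pull (g ≫ i.obj.hom) y)
        (Φ.hom (R.arrows.categoryMk (g ≫ i.obj.hom) h)) (𝟙 Z) (by simpa [pull] using hx)
        (by simpa [pull] using hy) := by
  let j := R.arrows.categoryMk (g ≫ i.obj.hom) h
  let φi : pull i.obj.hom x ⟶ pull i.obj.hom y := Φ.hom i
  let φj : pull (g ≫ i.obj.hom) x ⟶ pull (g ≫ i.obj.hom) y := Φ.hom j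
  have h0 := Φ.comm (g ≫ i.obj.hom) (i₁ := i) (i₂ := j) g (𝟙 Z) rfl (Category.id_comp _)
  have a1 : (pull g (pull i.obj.hom x)).sieve (𝟙 Z) := by simpa [pull] using hx
  have a2 : (pull g (pull i.obj.hom y)).sieve (𝟙 Z) := by simpa [pull] using hy
  have a3 : (pull (𝟙 Z) (pull (g ≫ i.obj.hom) x)).sieve (𝟙 Z) := by simpa [pull] using hx
  have a4 : (pull (𝟙 Z) (pull (g ≫ i.obj.hom) y)).sieve (𝟙 Z) := by simpa [pull] using hy
  have h1 := (comp_c (x := pull g (pull i.obj.hom x)) (y := pull g (pull i.obj.hom y))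
    (z := pull (𝟙 Z) (pull (g ≫ i.obj.hom) y)) (pullMap g φi)
    ((DescentData.ofObj (F := K.conePseudofunctor)
      (f := fun (f : R.arrows.category) ↦ f.obj.hom) y).hom (g ≫ i.obj.hom) (i₁ := i) (i₂ := j)
        g (𝟙 Z) rfl (Category.id_comp _))
    (𝟙 Z) a1 a4 a2)
  have h2 := (comp_c (x := pull g (pull i.obj.hom x)) (y := pull (𝟙 Z) (pull (g ≫ i.obj.hom) x))
    (z := pull (𝟙 Z) (pull (g ≫ i.obj.hom) y))
    ((DescentData.ofObj (F := K.conePseudofunctor)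
      (f := fun (f : R.arrows.category) ↦ f.obj.hom) x).hom (g ≫ i.obj.hom) (i₁ := i) (i₂ := j)
        g (𝟙 Z) rfl (Category.id_comp _)) (pullMap (𝟙 Z) φj)
    (𝟙 Z) a1 a4 a3)
  have h3 := congrArg (fun ψ => ConeObj.Hom.c (x := pull g (pull i.obj.hom x))
    (y := pull (𝟙 Z) (pull (g ≫ i.obj.hom) y)) ψ (𝟙 Z) a1 a4) h0
  have h4 := h1.symm.trans (h3.trans h2)
  rw [ofObj_hom_c y _ _ _ rfl (Category.id_comp _), ofObj_hom_c x _ _ _ rfl (Category.id_comp _),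
    add_zero, zero_add] at h4
  change ConeObj.Hom.c φi (𝟙 Z ≫ g) _ _ = ConeObj.Hom.c φj (𝟙 Z ≫ 𝟙 Z) _ _ at h4
  simpa only [Category.id_comp] using h4

theorem conePseudofunctor_isStack : K.conePseudofunctor.IsStack J := by
  refine IsStack.of_isStackFor fun S R hR => ⟨?_⟩
  have h1 : (K.conePseudofunctor.toDescentData
      (fun (f : R.arrows.category) ↦ f.obj.hom)).Faithful := ⟨fun {x y φ ψ} h => by
    refine ConeObj.Hom.ext_of (X := S) hR fun Y f hf hx hy => ?_
    have h' := congrArg (fun Φ => DescentData.Hom.hom Φ (R.arrows.categoryMk f hf)) h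
    have h'' : pullMap f φ = pullMap f ψ := h'
    have := congrArg (fun θ => ConeObj.Hom.c θ (𝟙 Y) (by simpa [pull] using hx)
      (by simpa [pull] using hy)) h''
    change ConeObj.Hom.c φ (𝟙 Y ≫ f) _ _ = ConeObj.Hom.c ψ (𝟙 Y ≫ f) _ _ at this
    simpa only [Category.id_comp] using this⟩
  have h2 : (K.conePseudofunctor.toDescentData
      (fun (f : R.arrows.category) ↦ f.obj.hom)).Full := ⟨fun {x y} Φ => by
    let Ψ : ∀ {Y : C} (f : Y ⟶ S) (hf : R f), pull (K := K) f x ⟶ pull f y :=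
      fun f hf => Φ.hom (R.arrows.categoryMk f hf)
    obtain ⟨φ, hφ⟩ := ConeObj.Hom.exists_glue (K := K) x y hR
      (fun Y f hf hx hy => ConeObj.Hom.c (Ψ f hf) (𝟙 Y) (by simpa [pull] using hx)
        (by simpa [pull] using hy))
      (fun Y f hf hx hy => by
        simpa only [pull, Category.id_comp] using ConeObj.Hom.d_c (Ψ f hf) (𝟙 Y)
          (by simpa [pull] using hx) (by simpa [pull] using hy))
      (fun Y Z f g hf hx hy => by
        have e1 := ConeObj.Hom.nat (Ψ f hf) (𝟙 Y) g
          (by simpa [pull] using hx) (by simpa [pull] using hy)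
        have e2 := ddMap_eq Φ (R.arrows.categoryMk f hf) g
          (ConeObj.sieve x |>.downward_closed hx g) (ConeObj.sieve y |>.downward_closed hy g)
          (R.downward_closed hf g)
        simp only [pull, Category.id_comp, Category.comp_id] at e1
        rw [← e1]
        exact congrArg _ e2.symm)
    refine ⟨φ, ?_⟩
    ext i
    refine ConeObj.Hom.ext_of (x := pull i.obj.hom x) (y := pull i.obj.hom y) (J.top_mem _)
      fun Z g _ hx hy => ?_
    have hR' : R (g ≫ i.obj.hom) := R.downward_closed i.property g
    exact (hφ (g ≫ i.obj.hom) hR' hx hy).trans (ddMap_eq Φ i g hx hy hR').symm⟩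
  have h3 : (K.conePseudofunctor.toDescentData
      (fun (f : R.arrows.category) ↦ f.obj.hom)).EssSurj := ⟨fun D => exists_glued_obj hR D⟩
  exact { }

end Stack

end TwoTerm

/-- A strictly commutative Picard stack on the site `(C, J)`: a stack of groupoids whose values are
symmetric monoidal, with symmetric monoidal pullback functors and monoidal coherence isomorphisms,
such that all objects are invertible and the commutativity isomorphism of `x ⊗ x` is the identity. -/
structure PicardStack {C : Type u₁} [Category.{v₁} C] (J : GrothendieckTopology C) where
  F : Pseudofunctor (LocallyDiscrete Cᵒᵖ) Cat.{v₂, u₂}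
  isStack : F.IsStack J
  isGroupoid (X : LocallyDiscrete Cᵒᵖ) : IsGroupoid (F.obj X)
  monoidal (X : LocallyDiscrete Cᵒᵖ) : MonoidalCategory (F.obj X)
  symmetric (X : LocallyDiscrete Cᵒᵖ) : SymmetricCategory (F.obj X)
  exists_inverse (X : LocallyDiscrete Cᵒᵖ) (x : F.obj X) :
    ∃ y : F.obj X, Nonempty (x ⊗ y ≅ 𝟙_ (F.obj X))
  braiding_self (X : LocallyDiscrete Cᵒᵖ) (x : F.obj X) : (β_ x x).hom = 𝟙 (x ⊗ x)
  braided {X Y : LocallyDiscrete Cᵒᵖ} (f : X ⟶ Y) : (F.map f).toFunctor.Braided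
  mapId_isMonoidal (X : LocallyDiscrete Cᵒᵖ) :
    NatTrans.IsMonoidal (F₁ := (F.map (𝟙 X)).toFunctor) (F₂ := 𝟭 (F.obj X))
      (F.mapId X).hom.toNatTrans
  mapComp_isMonoidal {X Y Z : LocallyDiscrete Cᵒᵖ} (f : X ⟶ Y) (g : Y ⟶ Z) :
    NatTrans.IsMonoidal (F₁ := (F.map (f ≫ g)).toFunctor)
      (F₂ := (F.map f).toFunctor ⋙ (F.map g).toFunctor) (F.mapComp f g).hom.toNatTrans

namespace PicardStack

attribute [instance] isGroupoid monoidal symmetric braided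

variable {C : Type u₁} [Category.{v₁} C] {J : GrothendieckTopology C}

open scoped Pseudofunctor.StrongTrans

/-- A morphism of Picard stacks: a morphism of stacks (a pseudonatural transformation) with a
symmetric monoidal structure on each component, such that the naturality isomorphisms are
monoidal. -/
structure Hom (P Q : PicardStack.{v₁, u₁, v₂, u₂} J) where
  trans : P.F ⟶ Q.F
  braided (X : LocallyDiscrete Cᵒᵖ) : (trans.app X).toFunctor.Braided
  naturality_isMonoidal {X Y : LocallyDiscrete Cᵒᵖ} (f : X ⟶ Y) :
    NatTrans.IsMonoidal (F₁ := (P.F.map f).toFunctor ⋙ (trans.app Y).toFunctor)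
      (F₂ := (trans.app X).toFunctor ⋙ (Q.F.map f).toFunctor) (trans.naturality f).hom.toNatTrans

namespace Hom

attribute [instance] braided

variable {P Q R : PicardStack.{v₁, u₁, v₂, u₂} J}

/-- A morphism of Picard stacks is an equivalence (that is, an isomorphism of Picard stacks) if
each of its component functors is an equivalence of categories. -/
def IsEquivalence (Φ : Hom P Q) : Prop :=
  ∀ X : LocallyDiscrete Cᵒᵖ, (Φ.trans.app X).toFunctor.IsEquivalence

/-- A 2-morphism: a modification with monoidal components. It is automatically invertible, because
the stacks consist of groupoids. -/
structure TwoHom (Φ Ψ : Hom P Q) where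
  mod : Φ.trans ⟶ Ψ.trans
  isMonoidal (X : LocallyDiscrete Cᵒᵖ) : NatTrans.IsMonoidal (mod.as.app X).toNatTrans

/-- The composition of morphisms of Picard stacks. -/
def comp (Φ : Hom P Q) (Ψ : Hom Q R) : Hom P R where
  trans := Φ.trans ≫ Ψ.trans
  braided X := inferInstanceAs ((Φ.trans.app X).toFunctor ⋙ (Ψ.trans.app X).toFunctor).Braided
  naturality_isMonoidal {X Y} f := by
    have h1 := Φ.naturality_isMonoidal f
    have h2 := Ψ.naturality_isMonoidal f
    exact inferInstanceAs (NatTrans.IsMonoidal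
      ((Functor.associator _ _ _).inv ≫
        Functor.whiskerRight (H := (Φ.trans.app X).toFunctor ⋙ (Q.F.map f).toFunctor) (G := (P.F.map f).toFunctor ⋙ (Φ.trans.app Y).toFunctor) (Φ.trans.naturality f).hom.toNatTrans (Ψ.trans.app Y).toFunctor ≫
        (Functor.associator _ _ _).hom ≫
        Functor.whiskerLeft (Φ.trans.app X).toFunctor (G := (Q.F.map f).toFunctor ⋙ (Ψ.trans.app Y).toFunctor) (H := (Ψ.trans.app X).toFunctor ⋙ (R.F.map f).toFunctor) (Ψ.trans.naturality f).hom.toNatTrans ≫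
        (Functor.associator _ _ _).inv))

end Hom
end PicardStack

namespace TwoTerm

variable {C : Type u₁} [Category.{v₁} C] {J : GrothendieckTopology C}

open ConeObj

instance isMonoidal_pullId (K : TwoTerm.{w} J) (X : C) :
    NatTrans.IsMonoidal (pullId K X).hom where
  unit := eq_of_isTriv _ _ (hφ := .comp (.of_c fun _ _ _ _ => rfl) inferInstance)
    (hψ := .of_c fun _ _ _ _ => rfl)
  tensor x y := eq_of_isTriv _ _ (hψ := .comp inferInstance (.of_c fun _ _ _ _ => rfl))

instance isMonoidal_pullComp (K : TwoTerm.{w} J) {X Y Z : C} (f : Y ⟶ X) (g : Z ⟶ Y) :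
    NatTrans.IsMonoidal (pullComp K f g).hom where
  unit := eq_of_isTriv _ _ (hψ := .comp inferInstance (.of_c fun _ _ _ _ => rfl))
  tensor x y := eq_of_isTriv _ _
    (hψ := .comp inferInstance (.comp inferInstance (.of_c fun _ _ _ _ => rfl)))

/-- The Picard stack `Cone (A → B)` associated with a two-term complex of sheaves of
abelian groups. -/
noncomputable def cone (K : TwoTerm.{w} J) :
    PicardStack.{v₁, u₁, max u₁ v₁ w, max u₁ v₁ w} J where
  F := K.conePseudofunctor
  isStack := K.conePseudofunctor_isStack
  isGroupoid X := inferInstanceAs (IsGroupoid (K.ConeObj X.as.unop))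
  monoidal X := inferInstanceAs (MonoidalCategory (K.ConeObj X.as.unop))
  symmetric X := inferInstanceAs (SymmetricCategory (K.ConeObj X.as.unop))
  exists_inverse X x := ConeObj.exists_inverse (K := K) (X := X.as.unop) x
  braiding_self X x := ConeObj.braiding_self (K := K) (X := X.as.unop) x
  braided f := inferInstanceAs (pullFunctor K f.as.unop).Braided
  mapId_isMonoidal X := isMonoidal_pullId K X.as.unop
  mapComp_isMonoidal f g := isMonoidal_pullComp K f.as.unop g.as.unop

/-- A morphism of two-term complexes. -/
structure Hom (K K' : TwoTerm.{w} J) where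
  f : K.A ⟶ K'.A
  g : K.B ⟶ K'.B
  comm : f ≫ K'.d = K.d ≫ g

namespace Hom

variable {K K' : TwoTerm.{w} J} (q : Hom K K')

lemma comm_app {Y : C} (x : K.A.obj (op Y)) :
    K'.dAt Y ((q.f.app (op Y)).hom x) = (q.g.app (op Y)).hom (K.dAt Y x) :=
  congrArg (fun φ : K.A ⟶ K'.B => (φ.app (op Y)).hom x) q.comm

/-- The image of a descent datum. -/
def mapObj {X : C} (x : K.ConeObj X) : K'.ConeObj X where
  sieve := x.sieve
  mem := x.mem
  b := fun Y h hh => (q.g.app (op Y)).hom (x.b h hh)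
  a := fun Y Z h k hh => (q.f.app (op Z)).hom (x.a h k hh)
  d_a := fun Y Z h k hh => by rw [res_app, comm_app, ← map_add, x.d_a]
  cocycle := fun Y Z T h k l hh => by rw [res_app, ← map_add, ← x.cocycle]

/-- The image of a morphism of descent data. -/
def mapHom {X : C} {x y : K.ConeObj X} (φ : x ⟶ y) : q.mapObj x ⟶ q.mapObj y where
  c := fun Y h hx hy => (q.f.app (op Y)).hom (ConeObj.Hom.c φ h hx hy)
  d_c := fun Y h hx hy => by
    rw [comm_app]
    exact (map_add _ _ _).symm.trans (congrArg _ (ConeObj.Hom.d_c φ h hx hy))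
  nat := fun Y Z h k hx hy => by
    rw [res_app]
    exact (map_add _ _ _).symm.trans ((congrArg _ (ConeObj.Hom.nat φ h k hx hy)).trans
      (map_add _ _ _))

/-- The functor on descent data. -/
noncomputable def mapFunctor (X : C) : K.ConeObj X ⥤ K'.ConeObj X where
  obj := q.mapObj
  map := q.mapHom
  map_id x := ConeObj.Hom.ext_of x.mem fun Y h _ hx hy => map_zero (q.f.app (op Y)).hom
  map_comp {x y z} φ ψ := ConeObj.Hom.ext_of y.mem fun Y h hT hx hz => by
    rw [comp_c (q.mapHom φ) (q.mapHom ψ) h hx hz hT]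
    exact (congrArg (q.f.app (op Y)).hom (comp_c φ ψ h hx hz hT)).trans (map_add _ _ _)

lemma isTriv_map {X : C} {x y : K.ConeObj X} (φ : x ⟶ y) (hφ : IsTriv φ) :
    IsTriv ((q.mapFunctor X).map φ) := by
  obtain ⟨T, hT, h⟩ := hφ
  exact ⟨T, hT, fun Y f hf hx hy =>
    (congrArg (q.f.app (op Y)).hom (h f hf hx hy)).trans (map_zero _)⟩

instance (X : C) {x y : K.ConeObj X} (φ : x ⟶ y) [hφ : IsTriv φ] :
    IsTriv ((q.mapFunctor X).map φ) := q.isTriv_map φ hφ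

noncomputable instance (X : C) : (q.mapFunctor X).Monoidal :=
  Functor.CoreMonoidal.toMonoidal
    { εIso := zeroIso _ _ (fun _ _ _ _ => (map_zero _).symm) (fun _ _ _ _ _ _ => (map_zero _).symm)
      μIso := fun _ _ => zeroIso _ _ (fun _ _ _ _ => (map_add _ _ _).symm)
        (fun _ _ _ _ _ _ => (map_add _ _ _).symm)
      μIso_hom_natural_left := fun {x y} φ z => by
        refine ConeObj.Hom.ext_of (J.intersection_covering x.mem y.mem) fun Y h hT hx hy => ?_
        refine square_c (mem_tensor (x := q.mapObj y) (y := q.mapObj z) hT.2 hx.2)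
          (mem_tensor hT.1 hx.2) ?_
        change ((q.f.app (op Y)).hom (ConeObj.Hom.c φ h hx.1 hy.1) + 0) + 0 =
          0 + (q.f.app (op Y)).hom (ConeObj.Hom.c φ h hx.1 hy.1 + 0)
        simp
      μIso_hom_natural_right := fun {x y} z φ => by
        refine ConeObj.Hom.ext_of (J.intersection_covering x.mem y.mem) fun Y h hT hx hy => ?_
        refine square_c (mem_tensor (x := q.mapObj z) (y := q.mapObj y) hx.1 hT.2)
          (mem_tensor hx.1 hT.1) ?_
        change (0 + (q.f.app (op Y)).hom (ConeObj.Hom.c φ h hx.2 hy.2)) + 0 =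
          0 + (q.f.app (op Y)).hom (0 + ConeObj.Hom.c φ h hx.2 hy.2)
        simp
      associativity := fun x y z => eq_of_isTriv _ _
        (hφ := .comp (@instIsTrivWhiskerRight _ _ _ _ _ _ _ _ _ (.of_c fun _ _ _ _ => rfl)) (.comp (.of_c fun _ _ _ _ => rfl)
          (q.isTriv_map _ inferInstance)))
        (hψ := .comp inferInstance (.comp (@instIsTrivWhiskerLeft _ _ _ _ _ _ _ _ _ (.of_c fun _ _ _ _ => rfl))
          (.of_c fun _ _ _ _ => rfl)))
      left_unitality := fun x => eq_of_isTriv _ _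
        (hψ := .comp (@instIsTrivWhiskerRight _ _ _ _ _ _ _ _ _ (.of_c fun _ _ _ _ => rfl)) (.comp (.of_c fun _ _ _ _ => rfl)
          (q.isTriv_map _ inferInstance)))
      right_unitality := fun x => eq_of_isTriv _ _
        (hψ := .comp (@instIsTrivWhiskerLeft _ _ _ _ _ _ _ _ _ (.of_c fun _ _ _ _ => rfl)) (.comp (.of_c fun _ _ _ _ => rfl)
          (q.isTriv_map _ inferInstance))) }

instance (X : C) (x y : K.ConeObj X) : IsTriv (Functor.LaxMonoidal.μ (q.mapFunctor X) x y) :=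
  .of_c fun _ _ _ _ => rfl
instance (X : C) : IsTriv (Functor.LaxMonoidal.ε (q.mapFunctor X)) :=
  .of_c fun _ _ _ _ => rfl

noncomputable instance (X : C) : (q.mapFunctor X).Braided where
  braided _ _ := eq_of_isTriv _ _

/-- Compatibility with pullback. -/
noncomputable def mapPull {X Y : C} (k : Y ⟶ X) :
    pullFunctor K k ⋙ q.mapFunctor Y ≅ q.mapFunctor X ⋙ pullFunctor K' k :=
  NatIso.ofComponents (fun x => zeroIso _ _ (fun _ _ _ _ => rfl) (fun _ _ _ _ _ _ => rfl))
    (fun {x y} φ => ConeObj.Hom.ext_of (J.intersection_covering (pull k x).mem (pull k y).mem)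
      fun Z h hT hx hy => square_c hT.2 hT.1 ((add_zero _).trans (zero_add _).symm))

instance {X Y : C} (k : Y ⟶ X) (x : K.ConeObj X) : IsTriv ((q.mapPull k).hom.app x) :=
  .of_c fun _ _ _ _ => rfl
instance {X Y : C} (k : Y ⟶ X) (x : K.ConeObj X) : IsTriv ((q.mapPull k).inv.app x) :=
  .of_c fun _ _ _ _ => rfl

instance isMonoidal_mapPull {X Y : C} (k : Y ⟶ X) : NatTrans.IsMonoidal (q.mapPull k).hom where
  unit := eq_of_isTriv _ _ (hφ := .comp (.comp inferInstance inferInstance) inferInstance)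
    (hψ := .comp inferInstance inferInstance)
  tensor x y := eq_of_isTriv _ _ (hφ := .comp (.comp inferInstance inferInstance) inferInstance)
    (hψ := .comp inferInstance (.comp inferInstance inferInstance))

lemma conePseudofunctor_map₂ {X Y : LocallyDiscrete Cᵒᵖ} {k l : X ⟶ Y} (η : k ⟶ l)
    (x : K.ConeObj X.as.unop) :
    IsTriv (K := K) (X := Y.as.unop) ((K.conePseudofunctor.map₂ η).toNatTrans.app x) := by
  obtain rfl : k = l := LocallyDiscrete.eq_of_hom η
  obtain rfl : η = 𝟙 k := Subsingleton.elim _ _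
  rw [PrelaxFunctor.map₂_id]
  exact .of_c fun _ _ _ _ => rfl

lemma isTriv_pullMap {X Y : C} {k : Y ⟶ X} {x y : K'.ConeObj X} {φ : x ⟶ y} (hφ : IsTriv φ) :
    IsTriv ((pullFunctor K' k).map φ) := inferInstance

open Bicategory in
/-- The underlying morphism of stacks of groupoids. -/
noncomputable def coneTrans : Pseudofunctor.StrongTrans K.conePseudofunctor K'.conePseudofunctor where
  app X := (q.mapFunctor X.as.unop).toCatHom
  naturality {X Y} k := Cat.Hom.isoMk (q.mapPull k.as.unop)
  naturality_naturality {X Y k l} η := by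
    ext x
    have h1 := conePseudofunctor_map₂ η x
    have h2 := conePseudofunctor_map₂ (K := K') η (q.mapObj x)
    exact eq_of_isTriv (K := K') (X := Y.as.unop) _ _
      (hφ := .comp (φ := (q.mapFunctor Y.as.unop).map
        ((K.conePseudofunctor.map₂ η).toNatTrans.app x))
        (ψ := (q.mapPull l.as.unop).hom.app x) (q.isTriv_map _ h1) (.of_c fun _ _ _ _ => rfl))
      (hψ := .comp (φ := (q.mapPull k.as.unop).hom.app x)
        (ψ := (K'.conePseudofunctor.map₂ η).toNatTrans.app (q.mapObj x)) (.of_c fun _ _ _ _ => rfl) h2)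
  naturality_id X := by
    ext x
    exact eq_of_isTriv (K := K') (X := X.as.unop) _ _
      (hφ := .comp (φ := (q.mapPull (𝟙 X : X ⟶ X).as.unop).hom.app x)
        (ψ := (pullId K' X.as.unop).hom.app (q.mapObj x)) (.of_c fun _ _ _ _ => rfl) (.of_c fun _ _ _ _ => rfl))
      (hψ := .comp (φ := (q.mapFunctor X.as.unop).map ((pullId K X.as.unop).hom.app x))
        (ψ := 𝟙 _ ≫ 𝟙 _) (q.isTriv_map _ (.of_c fun _ _ _ _ => rfl)) inferInstance)
  naturality_comp {X Y Z} k l := by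
    ext x
    exact eq_of_isTriv (K := K') (X := Z.as.unop) _ _
      (hφ := .comp (φ := (q.mapPull (k ≫ l).as.unop).hom.app x)
        (ψ := (pullComp K' k.as.unop l.as.unop).hom.app (q.mapObj x)) (.of_c fun _ _ _ _ => rfl) (.of_c fun _ _ _ _ => rfl))
      (hψ := .comp (φ := (q.mapFunctor Z.as.unop).map
          ((pullComp K k.as.unop l.as.unop).hom.app x))
        (ψ := 𝟙 _ ≫ (q.mapPull l.as.unop).hom.app (pull k.as.unop x) ≫ 𝟙 _ ≫
          (pullFunctor K' l.as.unop).map ((q.mapPull k.as.unop).hom.app x) ≫ 𝟙 _)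
        (q.isTriv_map _ (.of_c fun _ _ _ _ => rfl)) (.comp inferInstance (.comp
          (.of_c fun _ _ _ _ => rfl) (.comp inferInstance
          (.comp (isTriv_pullMap (.of_c fun _ _ _ _ => rfl)) inferInstance)))))

/-- The morphism of Picard stacks induced by a morphism of complexes. -/
noncomputable def coneMap : PicardStack.Hom K.cone K'.cone where
  trans := q.coneTrans
  braided X := instBraidedConeObjMapFunctor q X.as.unop
  naturality_isMonoidal k := q.isMonoidal_mapPull k.as.unop

end Hom

end TwoTerm

/-! ### The Hopf algebra of `𝔾ₐ^♯` -/

namespace Sharp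

open Polynomial TensorProduct

variable (p : ℕ)

/-- The element `x ^ (p ^ n) / p ^ ((p ^ n - 1) / (p - 1))` of `ℚ[x]`. -/
noncomputable def uPoly (n : ℕ) : ℚ[X] :=
  C (((p : ℚ) ^ ((p ^ n - 1) / (p - 1)))⁻¹) * X ^ (p ^ n)

/-- The subring of `ℚ[x]` generated by these elements. -/
noncomputable def coordSubalgebra : Subalgebra ℤ ℚ[X] := Algebra.adjoin ℤ (Set.range (uPoly p))

/-- The coordinate ring of `𝔾ₐ^♯`. -/
def Coord : Type := coordSubalgebra p

noncomputable instance : CommRing (Coord p) := inferInstanceAs (CommRing (coordSubalgebra p))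

/-- The generators of the coordinate ring. -/
noncomputable def gen (n : ℕ) : Coord p :=
  (⟨uPoly p n, Algebra.subset_adjoin ⟨n, rfl⟩⟩ : coordSubalgebra p)

variable {p}

lemma exponent_succ (hp : p.Prime) (n : ℕ) :
    (p ^ (n + 1) - 1) / (p - 1) = p * ((p ^ n - 1) / (p - 1)) + 1 := by
  rw [← Nat.geomSum_eq hp.two_le, ← Nat.geomSum_eq hp.two_le, Finset.sum_range_succ', Finset.mul_sum]
  simp [pow_succ, mul_comm]

lemma uPoly_zero : uPoly p 0 = X := by simp [uPoly]

lemma uPoly_pow (hp : p.Prime) (n : ℕ) : uPoly p n ^ p = (p : ℚ[X]) * uPoly p (n + 1) := by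
  have h0 : (p : ℚ) ≠ 0 := by exact_mod_cast hp.ne_zero
  rw [uPoly, uPoly, exponent_succ hp, mul_pow, ← pow_mul, ← pow_succ, ← C_pow, ← mul_assoc,
    ← C_eq_natCast, ← C_mul]
  congr 2
  rw [inv_pow, ← pow_mul, mul_comm _ p, pow_succ]
  field_simp

lemma gen_pow (hp : p.Prime) (n : ℕ) : gen p n ^ p = (p : Coord p) * gen p (n + 1) :=
  Subtype.ext (uPoly_pow hp n)

lemma ringHom_ext {T : Type*} [Ring T] {φ ψ : Coord p →+* T}
    (h : ∀ n, φ (gen p n) = ψ (gen p n)) : φ = ψ := by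
  let φ' : coordSubalgebra p →ₐ[ℤ] T := RingHom.toIntAlgHom φ
  let ψ' : coordSubalgebra p →ₐ[ℤ] T := RingHom.toIntAlgHom ψ
  have h1 : φ' = ψ' := by
    refine AlgHom.adjoin_ext ?_
    rintro x ⟨n, rfl⟩
    exact h n
  exact RingHom.ext fun x => DFunLike.congr_fun h1 x

lemma isAddTorsionFree_of_flat (T : Type*) [Ring T] [m : Module ℤ T] [hT : Module.Flat ℤ T] :
    IsAddTorsionFree T := by
  obtain rfl : m = AddCommGroup.toIntModule T := Subsingleton.elim _ _
  have := hT.isTorsionFree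
  refine ⟨fun n hn a b h => ?_⟩
  have h0 : (n : ℤ) ≠ 0 := by exact_mod_cast hn
  refine smul_right_injective T h0 ?_
  simpa using h

instance flat_coord : Module.Flat ℤ (Coord p) := inferInstanceAs (Module.Flat ℤ (coordSubalgebra p))

lemma flat₂ (R A B : Type*) [CommRing R] [CommRing A] [CommRing B] [Algebra R A] [Algebra R B]
    [Module.Flat R A] [Module.Flat R B] : Module.Flat R (A ⊗[R] B) := inferInstance

lemma flat₃ (R A : Type*) [CommRing R] [CommRing A] [Algebra R A] [Module.Flat R A] :
    Module.Flat R (A ⊗[R] (A ⊗[R] A)) := inferInstance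

variable {T : Type*} [CommRing T]

lemma cancel [IsAddTorsionFree T] (hp : p.Prime) {a b : T} (h : (p : T) * a = (p : T) * b) :
    a = b :=
  nsmul_right_injective hp.ne_zero (by simpa [nsmul_eq_mul] using h)

/-- A homomorphism into a torsion-free ring is determined by the image of `x`. -/
lemma ringHom_ext_zero [IsAddTorsionFree T] (hp : p.Prime) {φ ψ : Coord p →+* T}
    (h : φ (gen p 0) = ψ (gen p 0)) : φ = ψ := by
  refine ringHom_ext fun n => ?_
  induction n with
  | zero => exact h
  | succ n ih =>
    refine cancel hp ?_
    have h1 := congrArg φ (gen_pow hp n)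
    have h2 := congrArg ψ (gen_pow hp n)
    simp only [map_pow, map_mul, map_natCast] at h1 h2
    rw [← h1, ← h2, ih]

lemma exists_lift [IsAddTorsionFree T] (hp : p.Prime) (v : ℕ → T)
    (hv : ∀ n, v n ^ p = (p : T) * v (n + 1)) :
    ∃ φ : Coord p →+* T, ∀ n, φ (gen p n) = v n := by
  let ι : T →ₐ[ℤ] ℚ ⊗[ℤ] T := Algebra.TensorProduct.includeRight
  have hι : Function.Injective ι :=
    Algebra.TensorProduct.includeRight_injective (algebraMap ℤ ℚ).injective_int
  let e : ℚ[X] →ₐ[ℚ] ℚ ⊗[ℤ] T := aeval (ι (v 0))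
  have he : ∀ n, e (uPoly p n) = ι (v n) := by
    intro n
    induction n with
    | zero => simp [uPoly_zero, e]
    | succ n ih =>
      have h1 := congrArg e (uPoly_pow hp n)
      have h2 := congrArg ι (hv n)
      simp only [map_pow, map_mul, map_natCast] at h1 h2
      rw [ih, h2] at h1
      have h0 : (p : ℚ) ≠ 0 := by exact_mod_cast hp.ne_zero
      have h3 : IsUnit ((p : ℕ) : ℚ ⊗[ℤ] T) := by
        simpa using (IsUnit.mk0 _ h0).map (algebraMap ℚ (ℚ ⊗[ℤ] T))
      exact (h3.mul_left_cancel h1).symm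
  have hr : ∀ a : coordSubalgebra p, e a ∈ ι.range := by
    have : coordSubalgebra p ≤ ι.range.comap (e.restrictScalars ℤ) := by
      refine Algebra.adjoin_le ?_
      rintro _ ⟨n, rfl⟩
      exact ⟨v n, (he n).symm⟩
    exact fun a => this a.2
  let φ : coordSubalgebra p →ₐ[ℤ] T := (AlgEquiv.ofInjective ι hι).symm.toAlgHom.comp
    (((e.restrictScalars ℤ).comp (coordSubalgebra p).val).codRestrict ι.range hr)
  refine ⟨φ.toRingHom, fun n => ?_⟩
  refine hι ((congrArg Subtype.val (AlgEquiv.apply_symm_apply (AlgEquiv.ofInjective ι hι)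
    ⟨e (uPoly p n), hr ⟨uPoly p n, Algebra.subset_adjoin ⟨n, rfl⟩⟩⟩)).trans (he n))

/-- The divided powers of an element of the augmentation ideal. -/
lemma exists_seq (hp : p.Prime) (ε : T →+* ℤ)
    (h : ∀ f g : T →+* T ⧸ Ideal.span {(p : T)},
      (∀ t, f t = Ideal.Quotient.mk _ (t ^ p)) → (∀ t, g t = Int.castRingHom _ (ε t)) → f = g)
    (z : T) (hz : ε z = 0) :
    ∃ v : ℕ → T, v 0 = z ∧ ∀ n, v n ^ p = (p : T) * v (n + 1) := by
  have : Fact p.Prime := ⟨hp⟩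
  have hu : (p : T) ∈ nonunits T := fun hu => by
    have := hu.map ε
    rw [map_natCast, Int.isUnit_iff_natAbs_eq] at this
    exact hp.one_lt.ne' (by simpa using this)
  have := CharP.quotient T p hu
  have hfg := h ((frobenius (T ⧸ Ideal.span {(p : T)}) p).comp (Ideal.Quotient.mk _))
    ((Int.castRingHom _).comp ε) (fun t => by simp [frobenius_def]) (fun t => rfl)
  have key : ∀ z : {z : T // ε z = 0}, ∃ w : {z : T // ε z = 0}, z.1 ^ p = (p : T) * w.1 := by
    rintro ⟨z, hz⟩
    have h1 := DFunLike.congr_fun hfg z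
    have h2 : Ideal.Quotient.mk (Ideal.span {(p : T)}) (z ^ p) = 0 := by
      simpa [frobenius_def, hz] using h1
    rw [Ideal.Quotient.eq_zero_iff_mem, Ideal.mem_span_singleton] at h2
    obtain ⟨w, hw⟩ := h2
    refine ⟨⟨w, ?_⟩, hw⟩
    have h3 := congrArg ε hw
    simpa [hz, hp.ne_zero] using h3
  choose w hw using key
  refine ⟨fun n => (w^[n] ⟨z, hz⟩).1, rfl, fun n => ?_⟩
  beta_reduce
  rw [hw, Function.iterate_succ_apply']

/-- A ring homomorphism as a homomorphism of `ℤ`-algebras. -/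
def toAlgHom {R S : Type*} [Ring R] [Ring S] [Algebra ℤ R] [Algebra ℤ S] (f : R →+* S) :
    R →ₐ[ℤ] S :=
  { f with commutes' := fun n => by simp }

lemma algHom_ext_zero {S : Type*} [CommRing S] [alg : Algebra ℤ S]
    (hS : @Module.Flat ℤ S _ _ alg.toModule) (hp : p.Prime) {φ ψ : Coord p →ₐ[ℤ] S} (h : φ (gen p 0) = ψ (gen p 0)) : φ = ψ := by
  have := @isAddTorsionFree_of_flat S _ alg.toModule hS
  have h1 : φ.toRingHom = ψ.toRingHom := ringHom_ext_zero hp h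
  exact AlgHom.ext fun x => DFunLike.congr_fun h1 x

lemma exists_counit (hp : p.Prime) : ∃ φ : Coord p →ₐ[ℤ] ℤ, ∀ n, φ (gen p n) = 0 := by
  obtain ⟨φ, hφ⟩ := exists_lift (T := ℤ) hp (fun _ => 0) (fun _ => by simp [hp.ne_zero])
  exact ⟨toAlgHom φ, hφ⟩

lemma exists_antipode (hp : p.Prime) :
    ∃ φ : Coord p →ₐ[ℤ] Coord p, φ (gen p 0) = -gen p 0 := by
  obtain ⟨ε, hε⟩ := exists_counit (p := p) hp
  have := isAddTorsionFree_of_flat (Coord p)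
  obtain ⟨v, h0, hv⟩ := exists_seq hp ε.toRingHom (fun f g hf hg => ringHom_ext fun n => by
    rw [hf, hg, gen_pow hp]
    refine (Ideal.Quotient.eq_zero_iff_mem.2 ?_).trans ?_
    · exact Ideal.mul_mem_right _ _ (Ideal.mem_span_singleton_self _)
    · simp [hε]) (-gen p 0) (by simp [hε])
  obtain ⟨φ, hφ⟩ := exists_lift hp v hv
  exact ⟨toAlgHom φ, (hφ 0).trans h0⟩

lemma mk_tmul_pow (hp : p.Prime) (n : ℕ) :
    Ideal.Quotient.mk (Ideal.span {((p : ℕ) : Coord p ⊗[ℤ] Coord p)})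
      ((gen p n ⊗ₜ[ℤ] (1 : Coord p)) ^ p) = 0 ∧
    Ideal.Quotient.mk (Ideal.span {((p : ℕ) : Coord p ⊗[ℤ] Coord p)})
      (((1 : Coord p) ⊗ₜ[ℤ] gen p n) ^ p) = 0 := by
  constructor
  · have h : (gen p n ⊗ₜ[ℤ] (1 : Coord p)) ^ p =
        ((p : ℕ) : Coord p ⊗[ℤ] Coord p) * (gen p (n + 1) ⊗ₜ 1) := by
      have := congrArg (Algebra.TensorProduct.includeLeftRingHom (R := ℤ) (A := Coord p)
        (B := Coord p)) (gen_pow hp n)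
      rw [map_pow, map_mul, map_natCast] at this
      exact this
    rw [h]
    exact Ideal.Quotient.eq_zero_iff_mem.2
      (Ideal.mul_mem_right _ _ (Ideal.mem_span_singleton_self _))
  · have h : ((1 : Coord p) ⊗ₜ[ℤ] gen p n) ^ p =
        ((p : ℕ) : Coord p ⊗[ℤ] Coord p) * (1 ⊗ₜ gen p (n + 1)) := by
      have := congrArg (Algebra.TensorProduct.includeRight (R := ℤ) (A := Coord p)
        (B := Coord p)) (gen_pow hp n)
      rw [map_pow, map_mul, map_natCast] at this
      exact this
    rw [h]
    exact Ideal.Quotient.eq_zero_iff_mem.2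
      (Ideal.mul_mem_right _ _ (Ideal.mem_span_singleton_self _))

lemma exists_comul (hp : p.Prime) :
    ∃ φ : Coord p →ₐ[ℤ] Coord p ⊗[ℤ] Coord p,
      φ (gen p 0) = gen p 0 ⊗ₜ 1 + 1 ⊗ₜ gen p 0 := by
  obtain ⟨ε, hε⟩ := exists_counit (p := p) hp
  have := @isAddTorsionFree_of_flat (Coord p ⊗[ℤ] Coord p) _ Algebra.toModule (flat₂ ℤ _ _)
  let ε' : Coord p ⊗[ℤ] Coord p →ₐ[ℤ] ℤ := Algebra.TensorProduct.productMap ε ε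
  have h1 : ∀ n, ε' (gen p n ⊗ₜ 1) = 0 := fun n => by simp [ε', hε]
  have h2 : ∀ n, ε' (1 ⊗ₜ gen p n) = 0 := fun n => by simp [ε', hε]
  obtain ⟨v, h0, hv⟩ := exists_seq (T := Coord p ⊗[ℤ] Coord p) hp ε'.toRingHom
    (fun f g hf hg => by
      have h : toAlgHom f = toAlgHom g := by
        refine Algebra.TensorProduct.ext ?_ ?_
        · refine AlgHom.coe_ringHom_injective (ringHom_ext fun n => ?_)
          refine (hf (gen p n ⊗ₜ 1)).trans (Eq.trans ?_ (hg (gen p n ⊗ₜ 1)).symm)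
          refine (mk_tmul_pow hp n).1.trans (Eq.trans ?_ (congrArg (Int.castRingHom _) (h1 n)).symm)
          exact (map_zero _).symm
        · refine AlgHom.coe_ringHom_injective (ringHom_ext fun n => ?_)
          refine (hf (1 ⊗ₜ gen p n)).trans (Eq.trans ?_ (hg (1 ⊗ₜ gen p n)).symm)
          refine (mk_tmul_pow hp n).2.trans (Eq.trans ?_ (congrArg (Int.castRingHom _) (h2 n)).symm)
          exact (map_zero _).symm
      exact RingHom.ext fun x => DFunLike.congr_fun h x)
    (gen p 0 ⊗ₜ 1 + 1 ⊗ₜ gen p 0)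
    ((map_add ε' _ _).trans (by rw [h1, h2, add_zero]))
  obtain ⟨φ, hφ⟩ := exists_lift hp v hv
  exact ⟨toAlgHom φ, (hφ 0).trans h0⟩

variable (p) [hp : Fact p.Prime]

/-- The comultiplication: the homomorphism taking `x` to `x ⊗ 1 + 1 ⊗ x`. -/
noncomputable def comulHom : Coord p →ₐ[ℤ] Coord p ⊗[ℤ] Coord p := (exists_comul hp.out).choose

/-- The counit: the homomorphism taking `x` to `0`. -/
noncomputable def counitHom : Coord p →ₐ[ℤ] ℤ := (exists_counit hp.out).choose

/-- The antipode: the homomorphism taking `x` to `-x`. -/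
noncomputable def antipodeHom : Coord p →ₐ[ℤ] Coord p := (exists_antipode hp.out).choose

@[simp] lemma comulHom_gen : comulHom p (gen p 0) = gen p 0 ⊗ₜ 1 + 1 ⊗ₜ gen p 0 :=
  (exists_comul hp.out).choose_spec

@[simp] lemma counitHom_gen : counitHom p (gen p 0) = 0 := (exists_counit hp.out).choose_spec 0

@[simp] lemma antipodeHom_gen : antipodeHom p (gen p 0) = -gen p 0 :=
  (exists_antipode hp.out).choose_spec

lemma coassoc : (Algebra.TensorProduct.assoc ℤ ℤ ℤ (Coord p) (Coord p) (Coord p)).toAlgHom.comp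
      ((Algebra.TensorProduct.map (comulHom p) (.id ℤ (Coord p))).comp (comulHom p))
      = (Algebra.TensorProduct.map (.id ℤ (Coord p)) (comulHom p)).comp (comulHom p) := by
  refine algHom_ext_zero (flat₃ ℤ (Coord p)) hp.out ?_
  simp only [AlgHom.comp_apply, comulHom_gen, map_add, Algebra.TensorProduct.map_tmul,
      map_one, Algebra.TensorProduct.one_def, TensorProduct.add_tmul, TensorProduct.tmul_add, AlgHom.id_apply]
  exact add_assoc _ _ _

noncomputable instance : Bialgebra ℤ (Coord p) :=
  Bialgebra.ofAlgHom (comulHom p) (counitHom p) (coassoc p)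
    (algHom_ext_zero (flat₂ ℤ ℤ (Coord p)) hp.out (by simp))
    (algHom_ext_zero (flat₂ ℤ (Coord p) ℤ) hp.out (by simp))

noncomputable instance : HopfAlgebra ℤ (Coord p) where
  antipode := (antipodeHom p).toLinearMap
  mul_antipode_rTensor_comul := by
    have : ((Algebra.TensorProduct.lmul' ℤ (S := Coord p)).comp
      ((Algebra.TensorProduct.map (antipodeHom p) (AlgHom.id ℤ _)).comp (comulHom p))) =
      (Algebra.ofId ℤ _).comp (counitHom p) := algHom_ext_zero flat_coord hp.out (by simp)
    exact congrArg AlgHom.toLinearMap this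
  mul_antipode_lTensor_comul := by
    have : ((Algebra.TensorProduct.lmul' ℤ (S := Coord p)).comp
      ((Algebra.TensorProduct.map (AlgHom.id ℤ _) (antipodeHom p)).comp (comulHom p))) =
      (Algebra.ofId ℤ _).comp (counitHom p) := algHom_ext_zero flat_coord hp.out (by simp)
    exact congrArg AlgHom.toLinearMap this

instance : Coalgebra.IsCocomm ℤ (Coord p) where
  comm_comp_comul := by
    have : (Algebra.TensorProduct.comm ℤ (Coord p) (Coord p)).toAlgHom.comp (comulHom p) =
      comulHom p := algHom_ext_zero (flat₂ ℤ _ _) hp.out (by simp [add_comm])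
    exact congrArg AlgHom.toLinearMap this

end Sharp

/-! ### The group schemes -/

open AlgebraicGeometry

/-- The presheaf `X ↦ T(Γ(X))` on the category of schemes associated with a functor `T` on rings.
If `T` is represented by the ring `R`, this is the functor of points of `Spec R`. -/
noncomputable def toPresheaf (T : CommRingCat.{u} ⥤ AddCommGrpCat.{u}) :
    Scheme.{u}ᵒᵖ ⥤ AddCommGrpCat.{u} := Scheme.Γ ⋙ T

/-- A functor on rings which is represented by a ring gives an fpqc sheaf. -/
lemma isSheaf_toPresheaf (T : CommRingCat.{u} ⥤ AddCommGrpCat.{u}) (R : CommRingCat.{u})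
    (e : ∀ S : CommRingCat.{u}, (R ⟶ S) ≃ T.obj S)
    (he : ∀ {S S' : CommRingCat.{u}} (f : S ⟶ S') (g : R ⟶ S),
      e S' (g ≫ f) = (T.map f).hom (e S g)) :
    Presieve.IsSheaf Scheme.fpqcTopology (toPresheaf T ⋙ forget AddCommGrpCat.{u}) := by
  have h : (toPresheaf T ⋙ forget AddCommGrpCat.{u}).RepresentableBy (Spec R) :=
    { homEquiv := fun {X} => ((ΓSpec.adjunction.homEquiv X (op R)).symm.trans
        ⟨Quiver.Hom.unop, Quiver.Hom.op, fun _ => rfl, fun _ => rfl⟩).trans (e _)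
      homEquiv_comp := fun {X X'} f g => by
        refine Eq.trans ?_ (he (Scheme.Γ.map f.op) ((ΓSpec.adjunction.homEquiv X' (op R)).symm g).unop)
        refine congrArg (e _) ?_
        exact congrArg Quiver.Hom.unop (ΓSpec.adjunction.homEquiv_naturality_left_symm f g) }
  have := h.isRepresentable
  exact GrothendieckTopology.Subcanonical.isSheaf_of_isRepresentable _

/-- The homomorphism from (a copy of) `ℤ`. -/
def fromInt (S : Type u) [CommRing S] : ULift.{u} ℤ →+* S :=
  (Int.castRingHom S).comp ULift.ringEquiv.toRingHom

lemma fromInt_unique {S : Type u} [CommRing S] (f g : ULift.{u} ℤ →+* S) : f = g := by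
  have : f.comp ULift.ringEquiv.symm.toRingHom = g.comp ULift.ringEquiv.symm.toRingHom :=
    RingHom.ext_int _ _
  exact RingHom.ext fun x => DFunLike.congr_fun this x.down

/-- The functor `R ↦ R` (the additive group). -/
def gaFunctor : CommRingCat.{u} ⥤ AddCommGrpCat.{u} where
  obj R := AddCommGrpCat.of R
  map f := AddCommGrpCat.ofHom f.hom.toAddMonoidHom

/-- The functor `R ↦ W(R)` of `p`-typical Witt vectors. -/
noncomputable def wittFunctor (p : ℕ) [Fact p.Prime] : CommRingCat.{u} ⥤ AddCommGrpCat.{u} where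
  obj R := AddCommGrpCat.of (WittVector p R)
  map f := AddCommGrpCat.ofHom (WittVector.map f.hom).toAddMonoidHom
  map_id R := AddCommGrpCat.hom_ext (AddMonoidHom.ext fun x => WittVector.ext fun _ => rfl)
  map_comp f g := AddCommGrpCat.hom_ext (AddMonoidHom.ext fun x => WittVector.ext fun _ => rfl)

/-- The group of `R`-points of the group scheme `𝔾ₐ^♯ = Spec (Sharp.Coord p)`, written additively:
the ring homomorphisms from the Hopf algebra `Sharp.Coord p` to `R`. -/
def sharpPoints (p : ℕ) [Fact p.Prime] (R : Type u) [CommRing R] : Type u :=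
  Additive (WithConv (Sharp.Coord p →ₐ[ℤ] R))

namespace sharpPoints

variable {p : ℕ} [Fact p.Prime] {R S : Type u} [CommRing R] [CommRing S]

noncomputable instance : AddCommMonoid (sharpPoints p R) :=
  inferInstanceAs (AddCommMonoid (Additive (WithConv (Sharp.Coord p →ₐ[ℤ] R))))

/-- The point given by a homomorphism. -/
def of (φ : Sharp.Coord p →ₐ[ℤ] R) : sharpPoints p R := Additive.ofMul (.toConv φ)

/-- The homomorphism given by a point. -/
def hom (x : sharpPoints p R) : Sharp.Coord p →ₐ[ℤ] R := (Additive.toMul x).ofConv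

lemma hom_injective : Function.Injective (hom : sharpPoints p R → _) := fun _ _ h =>
  congrArg of h

lemma hom_zero : hom (0 : sharpPoints p R) =
    (Algebra.ofId ℤ R).comp (Bialgebra.counitAlgHom ℤ (Sharp.Coord p)) := rfl

lemma hom_add (x y : sharpPoints p R) : hom (x + y) =
    ((Algebra.TensorProduct.lmul' ℤ).comp (Algebra.TensorProduct.map (hom x) (hom y))).comp
      (Bialgebra.comulAlgHom ℤ (Sharp.Coord p)) := rfl

noncomputable instance : Neg (sharpPoints p R) :=
  ⟨fun x => of ((hom x).comp (HopfAlgebra.antipodeAlgHom ℤ (Sharp.Coord p)))⟩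

lemma hom_neg (x : sharpPoints p R) : hom (-x) =
    (hom x).comp (HopfAlgebra.antipodeAlgHom ℤ (Sharp.Coord p)) := rfl

protected lemma neg_add_cancel (x : sharpPoints p R) : -x + x = 0 := by
  refine hom_injective ?_
  rw [hom_add, hom_neg, hom_zero]
  have h1 : (Algebra.TensorProduct.lmul' ℤ).comp (Algebra.TensorProduct.map ((hom x).comp
      (HopfAlgebra.antipodeAlgHom ℤ (Sharp.Coord p))) (hom x)) =
      ((hom x).comp (Algebra.TensorProduct.lmul' ℤ)).comp (Algebra.TensorProduct.map
        (HopfAlgebra.antipodeAlgHom ℤ (Sharp.Coord p)) (.id ℤ _)) := by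
    ext <;> simp
  rw [h1]
  ext a
  have h2 := congrArg (hom x)
    (HopfAlgebra.mul_antipode_rTensor_comul_apply (R := ℤ) a)
  exact h2.trans ((hom x).commutes _)

noncomputable instance : AddCommGroup (sharpPoints p R) where
  zsmul := zsmulRec
  neg_add_cancel := sharpPoints.neg_add_cancel
  add_comm := add_comm

/-- The map on points induced by a ring homomorphism. -/
noncomputable def map (f : R →+* S) : sharpPoints p R →+ sharpPoints p S where
  toFun x := of (f.toIntAlgHom.comp (hom x))
  map_zero' := hom_injective (by
    ext a
    exact (f.toIntAlgHom.comp (Algebra.ofId ℤ R)).commutes _)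
  map_add' x y := hom_injective (by
    have h : f.toIntAlgHom.comp ((Algebra.TensorProduct.lmul' ℤ).comp
        (Algebra.TensorProduct.map (hom x) (hom y))) =
        (Algebra.TensorProduct.lmul' ℤ).comp (Algebra.TensorProduct.map
          (f.toIntAlgHom.comp (hom x)) (f.toIntAlgHom.comp (hom y))) := by
      ext <;> simp
    exact congrArg (fun φ => φ.comp (Bialgebra.comulAlgHom ℤ (Sharp.Coord p))) h)

/-- The homomorphism `𝔾ₐ^♯(R) → R` given by the inclusion `ℤ[x] ⊆ Sharp.Coord p`. -/
noncomputable def toGa : sharpPoints p R →+ R where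
  toFun x := hom x (Sharp.gen p 0)
  map_zero' := (congrArg (algebraMap ℤ R) (Sharp.counitHom_gen p)).trans (map_zero _)
  map_add' x y := by
    refine (congrArg ((Algebra.TensorProduct.lmul' ℤ).comp
      (Algebra.TensorProduct.map (hom x) (hom y))) (Sharp.comulHom_gen p)).trans ?_
    simp

end sharpPoints

/-- The functor of points of the group scheme `𝔾ₐ^♯`. -/
noncomputable def sharpFunctor (p : ℕ) [Fact p.Prime] : CommRingCat.{u} ⥤ AddCommGrpCat.{u} where
  obj R := AddCommGrpCat.of (sharpPoints p R)
  map f := AddCommGrpCat.ofHom (sharpPoints.map f.hom)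
  map_id R := rfl
  map_comp f g := rfl


lemma isSheaf_ga : Presieve.IsSheaf Scheme.fpqcTopology
    (toPresheaf gaFunctor.{u} ⋙ forget AddCommGrpCat.{u}) :=
  isSheaf_toPresheaf _ (CommRingCat.of (Polynomial (ULift.{u} ℤ)))
    (fun S =>
      { toFun := fun f => f.hom Polynomial.X
        invFun := fun s => CommRingCat.ofHom (Polynomial.eval₂RingHom (fromInt S) s)
        left_inv := fun f => CommRingCat.hom_ext
          (Polynomial.ringHom_ext' (fromInt_unique _ _) (by simp))
        right_inv := fun s => by
          exact Polynomial.eval₂_X (fromInt S) (show (S : Type u) from s) }) (fun f g => rfl)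

lemma isSheaf_witt (p : ℕ) [Fact p.Prime] : Presieve.IsSheaf Scheme.fpqcTopology
    (toPresheaf (wittFunctor.{u} p) ⋙ forget AddCommGrpCat.{u}) :=
  isSheaf_toPresheaf _ (CommRingCat.of (MvPolynomial ℕ (ULift.{u} ℤ)))
    (fun S =>
      { toFun := fun f => WittVector.mk p fun n => f.hom (MvPolynomial.X n)
        invFun := fun s => CommRingCat.ofHom (MvPolynomial.eval₂Hom (fromInt S) (WittVector.coeff s))
        left_inv := fun f => CommRingCat.hom_ext
          (MvPolynomial.ringHom_ext' (fromInt_unique _ _) (by intro i; simp))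
        right_inv := fun s => WittVector.ext fun n => by
          change MvPolynomial.eval₂ (fromInt S) (WittVector.coeff s) (MvPolynomial.X n) = s.coeff n
          simp }) (fun f g => rfl)

lemma isSheaf_sharp (p : ℕ) [Fact p.Prime] : Presieve.IsSheaf Scheme.fpqcTopology
    (toPresheaf (sharpFunctor.{u} p) ⋙ forget AddCommGrpCat.{u}) :=
  isSheaf_toPresheaf _ (CommRingCat.of (ULift.{u} (Sharp.Coord p)))
    (fun S =>
      { toFun := fun f => sharpPoints.of
          (Sharp.toAlgHom (f.hom.comp ULift.ringEquiv.symm.toRingHom))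
        invFun := fun s => CommRingCat.ofHom
          ((sharpPoints.hom s).toRingHom.comp ULift.ringEquiv.toRingHom)
        left_inv := fun f => rfl
        right_inv := fun s => rfl }) (fun f g => rfl)

/-- The functor of points of `𝔾ₐ^♯ × W`. -/
noncomputable def sharpProdWittFunctor (p : ℕ) [Fact p.Prime] :
    CommRingCat.{u} ⥤ AddCommGrpCat.{u} where
  obj R := AddCommGrpCat.of (sharpPoints p R × WittVector p R)
  map f := AddCommGrpCat.ofHom
    ((sharpPoints.map f.hom).prodMap (WittVector.map f.hom).toAddMonoidHom)
  map_id R := rfl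
  map_comp f g := rfl

/-- Homomorphisms out of a polynomial ring. -/
noncomputable def mvPolynomialHomEquiv (A S : Type u) [CommRing A] [CommRing S] :
    (MvPolynomial ℕ A →+* S) ≃ (A →+* S) × (ℕ → S) where
  toFun f := (f.comp MvPolynomial.C, fun n => f (MvPolynomial.X n))
  invFun s := MvPolynomial.eval₂Hom s.1 s.2
  left_inv f := MvPolynomial.ringHom_ext' (RingHom.ext fun x => by simp) (fun i => by simp)
  right_inv s := Prod.ext (RingHom.ext fun x => by simp) (funext fun i => by simp)

lemma isSheaf_sharpProdWitt (p : ℕ) [Fact p.Prime] : Presieve.IsSheaf Scheme.fpqcTopology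
    (toPresheaf (sharpProdWittFunctor.{u} p) ⋙ forget AddCommGrpCat.{u}) :=
  isSheaf_toPresheaf _ (CommRingCat.of (MvPolynomial ℕ (ULift.{u} (Sharp.Coord p))))
    (fun S => ((⟨fun f => f.hom, CommRingCat.ofHom, fun _ => rfl, fun _ => rfl⟩ :
        (CommRingCat.of (MvPolynomial ℕ (ULift.{u} (Sharp.Coord p))) ⟶ S) ≃ _).trans
      (mvPolynomialHomEquiv (ULift.{u} (Sharp.Coord p)) S)).trans
      { toFun := fun f => (sharpPoints.of (Sharp.toAlgHom
            (f.1.comp ULift.ringEquiv.symm.toRingHom)), WittVector.mk p f.2)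
        invFun := fun s => ((sharpPoints.hom s.1).toRingHom.comp ULift.ringEquiv.toRingHom,
          WittVector.coeff s.2)
        left_inv := fun f => rfl
        right_inv := fun s => rfl }) (fun f g => rfl)

section Maps

variable (p : ℕ) [Fact p.Prime]

lemma map_add_verschiebung {p : ℕ} [Fact p.Prime] {R S : Type*} [CommRing R] [CommRing S]
    (f : R →+* S) {a' : WittVector p S} (a b : WittVector p R) (h : a' = WittVector.map f a) :
    a' + WittVector.verschiebung (WittVector.map f b) =
      WittVector.map f (a + WittVector.verschiebung b) := by
  rw [map_add, WittVector.map_verschiebung, h]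

lemma constantCoeff_add_verschiebung {p : ℕ} [Fact p.Prime] {R : Type*} [CommRing R]
    (a b : WittVector p R) : WittVector.constantCoeff (a + WittVector.verschiebung b) =
      WittVector.constantCoeff a := by
  have h : WittVector.constantCoeff (WittVector.verschiebung b) = 0 :=
    WittVector.verschiebung_coeff_zero b
  rw [map_add, h, add_zero]

lemma frobenius_add_verschiebung {p : ℕ} [Fact p.Prime] {R : Type*} [CommRing R]
    (a b : WittVector p R) (h : WittVector.frobenius a = 0) :
    WittVector.frobenius (a + WittVector.verschiebung b) = p • b := by
  rw [map_add, h, zero_add, WittVector.frobenius_verschiebung, nsmul_eq_mul, mul_comm]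

/-- The sheaf of abelian groups `𝔾ₐ` on the category of schemes. -/
noncomputable abbrev Ga : Scheme.{u}ᵒᵖ ⥤ AddCommGrpCat.{u} := toPresheaf gaFunctor

/-- The sheaf of abelian groups `W` on the category of schemes. -/
noncomputable abbrev Witt : Scheme.{u}ᵒᵖ ⥤ AddCommGrpCat.{u} := toPresheaf (wittFunctor p)

/-- The sheaf of abelian groups `𝔾ₐ^♯` on the category of schemes. -/
noncomputable abbrev GaSharp : Scheme.{u}ᵒᵖ ⥤ AddCommGrpCat.{u} := toPresheaf (sharpFunctor p)

/-- The sheaf of abelian groups `𝔾ₐ^♯ × W` on the category of schemes. -/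
noncomputable abbrev GaSharpProdWitt : Scheme.{u}ᵒᵖ ⥤ AddCommGrpCat.{u} :=
  toPresheaf (sharpProdWittFunctor p)

/-- The canonical homomorphism `𝔾ₐ^♯ ⟶ 𝔾ₐ`. -/
noncomputable def sharpToGa : GaSharp.{u} p ⟶ Ga.{u} :=
  Functor.whiskerLeft Scheme.Γ
    { app := fun R => AddCommGrpCat.ofHom (sharpPoints.toGa (p := p) (R := R))
      naturality := fun _ _ _ => rfl }

/-- The canonical homomorphism `W ⟶ W/VW = 𝔾ₐ`, the component of index `0`. -/
noncomputable def wittToGa : Witt.{u} p ⟶ Ga.{u} :=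
  Functor.whiskerLeft Scheme.Γ
    { app := fun R => AddCommGrpCat.ofHom
        (WittVector.constantCoeff (p := p) (R := R)).toAddMonoidHom
      naturality := fun _ _ _ => rfl }

/-- The Witt vector Frobenius `F : W ⟶ W`. -/
noncomputable def wittF : Witt.{u} p ⟶ Witt.{u} p :=
  Functor.whiskerLeft Scheme.Γ
    { app := fun R => AddCommGrpCat.ofHom
        (WittVector.frobenius (p := p) (R := R)).toAddMonoidHom
      naturality := fun R S f => AddCommGrpCat.hom_ext (AddMonoidHom.ext fun x =>
        ((WittVector.IsPoly.map (WittVector.frobenius_isPoly p) f.hom x)).symm) }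

/-- Multiplication by `p` on `W`. -/
noncomputable def wittMulP : Witt.{u} p ⟶ Witt.{u} p :=
  Functor.whiskerLeft Scheme.Γ
    { app := fun R => AddCommGrpCat.ofHom (nsmulAddMonoidHom (α := WittVector p R) p)
      naturality := fun R S f => AddCommGrpCat.hom_ext (AddMonoidHom.ext fun x =>
        (map_nsmul (WittVector.map f.hom) p x).symm) }

variable {p}

/-- The homomorphism `𝔾ₐ^♯ × W ⟶ W` given by `(x, b) ↦ σ(x) + V(b)`. -/
noncomputable def sharpAddV (σ : GaSharp.{u} p ⟶ Witt.{u} p) :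
    GaSharpProdWitt.{u} p ⟶ Witt.{u} p where
  app X := AddCommGrpCat.ofHom (AddMonoidHom.coprod (σ.app X).hom
    (WittVector.verschiebung (p := p) (R := Scheme.Γ.obj X)))
  naturality X Y f := AddCommGrpCat.hom_ext (AddMonoidHom.ext fun x => by
    have h1 : (σ.app Y).hom ((GaSharp p).map f x.1) =
        WittVector.map (Scheme.Γ.map f).hom ((σ.app X).hom x.1) :=
      DFunLike.congr_fun (congrArg AddCommGrpCat.Hom.hom (σ.naturality f)) x.1
    exact map_add_verschiebung (Scheme.Γ.map f).hom _ x.2 h1)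

/-- A homomorphism `σ : 𝔾ₐ^♯ ⟶ W` such that `F ∘ σ = 0` and such that the composition of `σ`
with `W ⟶ 𝔾ₐ` is the canonical homomorphism `𝔾ₐ^♯ ⟶ 𝔾ₐ`. -/
structure IsWittLift (σ : GaSharp.{u} p ⟶ Witt.{u} p) : Prop where
  comp_F : σ ≫ wittF p = 0
  comp_toGa : σ ≫ wittToGa p = sharpToGa p

variable (p)

/-- The complex `𝔾ₐ^♯ ⟶ 𝔾ₐ`. -/
noncomputable def sharpComplex : TwoTerm Scheme.fpqcTopology.{u} where
  A := GaSharp p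
  B := Ga
  d := sharpToGa p
  isSheaf_A := isSheaf_sharp p
  isSheaf_B := isSheaf_ga

/-- The complex `p : W ⟶ W`. -/
noncomputable def wittComplex : TwoTerm Scheme.fpqcTopology.{u} where
  A := Witt p
  B := Witt p
  d := wittMulP p
  isSheaf_A := isSheaf_witt p
  isSheaf_B := isSheaf_witt p

variable {p}

/-- The complex `𝔾ₐ^♯ × W ⟶ W`, `(x, b) ↦ σ(x) + V(b)`. -/
noncomputable def middleComplex (σ : GaSharp.{u} p ⟶ Witt.{u} p) :
    TwoTerm Scheme.fpqcTopology.{u} where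
  A := GaSharpProdWitt p
  B := Witt p
  d := sharpAddV σ
  isSheaf_A := isSheaf_sharpProdWitt p
  isSheaf_B := isSheaf_witt p

/-- The morphism of complexes `(x, b) ↦ x`, `w ↦ w₀`. -/
noncomputable def middleToSharp (σ : GaSharp.{u} p ⟶ Witt.{u} p) (hσ : IsWittLift σ) :
    TwoTerm.Hom (middleComplex σ) (sharpComplex p) where
  f := Functor.whiskerLeft Scheme.Γ
    { app := fun R => AddCommGrpCat.ofHom (AddMonoidHom.fst (sharpPoints p R) (WittVector p R))
      naturality := fun _ _ _ => rfl }
  g := wittToGa p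
  comm := by
    ext X x
    have h1 := DFunLike.congr_fun (congrArg AddCommGrpCat.Hom.hom
      (NatTrans.congr_app hσ.comp_toGa X)) x.1
    exact h1.symm.trans (constantCoeff_add_verschiebung (R := Scheme.Γ.obj X)
      ((σ.app X).hom x.1) x.2).symm

/-- The morphism of complexes `(x, b) ↦ b`, `w ↦ F(w)`. -/
noncomputable def middleToWitt (σ : GaSharp.{u} p ⟶ Witt.{u} p) (hσ : IsWittLift σ) :
    TwoTerm.Hom (middleComplex σ) (wittComplex p) where
  f := Functor.whiskerLeft Scheme.Γ
    { app := fun R => AddCommGrpCat.ofHom (AddMonoidHom.snd (sharpPoints p R) (WittVector p R))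
      naturality := fun _ _ _ => rfl }
  g := wittF p
  comm := by
    ext X x
    have h1 := DFunLike.congr_fun (congrArg AddCommGrpCat.Hom.hom
      (NatTrans.congr_app hσ.comp_F X)) x.1
    exact (frobenius_add_verschiebung (R := Scheme.Γ.obj X) ((σ.app X).hom x.1) x.2 h1).symm

end Maps

/-! Both `middleToSharp` and `middleToWitt` are quasi-isomorphisms of complexes of sheaves, so each
induces an equivalence of Picard stacks; Φ is an inverse of the first followed by the second. The
quasi-isomorphism property is used in the concrete form `IsLocalEquiv`: the source of the first
complex is the fibre product A' ×_{B'} B, and B → B' is locally surjective. Descent data and their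
morphisms then lift explicitly. A lifted morphism is determined by its image, which makes the
coherence conditions for the inverse automatic (`eq_of_kills`).

For `middleToSharp` the input is the exact sequence 0 → W → W → 𝔾ₐ → 0 given by V and w ↦ w₀. For
`middleToWitt` it is FV = p together with the exact sequence 0 → 𝔾ₐ^♯ → W → W → 0 given by σ and F:
if F(w) = pv, then w - V(v) lies in the kernel of F. This second sequence is the real content.

Surjectivity of F for the fpqc topology follows from faithful flatness of the endomorphism of ℤ[X₀,
X₁, …] defining F (`FrobeniusAlgebra.faithfullyFlat`). Modulo p this endomorphism raises the
variables to the p-th power, so the target is free on the monomials with exponents less than p.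
After inverting p, ghost components exhibit the target as a polynomial ring in one variable over the
source. The criterion `Module.Flat.of_free_quotient_of_flat` combines the two statements. The fibres
are nonempty because F is surjective on Witt vectors of an algebraically closed field.

For the kernel, base change along w = 0 gives a flat, hence torsion-free, ring D representing ker F.
Over a torsion-free ring a Witt vector is determined by its Frobenius and its zeroth coordinate
(`eq_of_frobenius_eq`). Since F is the p-th power on coordinates modulo p, the p-th powers in the
augmentation ideal of D are divisible by p, so the zeroth coordinate has the iterated divided powers
x^p/p, … and defines a map from the coordinate ring of 𝔾ₐ^♯ to D. Conversely, the Witt vector over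
ℚ[x] with ghost components (x, 0, 0, …) has coordinates in that coordinate ring. This identifies
𝔾ₐ^♯ with ker F (`Sharp.exists_map_wittVector_eq_and_injective`). Uniqueness of σ is checked at the
universal point, which lives over a torsion-free ring. -/

namespace TwoTerm

variable {C : Type u₁} [Category.{v₁} C] {J : GrothendieckTopology C}

open ConeObj

/-! ### Quasi-isomorphisms in fibre-product form and lifting of descent data. -/

namespace Hom

variable {K K' K'' : TwoTerm.{w} J}

/-- A morphism of complexes `q` such that `A` is the fibre product of `A'` and `B` over `B'`,
such that `B → B'` is locally surjective, and such that `A' → B'` factors through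
the image of `B`. These conditions imply that `q` is a quasi-isomorphism. -/
structure IsLocalEquiv (q : Hom K K') : Prop where
  exists_lift : ∀ ⦃Y : C⦄ (b : K.B.obj (op Y)) (a' : K'.A.obj (op Y)),
    (q.g.app (op Y)).hom b = K'.dAt Y a' → ∃ a, (q.f.app (op Y)).hom a = a' ∧ K.dAt Y a = b
  eq_zero : ∀ ⦃Y : C⦄ (a : K.A.obj (op Y)), (q.f.app (op Y)).hom a = 0 → K.dAt Y a = 0 → a = 0
  exists_d : ∀ ⦃Y : C⦄ (a' : K'.A.obj (op Y)), ∃ b, (q.g.app (op Y)).hom b = K'.dAt Y a'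
  locally_surjective : ∀ ⦃Y : C⦄ (b' : K'.B.obj (op Y)), ∃ S ∈ J Y, ∀ ⦃Z⦄ (g : Z ⟶ Y), S g →
    ∃ b, (q.g.app (op Z)).hom b = res K'.B g b'

namespace IsLocalEquiv

variable {q : Hom K K'} (hq : q.IsLocalEquiv) {X : C}

include hq

/-- The uniqueness half of the fibre-product property: an identity in A may be checked separately in
A' and in B. -/
lemma ext {Y : C} {a₁ a₂ : K.A.obj (op Y)} (h : (q.f.app (op Y)).hom a₁ = (q.f.app (op Y)).hom a₂)
    (hd : K.dAt Y a₁ = K.dAt Y a₂) : a₁ = a₂ :=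
  sub_eq_zero.1 (hq.eq_zero _ (by rw [map_sub, h, sub_self]) (by rw [map_sub, hd, sub_self]))

/-- The differential of a component is forced by the values at source and target, so only the images
in A' remain to be compared. -/
lemma hom_ext {x y : K.ConeObj X} {φ ψ : x ⟶ y} {T : Sieve X} (hT : T ∈ J X)
    (h : ∀ ⦃Y⦄ (f : Y ⟶ X) (_ : T f) (hx : x.sieve f) (hy : y.sieve f),
      (q.f.app (op Y)).hom (ConeObj.Hom.c φ f hx hy) =
        (q.f.app (op Y)).hom (ConeObj.Hom.c ψ f hx hy)) : φ = ψ :=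
  ConeObj.Hom.ext_of hT fun Y f hf hx hy => hq.ext (h f hf hx hy)
    (add_left_cancel ((ConeObj.Hom.d_c φ f hx hy).trans (ConeObj.Hom.d_c ψ f hx hy).symm))

/-- A morphism between descent data is determined by its image. -/
lemma exists_hom (x y : K.ConeObj X) {T : Sieve X} (hT : T ∈ J X)
    (c : ∀ ⦃Y⦄ (f : Y ⟶ X), T f → x.sieve f → y.sieve f → K'.A.obj (op Y))
    (d_c : ∀ ⦃Y : C⦄ (f : Y ⟶ X) (hT : T f) (hx : x.sieve f) (hy : y.sieve f),
      (q.g.app (op Y)).hom (x.b f hx) + K'.dAt Y (c f hT hx hy) = (q.g.app (op Y)).hom (y.b f hy))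
    (nat : ∀ ⦃Y Z : C⦄ (f : Y ⟶ X) (g : Z ⟶ Y) (hT : T f) (hx : x.sieve f) (hy : y.sieve f),
      (q.f.app (op Z)).hom (x.a f g hx) + c (g ≫ f) (T.downward_closed hT g)
        (x.sieve.downward_closed hx g) (y.sieve.downward_closed hy g) =
        res K'.A g (c f hT hx hy) + (q.f.app (op Z)).hom (y.a f g hy)) :
    ∃ φ : x ⟶ y, ∀ ⦃Y⦄ (f : Y ⟶ X) (hT : T f) (hx : x.sieve f) (hy : y.sieve f),
      (q.f.app (op Y)).hom (ConeObj.Hom.c φ f hx hy) = c f hT hx hy := by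
  -- A point of the fibre product: the part in A' is prescribed, and the part in B can only be the
  -- difference of the values of the two data.
  have key : ∀ ⦃Y⦄ (f : Y ⟶ X) (hT : T f) (hx : x.sieve f) (hy : y.sieve f),
      ∃ a, (q.f.app (op Y)).hom a = c f hT hx hy ∧ K.dAt Y a = y.b f hy - x.b f hx :=
    fun Y f hT hx hy => hq.exists_lift _ _ (by rw [map_sub, ← d_c f hT hx hy, add_sub_cancel_left])
  choose s hs hs' using key
  obtain ⟨φ, hφ⟩ := ConeObj.Hom.exists_glue x y hT s
    (fun Y f hT hx hy => by rw [hs', add_sub_cancel])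
    (fun Y Z f g hT hx hy => by
      refine hq.ext ?_ ?_
      · rw [map_add, map_add, hs, ← res_app, hs, nat f g hT hx hy]
      · rw [map_add, map_add, hs', ← res_dAt, hs', map_sub, ← x.d_a f g hx, ← y.d_a f g hy]
        abel)
  exact ⟨φ, fun Y f hT hx hy => (congrArg _ (hφ f hT hx hy)).trans (hs f hT hx hy)⟩

/-- The covering sieve on which the values of a descent datum have preimages. -/
def sieve (hq : q.IsLocalEquiv) (x : K'.ConeObj X) : Sieve X where
  arrows Y f := ∃ hf : x.sieve f, ∃ b, (q.g.app (op Y)).hom b = x.b f hf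
  downward_closed := by
    rintro Y Z f ⟨hf, b, hb⟩ g
    -- The value at `g ≫ f` is the restriction of the value at `f` plus d of the transition element;
    -- the first term lifts by restriction, the second by `exists_d`.
    obtain ⟨b', hb'⟩ := hq.exists_d (x.a f g hf)
    exact ⟨x.sieve.downward_closed hf g, res K.B g b + b', by
      rw [map_add, ← res_app, hb, hb', x.d_a]⟩

lemma sieve_mem (x : K'.ConeObj X) : hq.sieve x ∈ J X := by
  refine J.transitive x.mem _ fun Y f hf => ?_
  obtain ⟨S, hS, h⟩ := hq.locally_surjective (x.b f hf)
  refine J.superset_covering (fun Z g hg => ?_) hS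
  obtain ⟨b, hb⟩ := h g hg
  obtain ⟨b', hb'⟩ := hq.exists_d (x.a f g hf)
  exact ⟨x.sieve.downward_closed hf g, b + b', by rw [map_add, hb, hb', x.d_a]⟩

/-- The values are lifted arbitrarily on the sieve where this is possible. Each transition element,
paired with the discrepancy of the lifted values, is then a point of the fibre product and gives a
unique transition element in A. The cocycle identity is inherited in A' and telescopes in B. -/
lemma exists_obj (x : K'.ConeObj X) : ∃ y : K.ConeObj X, ∃ h : ∀ ⦃Y⦄ (f : Y ⟶ X), y.sieve f →
    x.sieve f, (∀ ⦃Y⦄ (f : Y ⟶ X) (hf : y.sieve f),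
      (q.g.app (op Y)).hom (y.b f hf) = x.b f (h f hf)) ∧
    ∀ ⦃Y Z⦄ (f : Y ⟶ X) (g : Z ⟶ Y) (hf : y.sieve f),
      (q.f.app (op Z)).hom (y.a f g hf) = x.a f g (h f hf) := by
  have h1 : ∀ ⦃Y⦄ (f : Y ⟶ X) (hf : hq.sieve x f), ∃ b, (q.g.app (op Y)).hom b = x.b f hf.1 :=
    fun Y f hf => hf.2
  choose b hb using h1
  have h2 : ∀ ⦃Y Z⦄ (f : Y ⟶ X) (g : Z ⟶ Y) (hf : hq.sieve x f), ∃ a,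
      (q.f.app (op Z)).hom a = x.a f g hf.1 ∧
      K.dAt Z a = b (g ≫ f) ((hq.sieve x).downward_closed hf g) - res K.B g (b f hf) :=
    fun Y Z f g hf => hq.exists_lift _ _ (by
      rw [map_sub, ← res_app, hb, hb, ← x.d_a f g hf.1, add_sub_cancel_left])
  choose a ha ha' using h2
  refine ⟨⟨hq.sieve x, hq.sieve_mem x, b, a, fun Y Z f g hf => by rw [ha', add_sub_cancel],
    fun Y Z T f g h hf => ?_⟩, fun Y f hf => hf.1, hb, ha⟩
  refine hq.ext ?_ ?_
  · rw [map_add, ← res_app, ha, ha, ha, x.cocycle]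
  · rw [map_add, ← res_dAt, ha', ha', ha', map_sub, res_res]
    simp only [Category.assoc]
    abel

/-- A preimage of a descent datum. -/
noncomputable def obj (x : K'.ConeObj X) : K.ConeObj X := (hq.exists_obj x).choose

lemma sieve_of_obj {x : K'.ConeObj X} {Y : C} {f : Y ⟶ X} (hf : (hq.obj x).sieve f) : x.sieve f :=
  (hq.exists_obj x).choose_spec.choose f hf

lemma obj_b {x : K'.ConeObj X} {Y : C} {f : Y ⟶ X} (hf : (hq.obj x).sieve f) :
    (q.g.app (op Y)).hom ((hq.obj x).b f hf) = x.b f (hq.sieve_of_obj hf) :=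
  (hq.exists_obj x).choose_spec.choose_spec.1 f hf

lemma obj_a {x : K'.ConeObj X} {Y Z : C} {f : Y ⟶ X} (g : Z ⟶ Y) (hf : (hq.obj x).sieve f) :
    (q.f.app (op Z)).hom ((hq.obj x).a f g hf) = x.a f g (hq.sieve_of_obj hf) :=
  (hq.exists_obj x).choose_spec.choose_spec.2 f g hf

lemma exists_map {x y : K'.ConeObj X} (φ : x ⟶ y) : ∃ ψ : hq.obj x ⟶ hq.obj y,
    ∀ ⦃Y⦄ (f : Y ⟶ X) (hx : (hq.obj x).sieve f) (hy : (hq.obj y).sieve f),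
      (q.f.app (op Y)).hom (ConeObj.Hom.c ψ f hx hy) =
        ConeObj.Hom.c φ f (hq.sieve_of_obj hx) (hq.sieve_of_obj hy) := by
  obtain ⟨ψ, hψ⟩ := hq.exists_hom (hq.obj x) (hq.obj y) (J.top_mem X)
    (fun Y f _ hx hy => ConeObj.Hom.c φ f (hq.sieve_of_obj hx) (hq.sieve_of_obj hy))
    (fun Y f _ hx hy => by rw [obj_b, obj_b, ConeObj.Hom.d_c])
    (fun Y Z f g _ hx hy => by rw [obj_a, obj_a, ConeObj.Hom.nat])
  exact ⟨ψ, fun Y f hx hy => hψ f trivial hx hy⟩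

/-- The preimage of a morphism of descent data. -/
noncomputable def map {x y : K'.ConeObj X} (φ : x ⟶ y) : hq.obj x ⟶ hq.obj y :=
  (hq.exists_map φ).choose

lemma map_c {x y : K'.ConeObj X} (φ : x ⟶ y) {Y : C} (f : Y ⟶ X) (hx : (hq.obj x).sieve f)
    (hy : (hq.obj y).sieve f) : (q.f.app (op Y)).hom (ConeObj.Hom.c (hq.map φ) f hx hy) =
      ConeObj.Hom.c φ f (hq.sieve_of_obj hx) (hq.sieve_of_obj hy) :=
  (hq.exists_map φ).choose_spec f hx hy

end IsLocalEquiv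

/-- Composition of morphisms of descent data is compatible with addition of the components. -/
lemma f_comp_c (q : Hom K K') {X : C} {x y z : K.ConeObj X} (φ : x ⟶ y) (ψ : y ⟶ z) {Y : C}
    (f : Y ⟶ X) (hx : x.sieve f) (hz : z.sieve f) (hy : y.sieve f) :
    (q.f.app (op Y)).hom (ConeObj.Hom.c (φ ≫ ψ) f hx hz) =
      (q.f.app (op Y)).hom (ConeObj.Hom.c φ f hx hy) +
        (q.f.app (op Y)).hom (ConeObj.Hom.c ψ f hy hz) :=
  (congrArg (q.f.app (op Y)).hom (comp_c φ ψ f hx hz hy)).trans (map_add _ _ _)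

lemma square_f_c (q : Hom K K') {X : C} {x y y' z : K.ConeObj X} {φ : x ⟶ y} {ψ : y ⟶ z}
    {φ' : x ⟶ y'} {ψ' : y' ⟶ z} {Y : C} {f : Y ⟶ X} {hx : x.sieve f} {hz : z.sieve f}
    (hy : y.sieve f) (hy' : y'.sieve f)
    (h : (q.f.app (op Y)).hom (ConeObj.Hom.c φ f hx hy) +
        (q.f.app (op Y)).hom (ConeObj.Hom.c ψ f hy hz) =
      (q.f.app (op Y)).hom (ConeObj.Hom.c φ' f hx hy') +
        (q.f.app (op Y)).hom (ConeObj.Hom.c ψ' f hy' hz)) :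
    (q.f.app (op Y)).hom (ConeObj.Hom.c (φ ≫ ψ) f hx hz) =
      (q.f.app (op Y)).hom (ConeObj.Hom.c (φ' ≫ ψ') f hx hz) := by
  rw [f_comp_c q φ ψ f hx hz hy, f_comp_c q φ' ψ' f hx hz hy', h]

/-- A morphism of descent data whose image has locally vanishing components. -/
class Kills (q : Hom K K') {X : C} {x y : K.ConeObj X} (φ : x ⟶ y) : Prop where
  exists_sieve : ∃ T ∈ J X, ∀ ⦃Y⦄ (f : Y ⟶ X) (_ : T f) (hx : x.sieve f) (hy : y.sieve f),
    (q.f.app (op Y)).hom (ConeObj.Hom.c φ f hx hy) = 0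

namespace Kills

variable (q : Hom K K') {X : C}

instance of_isTriv {x y : K.ConeObj X} (φ : x ⟶ y) [hφ : IsTriv φ] : q.Kills φ := by
  obtain ⟨T, hT, h⟩ := hφ
  exact ⟨T, hT, fun Y f hf hx hy => (congrArg _ (h f hf hx hy)).trans (map_zero _)⟩

instance comp {x y z : K.ConeObj X} (φ : x ⟶ y) (ψ : y ⟶ z) [hφ : q.Kills φ] [hψ : q.Kills ψ] :
    q.Kills (φ ≫ ψ) := by
  obtain ⟨T, hT, h⟩ := hφ
  obtain ⟨T', hT', h'⟩ := hψ
  refine ⟨(T ⊓ T') ⊓ y.sieve, J.intersection_covering (J.intersection_covering hT hT') y.mem,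
    fun Y f hf hx hy => ?_⟩
  rw [f_comp_c q φ ψ f hx hy hf.2, h f hf.1.1, h' f hf.1.2, add_zero]

lemma comp' {q : Hom K K'} {x y z : K.ConeObj X} {φ : x ⟶ y} {ψ : y ⟶ z} (_ : q.Kills φ)
    (_ : q.Kills ψ) : q.Kills (φ ≫ ψ) := inferInstance

lemma of_c {q : Hom K K'} {x y : K.ConeObj X} {φ : x ⟶ y} (h : ∀ ⦃Y⦄ (f : Y ⟶ X)
    (hx : x.sieve f) (hy : y.sieve f), ConeObj.Hom.c φ f hx hy = 0) : q.Kills φ :=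
  .of_isTriv q φ (hφ := .of_c h)

instance tensorHom {x x' y y' : K.ConeObj X} (φ : x ⟶ x') (ψ : y ⟶ y') [hφ : q.Kills φ]
    [hψ : q.Kills ψ] : q.Kills (φ ⊗ₘ ψ) := by
  obtain ⟨T, hT, h⟩ := hφ
  obtain ⟨T', hT', h'⟩ := hψ
  refine ⟨T ⊓ T', J.intersection_covering hT hT', fun Y f hf hx hy => ?_⟩
  exact (map_add (q.f.app (op Y)).hom _ _).trans
    ((congrArg₂ (· + ·) (h f hf.1 hx.1 hy.1) (h' f hf.2 hx.2 hy.2)).trans (add_zero _))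

instance whiskerLeft (x : K.ConeObj X) {y y' : K.ConeObj X} (ψ : y ⟶ y') [q.Kills ψ] :
    q.Kills (x ◁ ψ) :=
  inferInstanceAs (q.Kills (𝟙 x ⊗ₘ ψ))

instance whiskerRight {x x' : K.ConeObj X} (φ : x ⟶ x') (y : K.ConeObj X) [q.Kills φ] :
    q.Kills (φ ▷ y) :=
  inferInstanceAs (q.Kills (φ ⊗ₘ 𝟙 y))

instance pull {X' : C} (k : X' ⟶ X) {x y : K.ConeObj X} (φ : x ⟶ y) [hφ : q.Kills φ] :
    q.Kills ((pullFunctor K k).map φ) := by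
  obtain ⟨T, hT, h⟩ := hφ
  exact ⟨T.pullback k, J.pullback_stable k hT, fun Y f hf hx hy => h (f ≫ k) hf hx hy⟩

lemma whiskerLeft' {q : Hom K K'} {x y y' : K.ConeObj X} {ψ : y ⟶ y'} (_ : q.Kills ψ) :
    q.Kills (x ◁ ψ) := inferInstance

lemma whiskerRight' {q : Hom K K'} {x x' y : K.ConeObj X} {φ : x ⟶ x'} (_ : q.Kills φ) :
    q.Kills (φ ▷ y) := inferInstance

lemma pull' {q : Hom K K'} {X' : C} {k : X' ⟶ X} {x y : K.ConeObj X} {φ : x ⟶ y}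
    (_ : q.Kills φ) : q.Kills ((pullFunctor K k).map φ) := inferInstance

end Kills

/-! ### Morphisms with trivial image, and the equivalence on descent data. -/

namespace IsLocalEquiv

variable {q : Hom K K'} (hq : q.IsLocalEquiv) {X : C}

include hq

/-- Both morphisms have locally vanishing image, and by `hom_ext` the image determines a morphism.
This replaces every diagram chase for the inverse functor: it suffices that each arrow of a diagram
is killed. -/
lemma eq_of_kills {x y : K.ConeObj X} (φ ψ : x ⟶ y) [hφ : q.Kills φ] [hψ : q.Kills ψ] : φ = ψ := by
  obtain ⟨T, hT, h⟩ := hφ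
  obtain ⟨T', hT', h'⟩ := hψ
  exact hq.hom_ext (J.intersection_covering hT hT') fun Y f hf hx hy => by
    rw [h f hf.1 hx hy, h' f hf.2 hx hy]

lemma kills_map {x y : K'.ConeObj X} (φ : x ⟶ y) [hφ : IsTriv φ] : q.Kills (hq.map φ) := by
  obtain ⟨T, hT, h⟩ := hφ
  exact ⟨T, hT, fun Y f hf hx hy => (hq.map_c φ f hx hy).trans (h f hf _ _)⟩

/-- Two descent data with equal images are isomorphic. -/
lemma exists_iso (x y : K.ConeObj X) {T : Sieve X} (hT : T ∈ J X)
    (hb : ∀ ⦃Y : C⦄ (f : Y ⟶ X) (_ : T f) (hx : x.sieve f) (hy : y.sieve f),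
      (q.g.app (op Y)).hom (x.b f hx) = (q.g.app (op Y)).hom (y.b f hy))
    (ha : ∀ ⦃Y Z : C⦄ (f : Y ⟶ X) (g : Z ⟶ Y) (_ : T f) (hx : x.sieve f) (hy : y.sieve f),
      (q.f.app (op Z)).hom (x.a f g hx) = (q.f.app (op Z)).hom (y.a f g hy)) :
    ∃ e : x ≅ y, ∀ ⦃Y : C⦄ (f : Y ⟶ X) (_ : T f) (hx : x.sieve f) (hy : y.sieve f),
      (q.f.app (op Y)).hom (ConeObj.Hom.c e.hom f hx hy) = 0 := by
  obtain ⟨φ, hφ⟩ := hq.exists_hom x y hT (fun _ _ _ _ _ => 0)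
    (fun Y f hT hx hy => by rw [map_zero, add_zero, hb f hT hx hy])
    (fun Y Z f g hT hx hy => by rw [map_zero, add_zero, zero_add, ha f g hT hx hy])
  have : IsIso φ := IsGroupoid.all_isIso _
  exact ⟨asIso φ, hφ⟩

variable (X) in
/-- The functor on descent data given by the choice of preimages. -/
noncomputable def functor : K'.ConeObj X ⥤ K.ConeObj X where
  obj := hq.obj
  map := hq.map
  map_id x := hq.hom_ext (hq.obj x).mem fun Y f hT hx hy =>
    (hq.map_c (𝟙 x) f hx hy).trans (map_zero (q.f.app (op Y)).hom).symm
  map_comp {x y z} φ ψ := hq.hom_ext (hq.obj y).mem fun Y f hT hx hz => by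
    rw [f_comp_c q _ _ f hx hz hT, map_c, map_c, map_c, comp_c φ ψ f _ _ (hq.sieve_of_obj hT)]

lemma mapFunctor_faithful : (q.mapFunctor X).Faithful where
  map_injective {x y φ ψ} h := hq.hom_ext (J.top_mem X) fun Y f _ hx hy =>
    congrArg (fun θ : q.mapObj x ⟶ q.mapObj y => ConeObj.Hom.c θ f hx hy) h

lemma mapFunctor_full : (q.mapFunctor X).Full where
  map_surjective {x y} ψ := by
    obtain ⟨φ, hφ⟩ := hq.exists_hom x y (J.top_mem X) (fun Y f _ hx hy => ConeObj.Hom.c ψ f hx hy)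
      (fun Y f _ hx hy => ConeObj.Hom.d_c ψ f hx hy)
      (fun Y Z f g _ hx hy => ConeObj.Hom.nat ψ f g hx hy)
    exact ⟨φ, ConeObj.hom_ext fun Y f hx hy => hφ f trivial hx hy⟩

/-- The image of the chosen preimage. -/
noncomputable def functorCompMap : hq.functor X ⋙ q.mapFunctor X ≅ 𝟭 (K'.ConeObj X) :=
  NatIso.ofComponents (fun x => zeroIso _ _ (fun Y f hx hy => hq.obj_b hx)
    (fun Y Z f g hx hy => hq.obj_a g hx)) (fun {x y} φ =>
      ConeObj.Hom.ext_of (J.intersection_covering (hq.obj x).mem (hq.obj y).mem)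
        fun Y f hT hx hy => square_c hT.2 (hq.sieve_of_obj hT.1)
          ((add_zero _).trans ((hq.map_c φ f hT.1 hT.2).trans (zero_add _).symm)))

lemma isEquivalence_mapFunctor : (q.mapFunctor X).IsEquivalence :=
  { faithful := hq.mapFunctor_faithful
    full := hq.mapFunctor_full
    essSurj := ⟨fun x => ⟨hq.obj x, ⟨hq.functorCompMap.app x⟩⟩⟩ }

lemma isEquivalence_functor : (hq.functor X).IsEquivalence := by
  have := hq.isEquivalence_mapFunctor (X := X)
  have : (hq.functor X ⋙ q.mapFunctor X).IsEquivalence :=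
    Functor.isEquivalence_of_iso hq.functorCompMap.symm
  exact Functor.isEquivalence_of_comp_right _ (q.mapFunctor X)

theorem isEquivalence_coneMap : q.coneMap.IsEquivalence :=
  fun _ => hq.isEquivalence_mapFunctor

end IsLocalEquiv

end Hom

end TwoTerm

/-! ### The inverse of Cone(q) as a morphism of Picard stacks. -/

namespace TwoTerm

variable {C : Type u₁} [Category.{v₁} C] {J : GrothendieckTopology C}

open ConeObj

namespace Hom.IsLocalEquiv

variable {K K' : TwoTerm.{w} J} {q : Hom K K'} (hq : q.IsLocalEquiv) {X : C}

variable (X) in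
-- This isomorphism and the analogous ones for tensor products, pullbacks and images all come from
-- `exists_iso`: the images of the two sides agree on the nose, so the isomorphism can be taken with
-- zero image. The recorded vanishing feeds `eq_of_kills`.
lemma exists_unitIso : ∃ e : 𝟙_ (K.ConeObj X) ≅ hq.obj (𝟙_ (K'.ConeObj X)),
    ∀ ⦃Y : C⦄ (f : Y ⟶ X) (_ : (⊤ : Sieve X) f) (hx) (hy),
      (q.f.app (op Y)).hom (ConeObj.Hom.c e.hom f hx hy) = 0 :=
  hq.exists_iso _ _ (J.top_mem X)
    (fun _ _ _ _ hy => (map_zero _).trans (hq.obj_b hy).symm)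
    (fun _ _ _ g _ _ hy => (map_zero _).trans (hq.obj_a g hy).symm)

variable (X) in
/-- Compatibility of the choice of preimages with the unit objects. -/
noncomputable def unitIso : 𝟙_ (K.ConeObj X) ≅ hq.obj (𝟙_ (K'.ConeObj X)) :=
  (hq.exists_unitIso X).choose

lemma exists_tensorIso (x y : K'.ConeObj X) : ∃ e : hq.obj x ⊗ hq.obj y ≅ hq.obj (x ⊗ y),
    ∀ ⦃Y : C⦄ (f : Y ⟶ X) (_ : (⊤ : Sieve X) f) (hx) (hy),
      (q.f.app (op Y)).hom (ConeObj.Hom.c e.hom f hx hy) = 0 :=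
  hq.exists_iso _ _ (J.top_mem X)
    (fun _ _ _ hx hy => (map_add _ _ _).trans ((congrArg₂ (· + ·) (hq.obj_b hx.1)
      (hq.obj_b hx.2)).trans (hq.obj_b hy).symm))
    (fun _ _ _ g _ hx hy => (map_add _ _ _).trans ((congrArg₂ (· + ·) (hq.obj_a g hx.1)
      (hq.obj_a g hx.2)).trans (hq.obj_a g hy).symm))

/-- Compatibility of the choice of preimages with tensor products. -/
noncomputable def tensorIso (x y : K'.ConeObj X) : hq.obj x ⊗ hq.obj y ≅ hq.obj (x ⊗ y) :=
  (hq.exists_tensorIso x y).choose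

lemma tensorIso_c (x y : K'.ConeObj X) {Y : C} (f : Y ⟶ X) (hx) (hy) :
    (q.f.app (op Y)).hom (ConeObj.Hom.c (hq.tensorIso x y).hom f hx hy) = 0 :=
  (hq.exists_tensorIso x y).choose_spec f trivial hx hy

lemma exists_pullIso {X' : C} (k : X' ⟶ X) (x : K'.ConeObj X) :
    ∃ e : hq.obj (pull k x) ≅ pull k (hq.obj x),
    ∀ ⦃Y : C⦄ (f : Y ⟶ X') (_ : (⊤ : Sieve X') f) (hx) (hy),
      (q.f.app (op Y)).hom (ConeObj.Hom.c e.hom f hx hy) = 0 :=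
  hq.exists_iso _ _ (J.top_mem X')
    (fun _ f _ hx hy => (hq.obj_b hx).trans (hq.obj_b (f := f ≫ k) hy).symm)
    (fun _ _ f g _ hx hy => (hq.obj_a g hx).trans (hq.obj_a (f := f ≫ k) g hy).symm)

/-- Compatibility of the choice of preimages with pullback. -/
noncomputable def pullIso {X' : C} (k : X' ⟶ X) (x : K'.ConeObj X) :
    hq.obj (pull k x) ≅ pull k (hq.obj x) :=
  (hq.exists_pullIso k x).choose

lemma pullIso_c {X' : C} (k : X' ⟶ X) (x : K'.ConeObj X) {Y : C} (f : Y ⟶ X') (hx) (hy) :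
    (q.f.app (op Y)).hom (ConeObj.Hom.c (hq.pullIso k x).hom f hx hy) = 0 :=
  (hq.exists_pullIso k x).choose_spec f trivial hx hy

lemma exists_counitIso (x : K.ConeObj X) : ∃ e : hq.obj (q.mapObj x) ≅ x,
    ∀ ⦃Y : C⦄ (f : Y ⟶ X) (_ : (⊤ : Sieve X) f) (hx) (hy),
      (q.f.app (op Y)).hom (ConeObj.Hom.c e.hom f hx hy) = 0 :=
  hq.exists_iso _ _ (J.top_mem X) (fun _ _ _ hx hy => hq.obj_b hx)
    (fun _ _ _ g _ hx hy => hq.obj_a g hx)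

/-- The chosen preimage of an image. -/
noncomputable def counitIso (x : K.ConeObj X) : hq.obj (q.mapObj x) ≅ x :=
  (hq.exists_counitIso x).choose

lemma counitIso_c (x : K.ConeObj X) {Y : C} (f : Y ⟶ X) (hx) (hy) :
    (q.f.app (op Y)).hom (ConeObj.Hom.c (hq.counitIso x).hom f hx hy) = 0 :=
  (hq.exists_counitIso x).choose_spec f trivial hx hy

lemma kills_unitIso : q.Kills (hq.unitIso X).hom := ⟨_, J.top_mem X, (hq.exists_unitIso X).choose_spec⟩

lemma kills_tensorIso (x y : K'.ConeObj X) : q.Kills (hq.tensorIso x y).hom :=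
  ⟨_, J.top_mem X, (hq.exists_tensorIso x y).choose_spec⟩

lemma kills_pullIso {X' : C} (k : X' ⟶ X) (x : K'.ConeObj X) : q.Kills (hq.pullIso k x).hom :=
  ⟨_, J.top_mem X', (hq.exists_pullIso k x).choose_spec⟩

lemma kills_counitIso (x : K.ConeObj X) : q.Kills (hq.counitIso x).hom :=
  ⟨_, J.top_mem X, (hq.exists_counitIso x).choose_spec⟩

noncomputable instance monoidal : (hq.functor X).Monoidal :=
  Functor.CoreMonoidal.toMonoidal
    { εIso := hq.unitIso X
      μIso := hq.tensorIso
      μIso_hom_natural_left := fun {x y} φ z => by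
        refine hq.hom_ext (J.intersection_covering (hq.obj (x ⊗ z)).mem
          (J.intersection_covering (hq.obj y).mem (hq.obj z).mem)) fun Y h hT hx hy => ?_
        refine q.square_f_c (mem_tensor (x := hq.obj y) (y := hq.obj z) hT.2.1 hT.2.2) hT.1 ?_
        refine (congrArg₂ (· + ·) (congrArg (q.f.app (op Y)).hom
          (whiskerRight_c (hq.map φ) (hq.obj z) h hx _)) (hq.tensorIso_c y z h _ hy)).trans ?_
        refine Eq.trans ?_ (congrArg₂ (· + ·) (hq.tensorIso_c x z h hx hT.1)
          (hq.map_c (φ ▷ z) h hT.1 hy)).symm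
        rw [map_c, whiskerRight_c, add_zero, zero_add]
      μIso_hom_natural_right := fun {x y} z φ => by
        refine hq.hom_ext (J.intersection_covering (hq.obj (z ⊗ x)).mem
          (J.intersection_covering (hq.obj z).mem (hq.obj y).mem)) fun Y h hT hx hy => ?_
        refine q.square_f_c (mem_tensor (x := hq.obj z) (y := hq.obj y) hT.2.1 hT.2.2) hT.1 ?_
        refine (congrArg₂ (· + ·) (congrArg (q.f.app (op Y)).hom
          (whiskerLeft_c (hq.obj z) (hq.map φ) h hx _)) (hq.tensorIso_c z y h _ hy)).trans ?_
        refine Eq.trans ?_ (congrArg₂ (· + ·) (hq.tensorIso_c z x h hx hT.1)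
          (hq.map_c (z ◁ φ) h hT.1 hy)).symm
        rw [map_c, whiskerLeft_c, add_zero, zero_add]
      -- The coherence axioms compare composites of killed morphisms, so only the naturality
      -- conditions above, which involve an arbitrary `φ`, need components.
      associativity := fun x y z => hq.eq_of_kills _ _
          (hφ := .comp' (.whiskerRight' (hq.kills_tensorIso _ _)) (.comp' (hq.kills_tensorIso _ _) (hq.kills_map _)))
          (hψ := .comp' inferInstance (.comp' (.whiskerLeft' (hq.kills_tensorIso _ _)) (hq.kills_tensorIso _ _)))
      left_unitality := fun x => hq.eq_of_kills _ _
          (hψ := .comp' (.whiskerRight' hq.kills_unitIso) (.comp' (hq.kills_tensorIso _ _) (hq.kills_map _)))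
      right_unitality := fun x => hq.eq_of_kills _ _
          (hψ := .comp' (.whiskerLeft' hq.kills_unitIso) (.comp' (hq.kills_tensorIso _ _) (hq.kills_map _))) }

lemma kills_μ (x y : K'.ConeObj X) : q.Kills (Functor.LaxMonoidal.μ (hq.functor X) x y) :=
  hq.kills_tensorIso x y

variable (X) in
lemma kills_ε : q.Kills (Functor.LaxMonoidal.ε (hq.functor X)) := hq.kills_unitIso

noncomputable instance braided : (hq.functor X).Braided where
  braided x y := by
    have h1 := hq.kills_μ x y
    have h2 := hq.kills_μ y x
    have h3 := hq.kills_map (β_ x y).hom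
    exact hq.eq_of_kills _ _ (hφ := .comp' h1 h3) (hψ := .comp' inferInstance h2)

/-- Compatibility with pullback. -/
noncomputable def pullNatIso {X Y : C} (k : Y ⟶ X) :
    pullFunctor K' k ⋙ hq.functor Y ≅ hq.functor X ⋙ pullFunctor K k :=
  NatIso.ofComponents (hq.pullIso k) (fun {x y} φ => by
    refine hq.hom_ext (J.intersection_covering (hq.obj (pull k y)).mem (pull k (hq.obj x)).mem)
      fun Z h hT hx hy => q.square_f_c hT.1 hT.2 ?_
    refine (congrArg₂ (· + ·) (hq.map_c (pullMap k φ) h hx hT.1) (hq.pullIso_c k y h hT.1 hy)).trans ?_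
    refine Eq.trans ?_ (congrArg₂ (· + ·) (hq.pullIso_c k x h hx hT.2)
      (hq.map_c φ (h ≫ k) hT.2 hy)).symm
    exact (add_zero _).trans (zero_add _).symm)

lemma kills_pullNatIso {X Y : C} (k : Y ⟶ X) (x : K'.ConeObj X) :
    q.Kills ((hq.pullNatIso k).hom.app x) := hq.kills_pullIso k x

lemma isMonoidal_pullNatIso {X Y : C} (k : Y ⟶ X) : NatTrans.IsMonoidal (hq.pullNatIso k).hom where
  unit := hq.eq_of_kills _ _
    (hφ := .comp' (.comp' (hq.kills_ε _) (hq.kills_map _)) (hq.kills_pullNatIso k _))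
    (hψ := .comp' inferInstance (.pull' (hq.kills_ε X)))
  tensor x y := by
    have h1 := hq.kills_pullNatIso k x
    have h2 := hq.kills_pullNatIso k y
    have h3 := hq.kills_μ x y
    exact hq.eq_of_kills _ _
      (hφ := .comp' (.comp' (hq.kills_μ _ _) (hq.kills_map _)) (hq.kills_pullNatIso k _))
      (hψ := .comp' inferInstance (.comp' inferInstance (.pull _ _ _)))

open Bicategory in
/-- The underlying morphism of stacks of groupoids of the inverse of `Cone q`. -/
noncomputable def inverseTrans :
    Pseudofunctor.StrongTrans K'.conePseudofunctor K.conePseudofunctor where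
  app X := (hq.functor X.as.unop).toCatHom
  naturality {X Y} k := Cat.Hom.isoMk (hq.pullNatIso k.as.unop)
  naturality_naturality {X Y k l} η := by
    ext x
    have h1 := conePseudofunctor_map₂ η x
    have h2 := conePseudofunctor_map₂ (K := K) η (hq.obj x)
    exact hq.eq_of_kills (X := Y.as.unop) _ _
      (hφ := .comp' (φ := (hq.functor Y.as.unop).map
        ((K'.conePseudofunctor.map₂ η).toNatTrans.app x))
        (ψ := (hq.pullNatIso l.as.unop).hom.app x) (hq.kills_map _ (hφ := h1)) (hq.kills_pullNatIso _ _))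
      (hψ := .comp' (φ := (hq.pullNatIso k.as.unop).hom.app x)
        (ψ := (K.conePseudofunctor.map₂ η).toNatTrans.app (hq.obj x)) (hq.kills_pullNatIso _ _)
        (.of_isTriv q _ (hφ := h2)))
  naturality_id X := by
    ext x
    exact hq.eq_of_kills (X := X.as.unop) _ _
      (hφ := .comp' (φ := (hq.pullNatIso (𝟙 X : X ⟶ X).as.unop).hom.app x)
        (ψ := (pullId K X.as.unop).hom.app (hq.obj x)) (hq.kills_pullNatIso _ _)
        (.of_c fun _ _ _ _ => rfl))
      (hψ := .comp' (φ := (hq.functor X.as.unop).map ((pullId K' X.as.unop).hom.app x))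
        (ψ := 𝟙 _ ≫ 𝟙 _) (hq.kills_map _ (hφ := .of_c fun _ _ _ _ => rfl)) inferInstance)
  naturality_comp {X Y Z} k l := by
    ext x
    exact hq.eq_of_kills (X := Z.as.unop) _ _
      (hφ := .comp' (φ := (hq.pullNatIso (k ≫ l).as.unop).hom.app x)
        (ψ := (pullComp K k.as.unop l.as.unop).hom.app (hq.obj x)) (hq.kills_pullNatIso _ _)
        (.of_c fun _ _ _ _ => rfl))
      (hψ := .comp' (φ := (hq.functor Z.as.unop).map
          ((pullComp K' k.as.unop l.as.unop).hom.app x))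
        (ψ := 𝟙 _ ≫ (hq.pullNatIso l.as.unop).hom.app (pull k.as.unop x) ≫ 𝟙 _ ≫
          (pullFunctor K l.as.unop).map ((hq.pullNatIso k.as.unop).hom.app x) ≫ 𝟙 _)
        (hq.kills_map _ (hφ := .of_c fun _ _ _ _ => rfl)) (.comp' inferInstance
          (.comp' (hq.kills_pullNatIso _ _) (.comp' inferInstance
            (.comp' (.pull' (hq.kills_pullNatIso _ _)) inferInstance)))))

/-- An inverse of the morphism of Picard stacks `Cone q`. -/
noncomputable def inverse : PicardStack.Hom K'.cone K.cone where
  trans := hq.inverseTrans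
  braided X := hq.braided (X := X.as.unop)
  naturality_isMonoidal k := hq.isMonoidal_pullNatIso k.as.unop

variable (X) in
/-- The choice of preimages is a left inverse up to isomorphism. -/
noncomputable def mapCompFunctor : q.mapFunctor X ⋙ hq.functor X ≅ 𝟭 (K.ConeObj X) :=
  NatIso.ofComponents hq.counitIso (fun {x y} φ => by
    refine hq.hom_ext (J.intersection_covering (hq.obj (q.mapObj y)).mem x.mem)
      fun Z h hT hx hy => q.square_f_c hT.1 hT.2 ?_
    refine (congrArg₂ (· + ·) (hq.map_c (q.mapHom φ) h hx hT.1) (hq.counitIso_c y h hT.1 hy)).trans ?_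
    refine Eq.trans ?_ (congrArg₂ (· + ·) (hq.counitIso_c x h hx hT.2) rfl).symm
    exact (add_zero _).trans (zero_add _).symm)

lemma kills_mapCompFunctor (x : K.ConeObj X) : q.Kills ((hq.mapCompFunctor X).hom.app x) :=
  hq.kills_counitIso x

lemma isMonoidal_mapCompFunctor : NatTrans.IsMonoidal (hq.mapCompFunctor X).hom where
  unit := hq.eq_of_kills _ _
    (hφ := .comp' (.comp' (hq.kills_ε _) (hq.kills_map _)) (hq.kills_mapCompFunctor _))
    (hψ := .of_isTriv q (𝟙 _))
  tensor x y := by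
    have h1 := hq.kills_mapCompFunctor x
    have h2 := hq.kills_mapCompFunctor y
    exact hq.eq_of_kills _ _
      (hφ := .comp' (.comp' (hq.kills_μ _ _) (hq.kills_map _)) (hq.kills_mapCompFunctor _))
      (hψ := .comp' inferInstance (.of_isTriv q (𝟙 _)))

open scoped Pseudofunctor.StrongTrans
open Bicategory

/-- The modification from the composition of `Cone q` and its inverse to the identity. -/
noncomputable def counitModification : q.coneMap.trans ≫ hq.inverse.trans ⟶ 𝟙 K.conePseudofunctor where
  as :=
    { app := fun X => (hq.mapCompFunctor X.as.unop).hom.toCatHom₂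
      naturality := fun {X Y} k => by
        ext x
        exact hq.eq_of_kills (X := Y.as.unop) _ _
          (hφ := .comp' (φ := (hq.mapCompFunctor Y.as.unop).hom.app (pull k.as.unop x))
            (ψ := 𝟙 _ ≫ 𝟙 _) (hq.kills_mapCompFunctor _) inferInstance)
          (hψ := .comp' (φ := 𝟙 _ ≫ (hq.functor Y.as.unop).map ((q.mapPull k.as.unop).hom.app x) ≫
            𝟙 _ ≫ (hq.pullNatIso k.as.unop).hom.app (q.mapObj x) ≫ 𝟙 _)
            (ψ := (pullFunctor K k.as.unop).map ((hq.mapCompFunctor X.as.unop).hom.app x))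
            (.comp' inferInstance (.comp' (hq.kills_map _ (hφ := .of_c fun _ _ _ _ => rfl))
              (.comp' inferInstance (.comp' (hq.kills_pullNatIso _ _) inferInstance))))
            (.pull' (hq.kills_mapCompFunctor _))) }

/-- A morphism of complexes `r : K ⟶ K''` induces a morphism `K'.cone ⟶ K''.cone` whose
composition with `Cone q` is `Cone r`. -/
noncomputable def twoHom {K'' : TwoTerm.{w} J} (r : Hom K K'') :
    PicardStack.Hom.TwoHom (q.coneMap.comp (hq.inverse.comp r.coneMap)) r.coneMap where
  -- The isomorphism from Cone(q) followed by its inverse to the identity, whiskered with Cone(r).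
  mod := (Bicategory.associator q.coneMap.trans hq.inverse.trans r.coneMap.trans).inv ≫
    hq.counitModification ▷ r.coneMap.trans ≫ (Bicategory.leftUnitor r.coneMap.trans).hom
  isMonoidal X := by
    have := hq.isMonoidal_mapCompFunctor (X := X.as.unop)
    exact inferInstanceAs (NatTrans.IsMonoidal
      ((Functor.associator (q.mapFunctor X.as.unop) (hq.functor X.as.unop)
        (r.mapFunctor X.as.unop)).inv ≫
        Functor.whiskerRight (hq.mapCompFunctor X.as.unop).hom (r.mapFunctor X.as.unop) ≫
        (Functor.leftUnitor (r.mapFunctor X.as.unop)).hom))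

end Hom.IsLocalEquiv

namespace Hom

/-- The equivalence is the inverse of Cone(q) followed by Cone(r). The hypothesis on `r` enters only
through its component functors being equivalences. -/
theorem exists_isEquivalence {K K' K'' : TwoTerm.{w} J} {q : Hom K K'} {r : Hom K K''}
    (hq : q.IsLocalEquiv) (hr : r.IsLocalEquiv) :
    ∃ Φ : PicardStack.Hom K'.cone K''.cone, Φ.IsEquivalence ∧
      Nonempty (PicardStack.Hom.TwoHom (q.coneMap.comp Φ) r.coneMap) := by
  refine ⟨hq.inverse.comp r.coneMap, fun X => ?_, ⟨hq.twoHom r⟩⟩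
  have h1 := hq.isEquivalence_functor (X := X.as.unop)
  have h2 := hr.isEquivalence_mapFunctor (X := X.as.unop)
  exact inferInstanceAs (hq.functor X.as.unop ⋙ r.mapFunctor X.as.unop).IsEquivalence

end Hom

end TwoTerm

/-! ### A flatness criterion: flat after inverting p and free modulo p. -/

section FlatnessCriterion

namespace Module

variable {A M N : Type*} [CommRing A] [AddCommGroup M] [Module A M] [AddCommGroup N] [Module A N]

/-- Place the two coefficient matrices and the two families of vectors side by side. -/
lemma IsTrivialRelation.add {ι : Type*} [Fintype ι] {f : ι → A} {x y : ι → M}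
    (hx : IsTrivialRelation f x) (hy : IsTrivialRelation f y) : IsTrivialRelation f (x + y) := by
  obtain ⟨k, a, z, h1, h2⟩ := hx
  obtain ⟨k', a', z', h1', h2'⟩ := hy
  refine ⟨k + k', fun i => Fin.append (a i) (a' i), Fin.append z z', fun i => ?_, fun j => ?_⟩
  · simp [Fin.sum_univ_add, h1, h1']
  · refine Fin.addCases (fun j => ?_) (fun j => ?_) j
    · simpa using h2 j
    · simpa using h2' j

lemma IsTrivialRelation.map {ι : Type*} [Fintype ι] {f : ι → A} {x : ι → M}
    (hx : IsTrivialRelation f x) (ψ : M →ₗ[A] N) : IsTrivialRelation f (fun i => ψ (x i)) := by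
  obtain ⟨k, a, z, h1, h2⟩ := hx
  exact ⟨k, a, fun j => ψ (z j), fun i => by simp [h1], h2⟩

/-- A relation is trivial if its multiple by a nonzerodivisor `p` is, provided that `M / p M` is
free over `A / p A`. -/
lemma IsTrivialRelation.of_smul {p : A} (hA : ∀ a : A, p * a = 0 → a = 0)
    (hM : ∀ m : M, p • m = 0 → m = 0) {κ : Type*} (e : κ → M)
    (hspan : ∀ m : M, ∃ (c : κ →₀ A) (m' : M), m = Finsupp.linearCombination A e c + p • m')
    (hind : ∀ (c : κ →₀ A) (m : M), Finsupp.linearCombination A e c = p • m → ∀ k, p ∣ c k)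
    {ι : Type*} [Fintype ι] {f : ι → A} {x : ι → M} (h : IsTrivialRelation f (p • x)) :
    IsTrivialRelation f x := by
  obtain ⟨n, a, y, h1, h2⟩ := h
  choose c y' hy using fun j => hspan (y j)
  -- Substituting y_j = e(c_j) + p y'_j into p x_i = ∑ a_ij y_j shows that the combination of the
  -- `e` with coefficients ∑ a_ij c_j is divisible by p.
  have h3 : ∀ i, Finsupp.linearCombination A e (∑ j, a i j • c j) =
      p • (x i - ∑ j, a i j • y' j) := by
    intro i
    have h4 := h1 i
    rw [Pi.smul_apply, Finset.sum_congr rfl fun j _ => congrArg (a i j • ·) (hy j)] at h4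
    rw [smul_sub, h4, map_sum, Finset.smul_sum]
    simp only [smul_add, Finset.sum_add_distrib, map_smul]
    rw [eq_sub_iff_add_eq]
    congr 1
    exact Finset.sum_congr rfl fun j _ => smul_comm _ _ _
  -- Independence of `e` modulo p divides the coefficients themselves by p. The quotients are
  -- finitely supported because p is a nonzerodivisor.
  have h5 : ∀ i, ∃ d : κ →₀ A, p • d = ∑ j, a i j • c j := by
    intro i
    choose d hd using hind _ _ (h3 i)
    refine ⟨Finsupp.onFinset (∑ j, a i j • c j).support d fun k hk => ?_, ?_⟩
    · rw [Finsupp.mem_support_iff]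
      exact fun h0 => hk (hA _ ((hd k).symm.trans h0))
    · ext k
      simpa using (hd k).symm
  choose d hd using h5
  -- After multiplication by p this becomes ∑ f_i a_ij c_j, which vanishes since the relation for p
  -- x is trivial.
  have h6 : ∑ i, f i • d i = 0 := by
    ext k
    refine hA _ ?_
    have h7 : p • ∑ i, f i • d i = 0 := by
      rw [Finset.smul_sum]
      simp_rw [smul_comm p, hd, Finset.smul_sum, smul_smul]
      rw [Finset.sum_comm]
      simp_rw [← Finset.sum_smul, h2, zero_smul, Finset.sum_const_zero]
    exact DFunLike.congr_fun h7 k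
  -- The first summand is the image of a relation in a free module, hence trivial; the second is
  -- trivial with the matrix `a` already at hand.
  have h8 : x = (fun i => Finsupp.linearCombination A e (d i)) + fun i => ∑ j, a i j • y' j := by
    funext i
    have h9 : p • (x i - ∑ j, a i j • y' j - Finsupp.linearCombination A e (d i)) = 0 := by
      rw [smul_sub, ← h3, ← map_smul, hd, sub_self]
    rw [Pi.add_apply, ← sub_eq_zero.1 (hM _ h9), sub_add_cancel]
  rw [h8]
  exact ((Flat.isTrivialRelation_of_sum_smul_eq_zero h6).map _).add ⟨n, a, y', fun i => rfl, h2⟩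

/-- A module is flat if it is torsion-free with respect to a nonzerodivisor `p`, free modulo `p`,
and flat after inverting `p`. -/
theorem Flat.of_free_quotient_of_flat {p : A} (hA : ∀ a : A, p * a = 0 → a = 0)
    (hM : ∀ m : M, p • m = 0 → m = 0) {κ : Type*} (e : κ → M)
    (hspan : ∀ m : M, ∃ (c : κ →₀ A) (m' : M), m = Finsupp.linearCombination A e c + p • m')
    (hind : ∀ (c : κ →₀ A) (m : M), Finsupp.linearCombination A e c = p • m → ∀ k, p ∣ c k)
    [Flat A N] (ψ : N →ₗ[A] M) (hψ : Function.Injective ψ)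
    (hψ' : ∀ m : M, ∃ (n : ℕ) (y : N), ψ y = p ^ n • m) : Flat A M := by
  refine Flat.of_forall_isTrivialRelation fun {l f x} hx => ?_
  choose n y hy using hψ'
  -- The sum of all exponents clears every denominator at once, so the multiplied relation comes
  -- from the flat module `N`, where it is trivial. The powers of p are then removed one at a time
  -- by `of_smul`.
  have h1 : ∑ i, f i • (p ^ (∑ j, n (x j) - n (x i)) • y (x i)) = 0 := by
    refine hψ ?_
    rw [map_sum, map_zero, ← smul_zero (p ^ ∑ j, n (x j)), ← hx, Finset.smul_sum]
    refine Finset.sum_congr rfl fun i _ => ?_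
    rw [map_smul, map_smul, hy, smul_smul (p ^ _), ← pow_add,
      Nat.sub_add_cancel (Finset.single_le_sum (f := fun j => n (x j)) (fun _ _ => Nat.zero_le _)
        (Finset.mem_univ i)), smul_comm]
  have h2 : IsTrivialRelation f (p ^ (∑ j, n (x j)) • x) := by
    have h3 := (Flat.isTrivialRelation_of_sum_smul_eq_zero h1).map ψ
    convert h3 using 2 with i
    rw [map_smul, hy, smul_smul (p ^ _), ← pow_add,
      Nat.sub_add_cancel (Finset.single_le_sum (f := fun j => n (x j)) (fun _ _ => Nat.zero_le _)
        (Finset.mem_univ i)), Pi.smul_apply]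
  generalize ∑ j, n (x j) = m at h2
  induction m with
  | zero => simpa using h2
  | succ m ih =>
    refine ih (IsTrivialRelation.of_smul hA hM e hspan hind ?_)
    rwa [smul_smul, ← pow_succ']

end Module

end FlatnessCriterion

/-! ### Ghost components and the Frobenius. -/

namespace WittVector

variable (p : ℕ) [hp : Fact p.Prime]

section

variable {p} {T : Type*} [CommRing T]

/-- Over a ring without `p`-torsion, Witt vectors are determined by their ghost components. -/
lemma eq_of_ghostComponent_eq (hT : ∀ t : T, (p : T) * t = 0 → t = 0) {a b : WittVector p T}
    (h : ∀ n, ghostComponent n a = ghostComponent n b) : a = b := by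
  have hpow : ∀ n (t : T), (p : T) ^ n * t = 0 → t = 0 := by
    intro n
    induction n with
    | zero => intro t ht; simpa using ht
    | succ n ih => intro t ht; exact ih t (hT _ (by rw [← mul_assoc, ← pow_succ', ht]))
  ext n
  induction n using Nat.strong_induction_on with
  | _ n ih =>
    have h1 := h n
    rw [ghostComponent_apply, ghostComponent_apply, aeval_wittPolynomial, aeval_wittPolynomial,
      Finset.sum_range_succ, Finset.sum_range_succ, Finset.sum_congr rfl fun i hi => by
        rw [ih i (Finset.mem_range.1 hi)]] at h1
    have h2 := add_left_cancel h1
    -- Once the earlier coordinates agree, only the last term p^n a_n of the ghost component is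
    -- left.
    rw [Nat.sub_self, pow_zero, pow_one, pow_one] at h2
    exact sub_eq_zero.1 (hpow n _ (by rw [mul_sub, h2, sub_self]))

lemma ghostComponent_zero_apply (a : WittVector p T) : ghostComponent 0 a = a.coeff 0 := by
  rw [ghostComponent_apply, aeval_wittPolynomial]
  simp

/-- The Frobenius shifts ghost components by one, and the zeroth ghost component is the zeroth
coordinate; together they give all ghost components. -/
lemma eq_of_frobenius_eq (hT : ∀ t : T, (p : T) * t = 0 → t = 0) {a b : WittVector p T}
    (h : frobenius a = frobenius b) (h0 : a.coeff 0 = b.coeff 0) : a = b := by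
  refine eq_of_ghostComponent_eq hT fun n => ?_
  cases n with
  | zero => rw [ghostComponent_zero_apply, ghostComponent_zero_apply, h0]
  | succ n => rw [← ghostComponent_frobenius, h, ghostComponent_frobenius]

/-- The Frobenius is surjective over rings in which `p` is invertible. -/
lemma exists_frobenius_eq_of_isUnit (hT : IsUnit (p : T)) (w : WittVector p T) (t : T) :
    ∃ v : WittVector p T, frobenius v = w ∧ v.coeff 0 = t := by
  obtain ⟨_⟩ := hT.nonempty_invertible
  have hb := ghostMap.bijective_of_invertible p T
  -- When p is invertible the ghost components can be prescribed freely: `t` in degree zero, and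
  -- those of `w` shifted by one.
  obtain ⟨v, hv⟩ := hb.2 (fun n => Nat.casesOn n t fun n => ghostComponent n w)
  have hv' := fun n => (ghostMap_apply v n).symm.trans (congrFun hv n)
  refine ⟨v, hb.1 (funext fun n => ?_), ?_⟩
  · rw [ghostMap_apply, ghostMap_apply, ghostComponent_frobenius, hv']
  · exact (ghostComponent_zero_apply v).symm.trans (hv' 0)

end

end WittVector

/-! ### Flatness of the Frobenius on the coordinate ring of W. -/

namespace WittVector

variable (p : ℕ) [hp : Fact p.Prime]

open MvPolynomial

/-- The coordinate ring of the ring scheme of Witt vectors, considered as an algebra over itself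
via the Frobenius. -/
def FrobeniusAlgebra (_ : ℕ) : Type := MvPolynomial ℕ ℤ

namespace FrobeniusAlgebra

noncomputable instance : CommRing (FrobeniusAlgebra p) := inferInstanceAs (CommRing (MvPolynomial ℕ ℤ))

noncomputable instance : Algebra (MvPolynomial ℕ ℤ) (FrobeniusAlgebra p) :=
  (bind₁ (R := ℤ) (frobeniusPoly p)).toRingHom.toAlgebra

/-- The identity map, as an isomorphism of rings. -/
noncomputable def of : MvPolynomial ℕ ℤ ≃+* FrobeniusAlgebra p := RingEquiv.refl _

omit hp in
lemma algebraMap_def (a : MvPolynomial ℕ ℤ) :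
    algebraMap (MvPolynomial ℕ ℤ) (FrobeniusAlgebra p) a = of p (bind₁ (frobeniusPoly p) a) := rfl

omit hp in
lemma smul_def (a : MvPolynomial ℕ ℤ) (b : FrobeniusAlgebra p) :
    a • b = of p (bind₁ (frobeniusPoly p) a) * b := rfl

omit hp in
lemma natCast_smul (n : ℕ) (b : FrobeniusAlgebra p) :
    (n : MvPolynomial ℕ ℤ) • b = (n : FrobeniusAlgebra p) * b := by
  rw [smul_def, map_natCast, map_natCast]

instance : IsDomain (FrobeniusAlgebra p) := inferInstanceAs (IsDomain (MvPolynomial ℕ ℤ))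

instance : CharZero (FrobeniusAlgebra p) := inferInstanceAs (CharZero (MvPolynomial ℕ ℤ))

/-- The coordinates. -/
noncomputable def coord (n : ℕ) : FrobeniusAlgebra p := of p (X n)

variable {p} in
omit hp in
lemma ringHom_ext {T : Type*} [CommRing T] {f g : FrobeniusAlgebra p →+* T}
    (h : ∀ n, f (coord p n) = g (coord p n)) : f = g :=
  MvPolynomial.ringHom_ext' (RingHom.ext_int _ _) h

variable {p} in
/-- The homomorphism corresponding to a Witt vector. -/
noncomputable def lift {T : Type*} [CommRing T] (v : WittVector p T) : FrobeniusAlgebra p →+* T :=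
  (aeval (R := ℤ) v.coeff).toRingHom

variable {p} in
omit hp in
lemma lift_coord {T : Type*} [CommRing T] (v : WittVector p T) (n : ℕ) :
    lift v (coord p n) = v.coeff n := aeval_X _ _

variable {p} in
-- On points, restriction along the algebra structure is the Frobenius; ring maps out of
-- `FrobeniusAlgebra p` extending a given point `w` are therefore the Witt vectors with Frobenius
-- `w`.
lemma lift_algebraMap {T : Type*} [CommRing T] (v : WittVector p T) (a : MvPolynomial ℕ ℤ) :
    lift v (algebraMap _ _ a) = aeval (frobenius v).coeff a := by
  rw [algebraMap_def]
  refine (aeval_bind₁ _ _ _).trans ?_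
  congr 2

/-- The universal case of a Witt vector with prescribed Frobenius: the structure map sends the
variables to the Frobenius polynomials, whose values at the coordinates compute the Frobenius. -/
lemma frobenius_mk_coord : frobenius (WittVector.mk p (coord p)) =
    WittVector.mk p fun n => algebraMap (MvPolynomial ℕ ℤ) (FrobeniusAlgebra p) (X n) := by
  ext n
  rw [coeff_frobenius]
  change _ = algebraMap (MvPolynomial ℕ ℤ) (FrobeniusAlgebra p) (X n)
  rw [algebraMap_def, bind₁_X_right]
  have h : (aeval (R := ℤ) (coord p)).toRingHom = (of p).toRingHom :=
    MvPolynomial.ringHom_ext' (RingHom.ext_int _ _) fun n => by simp [coord]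
  exact DFunLike.congr_fun h _

/-- Modulo `p`, the Frobenius is given by the `p`-th powers of the coordinates. -/
lemma exists_bind₁_eq (a : MvPolynomial ℕ ℤ) :
    ∃ b : MvPolynomial ℕ ℤ, bind₁ (frobeniusPoly p) a = expand p a + (p : MvPolynomial ℕ ℤ) * b := by
  -- Over `ZMod p` the Frobenius polynomials are the p-th powers of the variables, so both
  -- homomorphisms agree on generators.
  have h : (MvPolynomial.map (Int.castRingHom (ZMod p))).comp (bind₁ (frobeniusPoly p)).toRingHom =
      (MvPolynomial.map (Int.castRingHom (ZMod p))).comp (expand (σ := ℕ) (R := ℤ) p).toRingHom := by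
    refine MvPolynomial.ringHom_ext' (RingHom.ext_int _ _) fun n => ?_
    simp [frobeniusPoly_zmod]
  have h1 := DFunLike.congr_fun h a
  have h2 : MvPolynomial.map (Int.castRingHom (ZMod p)) (bind₁ (frobeniusPoly p) a - expand p a) = 0 := by
    rw [map_sub]
    exact sub_eq_zero.2 h1
  rw [← C_dvd_iff_zmod] at h2
  obtain ⟨b, hb⟩ := h2
  refine ⟨b, ?_⟩
  rw [sub_eq_iff_eq_add.1 hb, add_comm, eq_comm]
  simp

/-- The monomials with exponents less than `p`. -/
noncomputable def basis (α : {α : ℕ →₀ ℕ // ∀ i, α i < p}) : FrobeniusAlgebra p :=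
  of p (monomial α.1 1)

/-- Euclidean division of the exponents by p: X^u = X^{pk} X^r with all r_i < p, and the scalar X^k
acts as X^{pk} modulo p. -/
lemma exists_eq_linearCombination (m : FrobeniusAlgebra p) : ∃ (c : _ →₀ MvPolynomial ℕ ℤ)
    (m' : FrobeniusAlgebra p), m = Finsupp.linearCombination _ (basis p) c +
      (p : MvPolynomial ℕ ℤ) • m' := by
  induction m using MvPolynomial.induction_on' with
  | monomial u a =>
    let k : ℕ →₀ ℕ := u.mapRange (· / p) (Nat.zero_div p)
    let r : ℕ →₀ ℕ := u.mapRange (· % p) (Nat.zero_mod p)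
    have hr : ∀ i, r i < p := fun i => Nat.mod_lt _ hp.out.pos
    have hu : p • k + r = u := by
      ext i
      exact Nat.div_add_mod (u i) p
    obtain ⟨b, hb⟩ := exists_bind₁_eq p (monomial k a)
    refine ⟨Finsupp.single ⟨r, hr⟩ (monomial k a), of p (-(b * monomial r 1)), ?_⟩
    rw [Finsupp.linearCombination_single, smul_def, natCast_smul, hb, expand_monomial, basis,
      ← map_mul, add_mul, monomial_mul, hu, mul_one, map_add, add_assoc, mul_assoc, map_mul,
      map_natCast, ← mul_add, ← map_add, add_neg_cancel, map_zero, mul_zero, add_zero]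
    rfl
  | add x y hx hy =>
    obtain ⟨c, m, h⟩ := hx
    obtain ⟨c', m', h'⟩ := hy
    refine ⟨c + c', m + m', ?_⟩
    rw [map_add, smul_add, add_add_add_comm, ← h, ← h']
    rfl

/-- All exponents occurring in `expand p a` are multiples of p, so the exponent pn + β determines β
by reduction modulo p. -/
lemma coeff_expand_mul_monomial (a : MvPolynomial ℕ ℤ) (α β : {α : ℕ →₀ ℕ // ∀ i, α i < p})
    (n : ℕ →₀ ℕ) : MvPolynomial.coeff (p • n + β.1) (expand p a * monomial α.1 1) =
      if α = β then MvPolynomial.coeff n a else 0 := by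
  rw [coeff_mul_monomial', mul_one]
  rcases eq_or_ne α β with h | h
  · rw [if_pos h, h, if_pos le_add_self, add_tsub_cancel_right,
      coeff_expand_smul _ hp.out.ne_zero]
  · rw [if_neg h]
    split_ifs with h1
    · obtain ⟨i, hi⟩ : ∃ i, α.1 i ≠ β.1 i := by
        by_contra! hc
        exact h (Subtype.ext (Finsupp.ext hc))
      have h2 : (p • n + β.1 - α.1) i + α.1 i = p * n i + β.1 i := by
        have h3 := h1 i
        simp only [Finsupp.tsub_apply, Finsupp.add_apply, Finsupp.smul_apply, smul_eq_mul] at h3 ⊢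
        omega
      have h3 : ¬ p ∣ (p • n + β.1 - α.1) i := fun hd => by
        have h4 : (p • n + β.1 - α.1) i ≡ p * n i [MOD p] :=
          (Nat.modEq_zero_iff_dvd.2 hd).trans (Nat.modEq_zero_iff_dvd.2 (dvd_mul_right _ _)).symm
        have h5 : α.1 i ≡ β.1 i [MOD p] := h4.add_left_cancel (congrArg (· % p) h2)
        exact hi (h5.eq_of_lt_of_lt (α.2 i) (β.2 i))
      exact coeff_expand_of_not_dvd a h3
    · rfl

/-- Modulo p the scalar c_α acts as `expand p` of itself. The coefficient at exponent pn + k then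
isolates the n-th coefficient of `c k`, because the reduced monomials occupy disjoint residue
classes. -/
lemma dvd_of_linearCombination_eq (c : {α : ℕ →₀ ℕ // ∀ i, α i < p} →₀ MvPolynomial ℕ ℤ)
    (m : FrobeniusAlgebra p)
    (h : Finsupp.linearCombination _ (basis p) c = (p : MvPolynomial ℕ ℤ) • m) (k) :
    (p : MvPolynomial ℕ ℤ) ∣ c k := by
  have h1 : ∀ α, ∃ b : MvPolynomial ℕ ℤ, c α • basis p α =
      of p (expand p (c α) * monomial α.1 1 + (p : MvPolynomial ℕ ℤ) * b) := by
    intro α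
    obtain ⟨b, hb⟩ := exists_bind₁_eq p (c α)
    refine ⟨b * monomial α.1 1, ?_⟩
    rw [smul_def, hb, basis, ← map_mul, add_mul, mul_assoc]
  choose b hb using h1
  have h2 : (p : MvPolynomial ℕ ℤ) * (of p).symm m =
      ∑ α ∈ c.support, (expand p (c α) * monomial α.1 1) +
        (p : MvPolynomial ℕ ℤ) * ∑ α ∈ c.support, b α := by
    rw [natCast_smul, Finsupp.linearCombination_apply, Finsupp.sum,
      Finset.sum_congr rfl fun α _ => hb α, ← map_sum] at h
    rw [Finset.mul_sum, ← Finset.sum_add_distrib]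
    refine (of p).injective (Eq.trans ?_ h.symm)
    rw [map_mul, map_natCast, RingEquiv.apply_symm_apply]
  have h3 : (C (p : ℤ) : MvPolynomial ℕ ℤ) ∣ c k := by
    rw [C_dvd_iff_dvd_coeff]
    intro n
    have h4 := congrArg (MvPolynomial.coeff (p • n + k.1)) h2
    have h5 : ∀ f : MvPolynomial ℕ ℤ, (p : MvPolynomial ℕ ℤ) * f = C (p : ℤ) * f := by simp
    rw [h5, h5, coeff_add, coeff_C_mul, coeff_C_mul, coeff_sum,
      Finset.sum_congr rfl fun α _ => coeff_expand_mul_monomial p (c α) α k n,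
      Finset.sum_ite_eq'] at h4
    split_ifs at h4 with h6
    · exact (Int.dvd_add_left (dvd_mul_right _ _)).1 (h4 ▸ dvd_mul_right _ _)
    · rw [Finsupp.notMem_support_iff.1 h6, coeff_zero]
      exact dvd_zero _
  simpa using h3

/-- Over ℚ a Witt vector can be given any Frobenius and any zeroth coordinate independently. Taking
the variables and a new indeterminate produces a map out of the algebra whose composite with this
one is the inclusion of integral into rational polynomials. -/
lemma injective_aeval_coord :
    Function.Injective (Polynomial.aeval (R := MvPolynomial ℕ ℤ) (coord p 0)) := by
  let T := Polynomial (MvPolynomial ℕ ℚ)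
  have hT : IsUnit (p : T) := by
    have h1 : IsUnit (p : ℚ) := IsUnit.mk0 _ (by exact_mod_cast hp.out.ne_zero)
    simpa using h1.map (algebraMap ℚ T)
  obtain ⟨v, hv, hv0⟩ := exists_frobenius_eq_of_isUnit hT
    (WittVector.mk p fun n => Polynomial.C (X n)) Polynomial.X
  let j : Polynomial (MvPolynomial ℕ ℤ) →+* T :=
    Polynomial.mapRingHom (MvPolynomial.map (Int.castRingHom ℚ))
  have hj : Function.Injective j :=
    Polynomial.map_injective _ (MvPolynomial.map_injective _ Int.cast_injective)
  have h : (lift v).comp (Polynomial.aeval (R := MvPolynomial ℕ ℤ) (coord p 0)).toRingHom = j := by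
    refine Polynomial.ringHom_ext' (MvPolynomial.ringHom_ext' (RingHom.ext_int _ _) fun n => ?_) ?_
    · simp [lift_algebraMap, hv, j, T]
    · simp [lift_coord, hv0, j, T]
  refine Function.Injective.of_comp (f := lift v) ?_
  have h2 : ⇑(lift v) ∘ ⇑(Polynomial.aeval (R := MvPolynomial ℕ ℤ) (coord p 0)) = ⇑j :=
    congrArg DFunLike.coe h
  rw [h2]
  exact hj

/-- The ghost components of the tautological Witt vector lie in the subalgebra generated by `coord p
0`: the zeroth is that coordinate, and the others are ghost components of the Frobenius, hence come
from the base. Each coordinate is recovered from them by inductively dividing by powers of p. -/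
lemma exists_aeval_coord_eq (m : FrobeniusAlgebra p) : ∃ (n : ℕ) (y : Polynomial (MvPolynomial ℕ ℤ)),
    Polynomial.aeval (coord p 0) y = (p : MvPolynomial ℕ ℤ) ^ n • m := by
  let ψ : Polynomial (MvPolynomial ℕ ℤ) →ₐ[MvPolynomial ℕ ℤ] FrobeniusAlgebra p :=
    Polynomial.aeval (coord p 0)
  -- The elements that enter the subalgebra after multiplication by a power of p.
  let S : Subring (FrobeniusAlgebra p) :=
    { carrier := {m | ∃ n, (p : FrobeniusAlgebra p) ^ n * m ∈ ψ.range}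
      mul_mem' := by
        rintro a b ⟨n, hn⟩ ⟨n', hn'⟩
        refine ⟨n + n', ?_⟩
        rw [pow_add, mul_mul_mul_comm]
        exact mul_mem hn hn'
      one_mem' := ⟨0, by simp⟩
      add_mem' := by
        rintro a b ⟨n, hn⟩ ⟨n', hn'⟩
        refine ⟨n + n', ?_⟩
        rw [mul_add, pow_add, mul_assoc, mul_left_comm, mul_assoc]
        exact add_mem (mul_mem (pow_mem (natCast_mem _ _) _) hn)
          (mul_mem (pow_mem (natCast_mem _ _) _) hn')
      zero_mem' := ⟨0, by simp⟩
      neg_mem' := by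
        rintro a ⟨n, hn⟩
        exact ⟨n, by rw [mul_neg]; exact neg_mem hn⟩ }
  have h1 : ∀ n, ghostComponent n (WittVector.mk p (coord p)) ∈ ψ.range := by
    intro n
    cases n with
    | zero =>
      rw [ghostComponent_zero_apply]
      exact ⟨Polynomial.X, Polynomial.aeval_X _⟩
    | succ n =>
      rw [← ghostComponent_frobenius, frobenius_mk_coord, ghostComponent_apply, aeval_wittPolynomial]
      exact sum_mem fun i _ => mul_mem (pow_mem (natCast_mem _ _) _)
        (pow_mem (ψ.range.algebraMap_mem _) _)
  have h2 : ∀ n, coord p n ∈ S := by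
    intro n
    induction n using Nat.strong_induction_on with
    | _ n ih =>
      have h3 := h1 n
      -- The n-th ghost component minus its terms in the earlier coordinates, which belong to `S` by
      -- induction.
      have h4 : (p : FrobeniusAlgebra p) ^ n * coord p n ∈ S := by
        have h5 : (p : FrobeniusAlgebra p) ^ n * coord p n =
            ghostComponent n (WittVector.mk p (coord p)) - ∑ i ∈ Finset.range n,
              (p : FrobeniusAlgebra p) ^ i * coord p i ^ p ^ (n - i) := by
          rw [ghostComponent_apply, aeval_wittPolynomial, Finset.sum_range_succ]
          simp
        rw [h5]
        refine sub_mem ⟨0, by simpa using h3⟩ (sum_mem fun i hi => ?_)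
        exact mul_mem (pow_mem (natCast_mem _ _) _) (pow_mem (ih i (Finset.mem_range.1 hi)) _)
      obtain ⟨k, hk⟩ := h4
      exact ⟨k + n, by rwa [pow_add, mul_assoc]⟩
  have h3 : m ∈ S := by
    induction m using MvPolynomial.induction_on with
    | C a => exact intCast_mem S a
    | add a b ha hb => exact add_mem ha hb
    | mul_X a n ha => exact mul_mem ha (h2 n)
  obtain ⟨n, y, hy⟩ := h3
  refine ⟨n, y, hy.trans ?_⟩
  rw [Algebra.smul_def, map_pow, map_natCast]

/-- The reduced monomials form a basis modulo p, and the polynomial ring in `coord p 0` over the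
base is the flat submodule that becomes everything after inverting p. -/
theorem flat : Module.Flat (MvPolynomial ℕ ℤ) (FrobeniusAlgebra p) := by
  have h0 : (p : MvPolynomial ℕ ℤ) ≠ 0 := by exact_mod_cast hp.out.ne_zero
  refine Module.Flat.of_free_quotient_of_flat (p := (p : MvPolynomial ℕ ℤ))
    (fun a ha => (mul_eq_zero.1 ha).resolve_left h0) (fun m hm => ?_) (basis p)
    (exists_eq_linearCombination p) (dvd_of_linearCombination_eq p)
    (Polynomial.aeval (R := MvPolynomial ℕ ℤ) (coord p 0)).toLinearMap (injective_aeval_coord p)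
    (exists_aeval_coord_eq p)
  rw [natCast_smul] at hm
  exact (mul_eq_zero.1 hm).resolve_left (by exact_mod_cast hp.out.ne_zero)

end FrobeniusAlgebra

end WittVector

/-! ### Faithful flatness of the Frobenius and the ring representing its kernel. -/

namespace WittVector

open MvPolynomial TensorProduct

variable (p : ℕ) [hp : Fact p.Prime]

/-- Over a field, every Witt vector is in the image of the Frobenius after a field extension. -/
lemma exists_field_frobenius_eq {k : Type*} [Field k] (w : WittVector p k) :
    ∃ v : WittVector p (AlgebraicClosure k),
      frobenius v = WittVector.map (algebraMap k (AlgebraicClosure k)) w := by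
  -- In characteristic p the algebraic closure is perfect and F is bijective; otherwise p is
  -- invertible and the ghost map gives a preimage, with zeroth coordinate arbitrarily 0.
  by_cases h : (p : k) = 0
  · have : CharP k p := (CharP.charP_iff_prime_eq_zero hp.out).2 h
    have : CharP (AlgebraicClosure k) p :=
      charP_of_injective_algebraMap (algebraMap k (AlgebraicClosure k)).injective p
    exact (frobenius_bijective p (AlgebraicClosure k)).2 _
  · have h1 : IsUnit (p : AlgebraicClosure k) := by
      simpa using (IsUnit.mk0 _ h).map (algebraMap k (AlgebraicClosure k))
    obtain ⟨v, hv, -⟩ := exists_frobenius_eq_of_isUnit h1 (WittVector.map (algebraMap k _) w) 0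
    exact ⟨v, hv⟩

namespace FrobeniusAlgebra

/-- It remains to see that the fibre over a maximal ideal is nonzero. A Frobenius preimage, over the
algebraic closure of the residue field, of the reduced tautological Witt vector is a point of this
fibre; the extended ideal lies in the kernel of the corresponding homomorphism to a field. -/
theorem faithfullyFlat : Module.FaithfullyFlat (MvPolynomial ℕ ℤ) (FrobeniusAlgebra p) :=
  { flat p with
    submodule_ne_top := fun m hm h => by
      let _ := Ideal.Quotient.field m
      obtain ⟨v, hv⟩ := exists_field_frobenius_eq p
        (WittVector.mk p fun n => Ideal.Quotient.mk m (X n))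
      have h1 : (lift v).comp (algebraMap (MvPolynomial ℕ ℤ) (FrobeniusAlgebra p)) =
          (algebraMap (MvPolynomial ℕ ℤ ⧸ m) _).comp (Ideal.Quotient.mk m) :=
        MvPolynomial.ringHom_ext' (RingHom.ext_int _ _) fun n => by
          rw [RingHom.comp_apply, lift_algebraMap, hv, aeval_X]
          rfl
      rw [Ideal.smul_top_eq_map] at h
      have h2 : (1 : FrobeniusAlgebra p) ∈ m.map (algebraMap (MvPolynomial ℕ ℤ) _) := by
        have : (1 : FrobeniusAlgebra p) ∈ (⊤ : Submodule (MvPolynomial ℕ ℤ) (FrobeniusAlgebra p)) :=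
          Submodule.mem_top
        rw [← h] at this
        exact this
      have h3 : m.map (algebraMap (MvPolynomial ℕ ℤ) (FrobeniusAlgebra p)) ≤ RingHom.ker (lift v) := by
        refine Ideal.map_le_iff_le_comap.2 fun a ha => ?_
        have h4 := DFunLike.congr_fun h1 a
        rw [Ideal.mem_comap, RingHom.mem_ker]
        refine h4.trans ?_
        rw [RingHom.comp_apply, Ideal.Quotient.eq_zero_iff_mem.2 ha, map_zero]
      exact one_ne_zero ((map_one (lift v)).symm.trans (h3 h2)) }

end FrobeniusAlgebra

universe u'

/-- The base change of a faithfully flat algebra, characterized by its universal property. -/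
lemma _root_.Module.FaithfullyFlat.exists_pushout {A B : Type} {R : Type u} [CommRing A]
    [CommRing B] [CommRing R] [Algebra A B] [Module.FaithfullyFlat A B] (φ : A →+* R) :
    ∃ (R' : Type u) (_ : CommRing R') (_ : Algebra R R') (i : B →+* R'),
      Module.FaithfullyFlat R R' ∧ (∀ a, i (algebraMap A B a) = algebraMap R R' (φ a)) ∧
      (∀ {S : Type u'} [CommRing S] (f : R →+* S) (l : B →+* S),
        (∀ a, l (algebraMap A B a) = f (φ a)) →
        ∃ g : R' →+* S, g.comp (algebraMap R R') = f ∧ g.comp i = l) ∧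
      ∀ {S : Type u'} [CommRing S] (g g' : R' →+* S),
        g.comp (algebraMap R R') = g'.comp (algebraMap R R') → g.comp i = g'.comp i → g = g' := by
  let _ : Algebra A R := φ.toAlgebra
  refine ⟨R ⊗[A] B, inferInstance, inferInstance,
    (Algebra.TensorProduct.includeRight : B →ₐ[A] R ⊗[A] B).toRingHom, inferInstance,
    fun a => ?_, fun {S} _ f l h => ?_, fun g g' h h' => Algebra.TensorProduct.ringHom_ext h h'⟩
  · exact ((Algebra.TensorProduct.includeRight : B →ₐ[A] R ⊗[A] B).commutes a).trans
      (IsScalarTower.algebraMap_apply A R _ a)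
  · let _ : Algebra R S := f.toAlgebra
    let _ : Algebra A S := (f.comp φ).toAlgebra
    have : IsScalarTower A R S := .of_algebraMap_eq fun _ => rfl
    let l' : B →ₐ[A] S := { l with commutes' := h }
    let g : R ⊗[A] B →ₐ[R] S :=
      Algebra.TensorProduct.lift (Algebra.ofId R S) l' fun _ _ => Commute.all _ _
    refine ⟨g.toRingHom, RingHom.ext fun r => g.commutes r, RingHom.ext fun b => ?_⟩
    refine (Algebra.TensorProduct.lift_tmul (Algebra.ofId R S) l' (fun _ _ => Commute.all _ _)
      1 b).trans ?_
    rw [map_one, one_mul]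
    rfl

lemma frobenius_map {R : Type*} {S : Type*} [CommRing R] [CommRing S] (f : R →+* S)
    (w : WittVector p R) : frobenius (WittVector.map f w) = WittVector.map f (frobenius w) := by
  ext n
  rw [coeff_frobenius, map_coeff, coeff_frobenius]
  exact (map_aeval _ f _).trans (eval₂Hom_congr (RingHom.ext_int _ _) rfl rfl) |>.symm

/-- For every Witt vector `w` there is a universal ring over which `w` is in the image of the
Frobenius, and this ring is faithfully flat. -/
theorem exists_faithfullyFlat_frobenius_eq {R : Type u} [CommRing R] (w : WittVector p R) :
    ∃ (R' : Type u) (_ : CommRing R') (_ : Algebra R R') (v : WittVector p R'),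
      Module.FaithfullyFlat R R' ∧ frobenius v = WittVector.map (algebraMap R R') w ∧
      (∀ {S : Type u'} [CommRing S] (f : R →+* S) (z : WittVector p S),
        frobenius z = WittVector.map f w →
        ∃ g : R' →+* S, g.comp (algebraMap R R') = f ∧ WittVector.map g v = z) ∧
      ∀ {S : Type u'} [CommRing S] (g g' : R' →+* S),
        g.comp (algebraMap R R') = g'.comp (algebraMap R R') →
        WittVector.map g v = WittVector.map g' v → g = g' := by
  have := FrobeniusAlgebra.faithfullyFlat p
  -- The base change of the universal Frobenius along the homomorphism classifying `w`.
  obtain ⟨R', _, _, i, h1, h2, h3, h4⟩ := Module.FaithfullyFlat.exists_pushout.{u, u'}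
    (B := FrobeniusAlgebra p) (aeval (R := ℤ) w.coeff).toRingHom
  refine ⟨R', inferInstance, inferInstance,
    WittVector.map i (WittVector.mk p (FrobeniusAlgebra.coord p)), h1, ?_, ?_, ?_⟩
  · rw [frobenius_map, FrobeniusAlgebra.frobenius_mk_coord]
    ext n
    refine (h2 (X n)).trans (congrArg (algebraMap R R') (aeval_X _ _))
  · intro S _ f z hz
    obtain ⟨g, hg, hg'⟩ := h3 f (FrobeniusAlgebra.lift z) fun a => by
      rw [FrobeniusAlgebra.lift_algebraMap, hz]
      exact ((map_aeval _ f _).trans (eval₂Hom_congr (RingHom.ext_int _ _) rfl rfl)).symm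
    refine ⟨g, hg, ?_⟩
    ext n
    exact (DFunLike.congr_fun hg' (FrobeniusAlgebra.coord p n)).trans
      (FrobeniusAlgebra.lift_coord z n)
  · intro S _ g g' h h'
    exact h4 g g' h (FrobeniusAlgebra.ringHom_ext fun n =>
      congrArg (fun x => WittVector.coeff x n) h')

lemma isAddTorsionFree_of_flat (R D : Type*) [CommRing R] [IsDomain R] [CharZero R] [CommRing D]
    [Algebra R D] [Module.Flat R D] : IsAddTorsionFree D where
  nsmul_right_injective n hn a b h := by
    have h1 : (n : R) ≠ 0 := by exact_mod_cast hn
    refine smul_right_injective D h1 ?_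
    simpa [Nat.cast_smul_eq_nsmul] using h

/-- The ring representing the kernel of the Frobenius is torsion-free. -/
theorem exists_frobenius_kernel_ring : ∃ (D : Type u) (_ : CommRing D) (v : WittVector p D),
    IsAddTorsionFree D ∧ frobenius v = 0 ∧
      (∀ {S : Type u'} [CommRing S] (z : WittVector p S), frobenius z = 0 →
        ∃ g : D →+* S, WittVector.map g v = z) ∧
      ∀ {S : Type u'} [CommRing S] (g g' : D →+* S),
        WittVector.map g v = WittVector.map g' v → g = g' := by
  -- The kernel is the fibre of F over the zero vector, taken over ℤ; flatness over ℤ then gives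
  -- torsion-freeness.
  obtain ⟨D, _, _, v, h1, h2, h3, h4⟩ :=
    exists_faithfullyFlat_frobenius_eq.{u, u'} p (0 : WittVector p (ULift.{u} ℤ))
  refine ⟨D, inferInstance, v, ?_, by rw [h2, map_zero], fun {S} _ z hz => ?_,
    fun {S} _ g g' h => h4 g g' (RingHom.ext fun x => ?_) h⟩
  · have : CharZero (ULift.{u} ℤ) := ⟨fun a b h => by
      have h5 := congrArg ULift.down h
      simpa using h5⟩
    have : IsDomain (ULift.{u} ℤ) := ULift.ringEquiv.toMulEquiv.isDomain ℤ
    have := h1.toFlat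
    exact isAddTorsionFree_of_flat (ULift.{u} ℤ) D
  · obtain ⟨g, -, hg⟩ := h3 ((Int.castRingHom S).comp ULift.ringEquiv.toRingHom) z
      (by rw [hz, map_zero])
    exact ⟨g, hg⟩
  · have : (g.comp (algebraMap (ULift.{u} ℤ) D)).comp ULift.ringEquiv.symm.toRingHom =
      (g'.comp (algebraMap (ULift.{u} ℤ) D)).comp ULift.ringEquiv.symm.toRingHom :=
      RingHom.ext_int _ _
    exact DFunLike.congr_fun this x.down

end WittVector

/-! ### The coordinate ring of 𝔾ₐ^♯ represents the kernel of F. -/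

namespace Sharp

open Polynomial TensorProduct

variable (p : ℕ) [hp : Fact p.Prime]

/-- The inclusion of the coordinate ring of `𝔾ₐ^♯` in `ℚ[x]`. -/
noncomputable def val : Coord p →+* ℚ[X] := (coordSubalgebra p).val.toRingHom

omit hp in
lemma val_injective : Function.Injective (val p) := Subtype.val_injective

instance : IsAddTorsionFree (Coord p) := isAddTorsionFree_of_flat _

variable {p}

lemma counitHom_gen_eq_zero (n : ℕ) : counitHom p (gen p n) = 0 :=
  (exists_counit hp.out).choose_spec n

/-- Elements of the augmentation ideal have iterated divided powers, t^p = p v₁, v₁^p = p v₂, …,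
because on generators the p-th power vanishes modulo p. Iterating gives more factors of p than the k
that are needed; the cofactor stays in the augmentation ideal so that the construction of the Witt
vector can continue. -/
lemma exists_pow_eq {t : Coord p} (ht : counitHom p t = 0) (k : ℕ) :
    ∃ c : Coord p, counitHom p c = 0 ∧ t ^ p ^ k = (p : Coord p) ^ k * c := by
  obtain ⟨v, h0, hv⟩ := exists_seq hp.out (counitHom p).toRingHom
    (fun f g hf hg => ringHom_ext fun n => by
      rw [hf, hg, gen_pow hp.out]
      refine (Ideal.Quotient.eq_zero_iff_mem.2 ?_).trans ?_
      · exact Ideal.mul_mem_right _ _ (Ideal.mem_span_singleton_self _)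
      · refine Eq.trans ?_ (congrArg (Int.castRingHom _) (counitHom_gen_eq_zero n)).symm
        exact (map_zero _).symm) t ht
  have h1 : ∀ n, counitHom p (v n) = 0 := by
    intro n
    induction n with
    | zero => rw [h0, ht]
    | succ n ih =>
      have h2 := congrArg (counitHom p) (hv n)
      rw [map_pow, ih, zero_pow hp.out.ne_zero, map_mul, map_natCast] at h2
      exact (mul_eq_zero.1 h2.symm).resolve_left (by exact_mod_cast hp.out.ne_zero)
  have h2 : ∀ k, ∃ c : Coord p, t ^ p ^ k = (p : Coord p) ^ k * (c * v k) := by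
    intro k
    induction k with
    | zero => exact ⟨1, by simp [h0]⟩
    | succ k ih =>
      obtain ⟨c, hc⟩ := ih
      -- The p-th power of p^k c v_k is p^{kp} c^p · p v_{k+1}; of the kp + 1 factors of p, k + 1
      -- are kept in front.
      refine ⟨(p : Coord p) ^ (k * (p - 1)) * c ^ p, ?_⟩
      have h3 : k * p = k * (p - 1) + k := by
        rw [← Nat.mul_succ, Nat.succ_eq_add_one, Nat.sub_add_cancel hp.out.one_le]
      rw [pow_succ, pow_mul, hc, mul_pow, mul_pow, hv, ← pow_mul, h3, pow_add, pow_succ]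
      ring
  obtain ⟨c, hc⟩ := h2 k
  exact ⟨c * v k, by rw [map_mul, h1, mul_zero], hc⟩

variable (p)

/-- The Witt vector over the coordinate ring of `𝔾ₐ^♯` defining the homomorphism to `W`. -/
lemma exists_wittVector : ∃ ω : WittVector p (Coord p),
    WittVector.frobenius ω = 0 ∧ ω.coeff 0 = gen p 0 := by
  have hu : IsUnit (p : ℚ[X]) := by
    simpa using (IsUnit.mk0 (p : ℚ) (by exact_mod_cast hp.out.ne_zero)).map (algebraMap ℚ ℚ[X])
  -- The Witt vector over ℚ[x] with ghost components (x, 0, 0, …). What has to be shown is that its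
  -- coordinates are integral; the induction also carries the vanishing of the counit.
  obtain ⟨v, hv, hv0⟩ := WittVector.exists_frobenius_eq_of_isUnit hu (0 : WittVector p ℚ[X]) X
  have key : ∀ n, ∃ t : Coord p, val p t = v.coeff n ∧ counitHom p t = 0 := by
    intro n
    induction n using Nat.strong_induction_on with
    | _ n ih =>
      cases n with
      | zero => exact ⟨gen p 0, uPoly_zero.trans hv0.symm, counitHom_gen p⟩
      | succ n =>
        choose! t ht ht' using ih
        have h1 : ∀ i, i < n + 1 → ∃ c : Coord p, counitHom p c = 0 ∧
            t i ^ p ^ (n + 1 - i) = (p : Coord p) ^ (n + 1 - i) * c :=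
          fun i hi => exists_pow_eq (ht' i hi) _
        choose! c hc hc' using h1
        refine ⟨-∑ i ∈ Finset.range (n + 1), c i, ?_, ?_⟩
        -- Vanishing of this ghost component expresses p^{n+1} times the new coordinate as minus a
        -- sum of terms p^i v_i^{p^{n+1-i}}, each divisible by p^{n+1} thanks to the divided powers
        -- of the earlier coordinates.
        · have h2 : WittVector.ghostComponent (n + 1) v = 0 := by
            rw [← WittVector.ghostComponent_frobenius, hv, map_zero]
          rw [WittVector.ghostComponent_apply, aeval_wittPolynomial, Finset.sum_range_succ,
            Nat.sub_self, pow_zero, pow_one] at h2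
          have h3 : ∀ i ∈ Finset.range (n + 1), (p : ℚ[X]) ^ i * v.coeff i ^ p ^ (n + 1 - i) =
              (p : ℚ[X]) ^ (n + 1) * val p (c i) := by
            intro i hi
            have hi' := Finset.mem_range.1 hi
            rw [← ht i hi', ← map_pow, hc' i hi', map_mul, map_pow, map_natCast, ← mul_assoc,
              ← pow_add, Nat.add_sub_cancel' hi'.le]
          rw [Finset.sum_congr rfl h3, ← Finset.mul_sum, ← mul_add] at h2
          have h4 := ((hu.pow (n + 1)).mul_right_eq_zero).1 h2
          rw [map_neg, map_sum]
          exact neg_eq_of_add_eq_zero_right h4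
        · rw [map_neg, map_sum, Finset.sum_eq_zero fun i hi => hc i (Finset.mem_range.1 hi), neg_zero]
  choose t ht _ using key
  refine ⟨WittVector.mk p t, ?_, ?_⟩
  · refine WittVector.map_injective (val p) (val_injective p) ?_
    have h1 : WittVector.map (val p) (WittVector.mk p t) = v := WittVector.ext ht
    rw [← WittVector.frobenius_map, h1, hv, map_zero]
  · exact val_injective p ((ht 0).trans (hv0.trans uPoly_zero.symm))

/-- The Witt vector over the coordinate ring of `𝔾ₐ^♯` defining the homomorphism to `W`. -/
noncomputable def wittVector : WittVector p (Coord p) := (exists_wittVector p).choose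

lemma frobenius_wittVector : WittVector.frobenius (wittVector p) = 0 :=
  (exists_wittVector p).choose_spec.1

lemma wittVector_coeff_zero : (wittVector p).coeff 0 = gen p 0 :=
  (exists_wittVector p).choose_spec.2

/-- The coordinate ring of `𝔾ₐ^♯` represents the kernel of the Frobenius. -/
theorem exists_map_wittVector_eq_and_injective :
    (∀ {S : Type u} [CommRing S] (z : WittVector p S), WittVector.frobenius z = 0 →
      ∃ φ : Coord p →+* S, WittVector.map φ (wittVector p) = z) ∧
    ∀ {S : Type u} [CommRing S] (φ φ' : Coord p →+* S),
      WittVector.map φ (wittVector p) = WittVector.map φ' (wittVector p) → φ = φ' := by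
  obtain ⟨D, _, v, h1, h2, h3, h4⟩ := WittVector.exists_frobenius_kernel_ring.{0, u} p
  -- The universal property is given for rings in universe `u`; rings in `Type`, such as `Coord p`,
  -- ℤ and quotients of `D`, are reached through `ULift`.
  have h3' : ∀ {S : Type} [CommRing S] (z : WittVector p S), WittVector.frobenius z = 0 →
      ∃ φ : D →+* S, WittVector.map φ v = z := by
    intro S _ z hz
    obtain ⟨φ, hφ⟩ := h3 (WittVector.map (ULift.ringEquiv.{0, u} (R := S)).symm.toRingHom z)
      (by rw [WittVector.frobenius_map, hz, map_zero])
    refine ⟨ULift.ringEquiv.toRingHom.comp φ, ?_⟩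
    ext n
    exact congrArg ULift.down (congrArg (fun x => WittVector.coeff x n) hφ)
  have h4' : ∀ {S : Type} [CommRing S] (φ φ' : D →+* S),
      WittVector.map φ v = WittVector.map φ' v → φ = φ' := by
    intro S _ φ φ' h
    have h5 := h4 ((ULift.ringEquiv.{0, u} (R := S)).symm.toRingHom.comp φ)
      ((ULift.ringEquiv.{0, u} (R := S)).symm.toRingHom.comp φ')
      (WittVector.ext fun n => congrArg ULift.up (congrArg (fun x => WittVector.coeff x n) h))
    exact RingHom.ext fun x => congrArg ULift.down (DFunLike.congr_fun h5 x)
  obtain ⟨ε, hε⟩ := h3' (0 : WittVector p ℤ) (map_zero _)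
  have hε' : ∀ n, ε (v.coeff n) = 0 := fun n => 
    (congrArg (fun x => WittVector.coeff x n) hε).trans (WittVector.zero_coeff p ℤ n)
  -- The p-th power map of D modulo p factors through ε: by universality this is tested on the
  -- coordinates of `v`, and F(v) = 0 says that their p-th powers vanish modulo p. Thus the zeroth
  -- coordinate has divided powers in D.
  obtain ⟨s, hs0, hs⟩ := exists_seq hp.out ε (fun f g hf hg => h4' f g (by
    ext n
    rw [WittVector.map_coeff, WittVector.map_coeff, hf, hg, hε', map_zero,
      Ideal.Quotient.eq_zero_iff_mem, Ideal.mem_span_singleton]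
    have h5 : (WittVector.frobenius v).coeff n = 0 := by rw [h2, WittVector.zero_coeff]
    rw [WittVector.coeff_frobenius, WittVector.frobeniusPoly, map_add, map_pow, map_mul,
      MvPolynomial.aeval_X, MvPolynomial.aeval_C] at h5
    refine ⟨-MvPolynomial.aeval v.coeff (WittVector.frobeniusPolyAux p n), ?_⟩
    rw [mul_neg, eq_neg_iff_add_eq_zero, ← h5]
    simp)) (v.coeff 0) (hε' 0)
  obtain ⟨τ, hτ⟩ := exists_lift hp.out s hs
  have hτ0 : τ (gen p 0) = v.coeff 0 := (hτ 0).trans hs0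
  -- Both vectors are killed by F and have the same zeroth coordinate, which suffices since D is
  -- torsion-free.
  have hτv : WittVector.map τ (wittVector p) = v := by
    refine WittVector.eq_of_frobenius_eq (fun t ht => cancel hp.out (by rw [ht, mul_zero])) ?_ ?_
    · rw [WittVector.frobenius_map, frobenius_wittVector, h2, map_zero]
    · rw [WittVector.map_coeff, wittVector_coeff_zero, hτ0]
  obtain ⟨β, hβ⟩ := h3' (wittVector p) (frobenius_wittVector p)
  -- A homomorphism from `Coord p` to a torsion-free ring is determined by the image of x. This
  -- one-sided identity is enough: existence below composes with τ, and uniqueness cancels β by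
  -- composing with τ.
  have hβτ : β.comp τ = RingHom.id _ := ringHom_ext_zero hp.out (by
    rw [RingHom.comp_apply, hτ0, ← WittVector.map_coeff, hβ, wittVector_coeff_zero]
    rfl)
  constructor
  · intro S _ z hz
    obtain ⟨g, hg⟩ := h3 z hz
    refine ⟨g.comp τ, ?_⟩
    rw [← hg, ← hτv]
    rfl
  · intro S _ φ φ' h
    have h5 : φ.comp β = φ'.comp β := h4 _ _ (by
      rw [← hβ] at h
      exact h)
    have h6 := congrArg (fun ψ => ψ.comp τ) h5
    simpa only [RingHom.comp_assoc, hβτ, RingHom.comp_id] using h6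

lemma map_counit_wittVector :
    WittVector.map (Bialgebra.counitAlgHom ℤ (Coord p)).toRingHom (wittVector p) = 0 := by
  refine WittVector.eq_of_frobenius_eq (fun t ht => ?_) ?_ ?_
  · exact (mul_eq_zero.1 ht).resolve_left (by exact_mod_cast hp.out.ne_zero)
  · rw [WittVector.frobenius_map, frobenius_wittVector, map_zero, map_zero]
  · rw [WittVector.map_coeff, wittVector_coeff_zero, WittVector.zero_coeff]
    exact counitHom_gen p

/-- Additivity at the universal pair of points. The tensor square is flat over ℤ, hence
torsion-free, so it suffices that F kills both sides and that the zeroth coordinates agree. -/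
lemma map_comul_wittVector :
    WittVector.map (Bialgebra.comulAlgHom ℤ (Coord p)).toRingHom (wittVector p) =
      WittVector.map (Algebra.TensorProduct.includeLeftRingHom :
        Coord p →+* Coord p ⊗[ℤ] Coord p) (wittVector p) +
      WittVector.map (Algebra.TensorProduct.includeRight :
        Coord p →ₐ[ℤ] Coord p ⊗[ℤ] Coord p).toRingHom (wittVector p) := by
  have := @isAddTorsionFree_of_flat (Coord p ⊗[ℤ] Coord p) _ Algebra.toModule (flat₂ ℤ _ _)
  refine WittVector.eq_of_frobenius_eq (fun t ht => cancel hp.out (by rw [ht, mul_zero])) ?_ ?_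
  · simp only [map_add, WittVector.frobenius_map, frobenius_wittVector, map_zero, add_zero]
  · rw [WittVector.add_coeff_zero]
    simp only [WittVector.map_coeff, wittVector_coeff_zero]
    exact comulHom_gen p

end Sharp

/-! ### The identification of 𝔾ₐ^♯ with ker F on points. -/

namespace sharpPoints

variable (p : ℕ) [hp : Fact p.Prime] {R S : Type u} [CommRing R] [CommRing S]

/-- The homomorphism `𝔾ₐ^♯(R) → W(R)`. -/
noncomputable def toWitt : sharpPoints p R →+ WittVector p R where
  toFun x := WittVector.map (hom x).toRingHom (Sharp.wittVector p)
  map_zero' := by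
    have h := congrArg (WittVector.map (algebraMap ℤ R)) (Sharp.map_counit_wittVector p)
    rw [map_zero] at h
    exact h
  map_add' x y := by
    have h := congrArg (WittVector.map ((Algebra.TensorProduct.lmul' ℤ).comp
      (Algebra.TensorProduct.map (hom x) (hom y))).toRingHom) (Sharp.map_comul_wittVector p)
    rw [map_add] at h
    refine Eq.trans h (congrArg₂ (· + ·) ?_ ?_)
    · ext n
      exact (congrArg (hom x _ * ·) (map_one (hom y))).trans (mul_one _)
    · ext n
      exact (congrArg (· * hom y _) (map_one (hom x))).trans (one_mul _)

lemma frobenius_toWitt (x : sharpPoints p R) : WittVector.frobenius (toWitt p x) = 0 := by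
  refine (WittVector.frobenius_map p _ _).trans ?_
  rw [Sharp.frobenius_wittVector, map_zero]

lemma toWitt_coeff_zero (x : sharpPoints p R) : (toWitt p x).coeff 0 = toGa x := by
  exact congrArg (hom x) (Sharp.wittVector_coeff_zero p)

lemma map_toWitt (f : R →+* S) (x : sharpPoints p R) :
    toWitt p (map f x) = WittVector.map f (toWitt p x) := rfl

lemma toWitt_injective : Function.Injective (toWitt p (R := R)) := fun x y h => by
  have h1 := (Sharp.exists_map_wittVector_eq_and_injective p).2 _ _ h
  exact hom_injective (AlgHom.ext fun a => DFunLike.congr_fun h1 a)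

lemma exists_toWitt_eq (z : WittVector p R) (hz : WittVector.frobenius z = 0) :
    ∃ x, toWitt p x = z := by
  obtain ⟨φ, hφ⟩ := (Sharp.exists_map_wittVector_eq_and_injective p).1 z hz
  exact ⟨of (Sharp.toAlgHom φ), hφ⟩

end sharpPoints

/-! ### The fpqc covering, uniqueness of σ, and the two quasi-isomorphisms. -/

section Geometry

variable {p : ℕ} [hp : Fact p.Prime]

/-- The adjunction between Spec and global sections; it reduces statements about sections over any
scheme to a universal point over an affine one. -/
lemma exists_map_op_eq {Y : Scheme.{u}} {R : CommRingCat.{u}} (φ : R ⟶ Scheme.Γ.obj (op Y)) :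
    ∃ g : Y ⟶ Spec R, Scheme.Γ.map g.op = (Scheme.ΓSpecIso R).hom ≫ φ := by
  refine ⟨Y.toSpecΓ ≫ Spec.map φ, ?_⟩
  have h : (Y.toSpecΓ ≫ Spec.map φ).appTop = (Scheme.ΓSpecIso R).hom ≫ φ := by
    rw [Scheme.Hom.comp_appTop, Scheme.toSpecΓ_appTop]
    exact Scheme.ΓSpecIso_naturality φ
  exact h

/-- A faithfully flat algebra over the ring of functions of a scheme defines an fpqc covering. -/
lemma exists_sieve_of_faithfullyFlat {X : Scheme.{u}} {R : CommRingCat.{u}}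
    (φ : Γ(X, ⊤) ⟶ R) (hφ : φ.hom.FaithfullyFlat) :
    ∃ S ∈ Scheme.fpqcTopology X, ∀ ⦃Z : Scheme.{u}⦄ (g : Z ⟶ X), S g →
      ∃ ψ : R ⟶ Γ(Z, ⊤), φ ≫ ψ = g.appTop := by
  obtain ⟨h1, h2⟩ := (flat_and_surjective_SpecMap_iff φ).2 hφ
  -- The faithfully flat algebra covers Spec Γ(X), and the covering of X is its pullback along X →
  -- Spec Γ(X). The second projection supplies the homomorphism `ψ`.
  refine ⟨_, Precoverage.generate_mem_toGrothendieck
    (Scheme.Hom.singleton_mem_fpqcPrecoverage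
      (Limits.pullback.fst X.toSpecΓ (Spec.map φ))), ?_⟩
  rintro Z _ ⟨_, h, _, ⟨⟩, rfl⟩
  refine ⟨(Scheme.ΓSpecIso R).inv ≫ (h ≫ Limits.pullback.snd X.toSpecΓ (Spec.map φ)).appTop, ?_⟩
  have h3 : (h ≫ Limits.pullback.fst X.toSpecΓ (Spec.map φ)) ≫ X.toSpecΓ =
      (h ≫ Limits.pullback.snd X.toSpecΓ (Spec.map φ)) ≫ Spec.map φ := by
    rw [Category.assoc, Category.assoc, Limits.pullback.condition]
  have h4 := congrArg Scheme.Hom.appTop h3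
  rw [Scheme.Hom.comp_appTop, Scheme.Hom.comp_appTop _ (Spec.map φ), Scheme.toSpecΓ_appTop] at h4
  refine (Category.assoc _ _ _).symm.trans ?_
  rw [Scheme.ΓSpecIso_inv_naturality, Category.assoc, ← h4, Iso.inv_hom_id_assoc]

/-- The Frobenius of the ring scheme of Witt vectors is surjective for the fpqc topology. -/
lemma exists_sieve_frobenius_eq {X : Scheme.{u}} (w : WittVector p Γ(X, ⊤)) :
    ∃ S ∈ Scheme.fpqcTopology X, ∀ ⦃Z : Scheme.{u}⦄ (g : Z ⟶ X), S g →
      ∃ v : WittVector p Γ(Z, ⊤), WittVector.frobenius v = WittVector.map g.appTop.hom w := by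
  obtain ⟨R', i₁, i₂, v, h1, h2, -⟩ := WittVector.exists_faithfullyFlat_frobenius_eq.{u, u} p w
  obtain ⟨S, hS, hS'⟩ := exists_sieve_of_faithfullyFlat (R := CommRingCat.of R')
    (CommRingCat.ofHom i₂.algebraMap) (RingHom.faithfullyFlat_algebraMap_iff.2 h1)
  refine ⟨S, hS, fun Z g hg => ?_⟩
  obtain ⟨ψ, hψ⟩ := hS' g hg
  refine ⟨WittVector.map ψ.hom v, ?_⟩
  rw [WittVector.frobenius_map, h2]
  exact congrArg (fun χ => WittVector.map (CommRingCat.Hom.hom χ) w) hψ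

lemma WittVector.exists_verschiebung_eq {R : Type*} [CommRing R] (w : WittVector p R)
    (h : w.coeff 0 = 0) : ∃ v, WittVector.verschiebung v = w :=
  ⟨_, (WittVector.eq_iterate_verschiebung (n := 1) fun i hi => by
    rwa [Nat.lt_one_iff.1 hi]).symm⟩

variable (p) in
/-- The homomorphism `𝔾ₐ^♯ ⟶ W` identifying `𝔾ₐ^♯` with the kernel of the Frobenius. -/
noncomputable def sharpToWitt : GaSharp.{u} p ⟶ Witt.{u} p :=
  Functor.whiskerLeft Scheme.Γ
    { app := fun R => AddCommGrpCat.ofHom (sharpPoints.toWitt p (R := R))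
      naturality := fun _ _ _ => rfl }

variable (p) in
lemma isWittLift_sharpToWitt : IsWittLift (sharpToWitt.{u} p) where
  comp_F := by
    ext X x
    exact sharpPoints.frobenius_toWitt p (R := Scheme.Γ.obj X) x
  comp_toGa := by
    ext X x
    exact sharpPoints.toWitt_coeff_zero p (R := Scheme.Γ.obj X) x

namespace IsWittLift

variable {σ : GaSharp.{u} p ⟶ Witt.{u} p} (hσ : IsWittLift σ)
include hσ

lemma frobenius_app (X : Scheme.{u}ᵒᵖ) (x : sharpPoints p (Scheme.Γ.obj X)) :
    WittVector.frobenius (p := p) (R := Scheme.Γ.obj X) ((σ.app X).hom x) = 0 :=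
  DFunLike.congr_fun (congrArg AddCommGrpCat.Hom.hom (NatTrans.congr_app hσ.comp_F X)) x

lemma app_coeff_zero (X : Scheme.{u}ᵒᵖ) (x : sharpPoints p (Scheme.Γ.obj X)) :
    WittVector.coeff (p := p) (R := Scheme.Γ.obj X) ((σ.app X).hom x) 0 = sharpPoints.toGa x :=
  DFunLike.congr_fun (congrArg AddCommGrpCat.Hom.hom (NatTrans.congr_app hσ.comp_toGa X)) x

/-- Every point is a pullback of the universal point over the spectrum of the coordinate ring. By
naturality it suffices to compare there, where global functions are torsion-free and the two
defining conditions on σ determine the Witt vector. -/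
lemma app_eq (X : Scheme.{u}ᵒᵖ) (x : sharpPoints p (Scheme.Γ.obj X)) :
    (σ.app X).hom x = sharpPoints.toWitt p x := by
  let R : CommRingCat.{u} := CommRingCat.of (ULift.{u} (Sharp.Coord p))
  let φ : R ⟶ Scheme.Γ.obj X := CommRingCat.ofHom
    ((sharpPoints.hom x).toRingHom.comp ULift.ringEquiv.toRingHom)
  obtain ⟨g, hg⟩ := exists_map_op_eq (Y := X.unop) φ
  let e : Scheme.Γ.obj (op (Spec R)) ≅ R := Scheme.ΓSpecIso R
  let ξ : sharpPoints p (Scheme.Γ.obj (op (Spec R))) := sharpPoints.of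
    (Sharp.toAlgHom (e.inv.hom.comp ULift.ringEquiv.symm.toRingHom))
  have hξ : sharpPoints.map (Scheme.Γ.map g.op).hom ξ = x := by
    refine sharpPoints.hom_injective (AlgHom.ext fun a => ?_)
    have h1 : e.inv ≫ Scheme.Γ.map g.op = φ := by rw [hg]; exact Iso.inv_hom_id_assoc _ _
    exact DFunLike.congr_fun (congrArg CommRingCat.Hom.hom h1) (ULift.up a)
  have hξ' : (σ.app (op (Spec R))).hom ξ = sharpPoints.toWitt p ξ := by
    refine WittVector.eq_of_frobenius_eq (T := Scheme.Γ.obj (op (Spec R))) (fun t ht => ?_) ?_ ?_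
    · have h1 : (p : Sharp.Coord p) * (e.hom.hom t).down = 0 := by
        have h2 := congrArg ULift.down (congrArg e.hom.hom ht)
        rw [map_mul, map_natCast, map_zero] at h2
        exact h2
      have h2 : (e.hom.hom t).down = 0 := Sharp.cancel hp.out (by rw [h1, mul_zero])
      have h3 : e.hom.hom t = 0 := ULift.ext _ _ h2
      have h4 := DFunLike.congr_fun (congrArg CommRingCat.Hom.hom e.hom_inv_id) t
      refine h4.symm.trans ((congrArg e.inv.hom h3).trans (map_zero _))
    · rw [hσ.frobenius_app, sharpPoints.frobenius_toWitt]
    · rw [hσ.app_coeff_zero, sharpPoints.toWitt_coeff_zero]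
  have h5 : (σ.app X).hom (sharpPoints.map (Scheme.Γ.map g.op).hom ξ) =
      WittVector.map (Scheme.Γ.map g.op).hom ((σ.app (op (Spec R))).hom ξ) :=
    DFunLike.congr_fun (congrArg AddCommGrpCat.Hom.hom (σ.naturality g.op)) ξ
  rw [hξ, hξ', ← sharpPoints.map_toWitt, hξ] at h5
  exact h5

lemma eq_sharpToWitt : σ = sharpToWitt p := by
  ext X x
  exact hσ.app_eq X x

/-- If w and σ(x) have the same zeroth coordinate, their difference is V(v) for a v that is unique
since V is injective. Teichmüller representatives lift sections of 𝔾ₐ without passing to a covering.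
-/
lemma isLocalEquiv_middleToSharp : (middleToSharp σ hσ).IsLocalEquiv where
  exists_lift Y b x h := by
    let R := Scheme.Γ.obj (op Y)
    let w : WittVector p R := b
    let s : WittVector p R := (σ.app (op Y)).hom x
    have h1 : w.coeff 0 = s.coeff 0 := h.trans (hσ.app_coeff_zero (op Y) x).symm
    obtain ⟨v, hv⟩ := WittVector.exists_verschiebung_eq (w - s) (by
      have h2 : WittVector.constantCoeff (w - s) = WittVector.constantCoeff w -
        WittVector.constantCoeff s := map_sub _ _ _
      exact h2.trans (sub_eq_zero.2 h1))
    exact ⟨(x, v), rfl, (congrArg (s + ·) hv).trans (add_sub_cancel s w)⟩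
  eq_zero Y a h h' := by
    obtain ⟨x, v⟩ := a
    obtain rfl : x = 0 := h
    have h1 : WittVector.verschiebung (p := p) (R := Scheme.Γ.obj (op Y)) v = 0 := by
      let s : WittVector p (Scheme.Γ.obj (op Y)) :=
        (σ.app (op Y)).hom (0 : sharpPoints p (Scheme.Γ.obj (op Y)))
      have h2 : s + WittVector.verschiebung v = 0 := h'
      have h3 : s = 0 := map_zero (σ.app (op Y)).hom
      rwa [h3, zero_add] at h2
    exact Prod.ext rfl (WittVector.verschiebung_injective p _ (h1.trans (map_zero _).symm))
  exists_d Y x := ⟨WittVector.teichmuller p (R := Scheme.Γ.obj (op Y)) _,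
    WittVector.teichmuller_coeff_zero p (R := Scheme.Γ.obj (op Y)) _⟩
  locally_surjective Y b := ⟨⊤, Scheme.fpqcTopology.top_mem Y, fun Z g _ =>
    ⟨WittVector.teichmuller p (R := Scheme.Γ.obj (op Z)) _,
      WittVector.teichmuller_coeff_zero p (R := Scheme.Γ.obj (op Z)) _⟩⟩

/-- Since FV = p, the equation F(w) = pv means that w - V(v) lies in ker F, hence equals σ(x) for a
unique x; the same identity lifts pv to V(v). Only surjectivity of F requires an fpqc covering. -/
lemma isLocalEquiv_middleToWitt : (middleToWitt σ hσ).IsLocalEquiv where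
  exists_lift Y b v h := by
    let R := Scheme.Γ.obj (op Y)
    let w : WittVector p R := b
    let v' : WittVector p R := v
    have h1 : WittVector.frobenius w = p • v' := h
    obtain ⟨x, hx⟩ := sharpPoints.exists_toWitt_eq p (w - WittVector.verschiebung v') (by
      rw [map_sub, h1, WittVector.frobenius_verschiebung, nsmul_eq_mul, mul_comm, sub_self])
    refine ⟨(x, v'), rfl, ?_⟩
    exact (congrArg (fun s : WittVector p R => s + WittVector.verschiebung v')
      ((hσ.app_eq (op Y) x).trans hx)).trans (sub_add_cancel w _)
  eq_zero Y a h h' := by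
    obtain ⟨x, v⟩ := a
    obtain rfl : v = 0 := h
    have h1 : sharpPoints.toWitt p x = 0 := by
      let s : WittVector p (Scheme.Γ.obj (op Y)) := (σ.app (op Y)).hom x
      have h2 : s + WittVector.verschiebung 0 = 0 := h'
      rw [map_zero, add_zero] at h2
      exact (hσ.app_eq (op Y) x).symm.trans h2
    exact Prod.ext (sharpPoints.toWitt_injective p (h1.trans (map_zero _).symm)) rfl
  exists_d Y v := ⟨WittVector.verschiebung (p := p) (R := Scheme.Γ.obj (op Y)) v, by
    refine (WittVector.frobenius_verschiebung (R := Scheme.Γ.obj (op Y)) v).trans ?_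
    exact (mul_comm _ _).trans (nsmul_eq_mul (α := WittVector p (Scheme.Γ.obj (op Y))) p v).symm⟩
  locally_surjective Y w := exists_sieve_frobenius_eq (X := Y) w

end IsWittLift

end Geometry

theorem propositionp (p : ℕ) [Fact p.Prime] :
    (∃! σ : GaSharp.{u} p ⟶ Witt.{u} p, IsWittLift σ) ∧
    ∀ (σ : GaSharp.{u} p ⟶ Witt.{u} p) (hσ : IsWittLift σ),
      (middleToSharp σ hσ).coneMap.IsEquivalence ∧
      ∃ Φ : PicardStack.Hom (sharpComplex.{u} p).cone (wittComplex.{u} p).cone,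
        Φ.IsEquivalence ∧
        Nonempty (PicardStack.Hom.TwoHom ((middleToSharp σ hσ).coneMap.comp Φ)
          (middleToWitt σ hσ).coneMap) :=
  ⟨⟨sharpToWitt p, isWittLift_sharpToWitt p, fun _ hσ => hσ.eq_sharpToWitt⟩,
    fun _ hσ => ⟨hσ.isLocalEquiv_middleToSharp.isEquivalence_coneMap,
      TwoTerm.Hom.exists_isEquivalence hσ.isLocalEquiv_middleToSharp
        hσ.isLocalEquiv_middleToWitt⟩⟩
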